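/- Let $n\ge 1$, let $\mathbb H$ be the quaternions, $\mathcal Q\subset\mathbb H$ the imaginary quaternions, and $\langle\mathbf a,\mathbf b\rangle=\mathbf a\,\overline{\mathbf b}^{\,t}$ for row vectors $\mathbf a,\mathbf b\in\mathbb H^{n-1}$ (and $\langle \mathrm a,\mathrm b\rangle=\mathrm a\overline{\mathrm b}$ for scalars). For $\mathrm a,\mathrm b\in\mathcal Q$ put $C(\mathrm a,\mathrm b)=\mathrm a\mathrm b-\mathrm b\mathrm a$, $A(\mathrm a,\mathrm b)=\mathrm a\mathrm b+\mathrm b\mathrm a$; for $\mathbf a,\mathbf b\in\mathbb H^{n-1}$ put $C(\mathbf a,\mathbf b)=\langle\mathbf a,\mathbf b\rangle-\langle\mathbf b,\mathbf a\rangle$, $A(\mathbf a,\mathbf b)=\langle\mathbf a,\mathbf b\rangle+\langle\mathbf b,\mathbf a\rangle$, $\mathbf C(\mathbf a,\mathbf b)=\overline{\mathbf a}^{\,t}\mathbf b-\overline{\mathbf b}^{\,t}\mathbf a$. Let $J^\infty=(x,\mathrm u,\mathbf u,\mathrm u_x,\mathbf u_x,\dots)$ be the $x$-jet space of $\mathrm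 u\in\mathcal Q$, $\mathbf u\in\mathbb H^{n-1}$. A function on $J^\infty$ is a smooth function of $x$ and finitely many of the jet variables; $D_x$ is the total $x$-derivative. On the total $x$-derivatives of such functions, $D_x^{-1}$ is the inverse of $D_x$ with vanishing constant of integration (i.e. $D_x^{-1}f$ vanishes at the point $x=0$, $\mathrm u_{(k)}=0$, $\mathbf u_{(k)}=0$ for all $k$). A functional $\mathfrak G=\int G\,dx$ is a real function $G$ on $J^\infty$ modulo total $x$-derivatives. An evolutionary vector field $\mathrm X=\mathrm h\cdot\partial/\partial\mathrm u+\mathrm{Re}(\mathbf h\cdot\partial/\partial\mathbf u)$, given by functions $\mathrm h\in\mathcal Q$, $\mathbf h\in\mathbb H^{n-1}$ on $J^\infty$, acts on functions and functionals through its prolongation. The variational derivatives of $\mathfrak G$ are defined by $$\int \mathrm{pr}(\mathrm X)G\,dx=\mathrm{Re}\int\big(\langle\mathrm h,-\delta\mathfrak G/\delta\mathrm u\rangle+\langle\mathbf h,\delta\mathfrak G/\delta\overline{\mathbf u}\rangle\big)dx\quad\text{for all }(\mathrm h,\mathbf h),$$ and $\delta\mathfrak G$ denotes the pair $(-\delta\mathfrak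 G/\delta\mathrm u,\ \delta\mathfrak G/\delta\overline{\mathbf u})$. Define the operators $$\mathcal H\begin{pmatrix}\mathrm w\\\mathbf w\end{pmatrix}=\begin{pmatrix}D_x\mathrm w+C(\mathrm u,\mathrm w^\parallel)+\tfrac12C(\mathbf u,\mathbf w)\\ D_x\mathbf w-\mathrm w^\parallel\mathbf u+\mathbf u\mathbf W^\parallel+\mathrm w\mathbf u-\mathrm u\mathbf w\end{pmatrix},\quad \mathrm w^\parallel=-D_x^{-1}\big(C(\mathrm u,\mathrm w)-\tfrac12C(\mathbf u,\mathbf w)\big),\ \ \mathbf W^\parallel=D_x^{-1}\mathbf C(\mathbf u,\mathbf w),$$ $$\mathcal J\begin{pmatrix}\mathrm h\\\mathbf h\end{pmatrix}=\begin{pmatrix}\tfrac14D_x\mathrm h+\tfrac14C(\mathbf u,\mathbf h)+\mathrm h_\parallel\mathrm u\\ D_x\mathbf h+\tfrac12\mathrm h\mathbf u+\mathrm u\mathbf h+\mathrm h_\parallel\mathbf u\end{pmatrix},\quad \mathrm h_\parallel=D_x^{-1}\big(-\tfrac12A(\mathrm u,\mathrm h)+\tfrac12A(\mathbf u,\mathbf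 h)\big),$$ the recursion operator $\mathcal R=\mathcal H\mathcal J$ and $\mathcal R^*=\mathcal J\mathcal H$, the Poisson bracket $\{\mathfrak G_1,\mathfrak G_2\}=\mathrm{Re}\int\langle\delta\mathfrak G_1,\mathcal H\,\delta\mathfrak G_2\rangle dx$, and the symplectic $2$-form $\boldsymbol\omega(\mathrm X_1,\mathrm X_2)=\mathrm{Re}\int\langle\mathrm X_1(\mathrm u,\mathbf u),\mathcal J\,\mathrm X_2(\mathrm u,\mathbf u)\rangle dx$ (in both, $\langle\cdot,\cdot\rangle$ is the sum of the scalar and the vector inner products). For $l=0,1,2,\dots$ let $$\begin{pmatrix}\mathrm h_{(l)}\\\mathbf h_{(l)}\end{pmatrix}=\mathcal R^l\begin{pmatrix}\mathrm u_x\\\mathbf u_x\end{pmatrix},\qquad \begin{pmatrix}\mathrm w_{(l)}\\\mathbf w_{(l)}\end{pmatrix}=\mathcal R^{*l}\begin{pmatrix}\mathrm u\\\mathbf u\end{pmatrix},\qquad H^{(l)}=\frac1{1+2l}D_x^{-1}\mathrm{Re}\big(\langle\mathrm u,\mathrm h_{(l)}\rangle+\langle\mathbf u,\mathbf h_{(l)}\rangle\big).$$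 Theorem. $\mathcal R^*$ is the formal adjoint of $\mathcal R$ (on arguments for which all the inverses $D_x^{-1}$ exist), and for all $k,l\ge0$: 1. Every $D_x^{-1}$ occurring in these definitions is applied to a total $x$-derivative, so that $(\mathrm h_{(l)},\mathbf h_{(l)})$, $(\mathrm w_{(l)},\mathbf w_{(l)})$ and $H^{(l)}$ are functions on $J^\infty$. 2. The evolutionary vector fields $\mathrm X_{(l)}=\mathrm h_{(l)}\cdot\partial/\partial\mathrm u+\mathrm{Re}(\mathbf h_{(l)}\cdot\partial/\partial\mathbf u)$ commute: $[\mathrm X_{(k)},\mathrm X_{(l)}]=0$. 3. They are Hamiltonian with Hamiltonians $\mathfrak H^{(l)}=\int H^{(l)}dx$: every functional $\mathfrak G$ on $J^\infty$ has variational derivatives, and $\mathrm{pr}(\mathrm X_{(l)})\mathfrak G=\{\mathfrak G,\mathfrak H^{(l)}\}$. 4. $H^{(l)}=\frac1{2+4l}D_x^{-1}\big(-A(\mathrm u,\mathrm h_{(l)})+A(\mathbf u,\mathbf h_{(l)})\big)=\frac1{1+2l}\mathrm h_\parallel^{(l)}$, where $\mathrm h_\parallel^{(l)}$ is $\mathrm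 h_\parallel$ for $(\mathrm h,\mathbf h)=(\mathrm h_{(l)},\mathbf h_{(l)})$. 5. The variational derivatives of the Hamiltonians are $-\delta H^{(l)}/\delta\mathrm u=\mathrm w_{(l)}$, $\delta H^{(l)}/\delta\overline{\mathbf u}=\mathbf w_{(l)}$. 6. The covector fields $\mathrm w_{(l)}\cdot d\mathrm u+\mathrm{Re}(\mathbf w_{(l)}\cdot d\mathbf u)$ are involutive: $\{\mathfrak H^{(k)},\mathfrak H^{(l)}\}=\mathrm{Re}\int\big\langle(\mathrm w_{(k)},\mathbf w_{(k)}),\mathcal H(\mathrm w_{(l)},\mathbf w_{(l)})\big\rangle dx=0$. 7. They are dual to the Hamiltonian vector fields: for every evolutionary vector field $\mathrm X$ on $J^\infty$, $$\int\big(\mathrm w_{(l+1)}\cdot d\mathrm u+\mathrm{Re}(\mathbf w_{(l+1)}\cdot d\mathbf u)\big)\rfloor\mathrm X\,dx=\boldsymbol\omega(\mathrm X,\mathrm X_{(l)}).$$ -/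

import Mathlib

open scoped ContDiff Quaternion

namespace QuatHierarchy

noncomputable section

/-! ### Quaternionic algebra -/

/-- The space `𝒬` of imaginary quaternions. -/
def ImQ : Submodule ℝ ℍ[ℝ] where
  carrier := {q | q.re = 0}
  add_mem' := by
    intro a b ha hb
    simp only [Set.mem_ofPred_eq] at *
    simp [ha, hb]
  zero_mem' := by simp
  smul_mem' := by
    intro c a ha
    simp only [Set.mem_ofPred_eq] at *
    simp [ha]

/-- Quaternion row vectors with `m` components. -/
abbrev QVec (m : ℕ) : Type := Fin m → ℍ[ℝ]

/-- The space `𝒬 ⊕ ℍ ^ m` in which the pair (scalar, vector) takes its values. -/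
abbrev Val (m : ℕ) : Type := ImQ × QVec m

/-- The Hermitian inner product `⟨x, y⟩ = ∑ i, x i * conj (y i)`. -/
def herm {m : ℕ} (x y : QVec m) : ℍ[ℝ] := ∑ i, x i * star (y i)

/-- The commutator `C(a, b) = a b - b a` of imaginary quaternions. -/
def commQ (a b : ImQ) : ImQ :=
  ⟨(a : ℍ[ℝ]) * b - b * a, by
    change ((a : ℍ[ℝ]) * b - b * a).re = 0
    simp only [Quaternion.re_sub, Quaternion.re_mul]
    ring⟩

theorem star_herm {m : ℕ} (x y : QVec m) : star (herm x y) = herm y x := by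
  simp [herm]

/-- The commutator `C(a, b) = ⟨a, b⟩ - ⟨b, a⟩` of quaternion vectors. -/
def commV {m : ℕ} (a b : QVec m) : ImQ :=
  ⟨herm a b - herm b a, by
    change (herm a b - herm b a).re = 0
    rw [← star_herm a b]
    simp⟩

/-- The matrix commutator of quaternion vectors, `conj(a)ᵗ b - conj(b)ᵗ a`,
a skew-Hermitian quaternion matrix. -/
def commM {m : ℕ} (a b : QVec m) : Fin m → Fin m → ℍ[ℝ] :=
  fun i j => star (a i) * b j - star (b i) * a j

/-- The anticommutator `A(a, b) = a b + b a` of imaginary quaternions (a real number). -/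
def antiQ (a b : ImQ) : ℝ := ((a : ℍ[ℝ]) * b + b * a).re

theorem coe_antiQ (a b : ImQ) : ((antiQ a b : ℝ) : ℍ[ℝ]) = (a : ℍ[ℝ]) * b + b * a := by
  have ha : (a : ℍ[ℝ]).re = 0 := a.2
  have hb : (b : ℍ[ℝ]).re = 0 := b.2
  ext <;> simp [antiQ, ha, hb] <;> ring

/-- The anticommutator `A(a, b) = ⟨a, b⟩ + ⟨b, a⟩` of quaternion vectors (a real number). -/
def antiV {m : ℕ} (a b : QVec m) : ℝ := (herm a b + herm b a).re

theorem coe_antiV {m : ℕ} (a b : QVec m) :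
    ((antiV a b : ℝ) : ℍ[ℝ]) = herm a b + herm b a := by
  rw [antiV, ← star_herm a b]
  ext <;> simp

/-- Left multiplication of a quaternion vector by an imaginary quaternion. -/
def leftMul {m : ℕ} (a : ImQ) (v : QVec m) : QVec m := fun j => (a : ℍ[ℝ]) * v j

/-- The row vector `v` times the matrix `M`. -/
def vecMat {m : ℕ} (v : QVec m) (M : Fin m → Fin m → ℍ[ℝ]) : QVec m :=
  fun j => ∑ i, v i * M i j

/-- `Re (⟨a, b⟩ + ⟨𝐚, 𝐛⟩)` for pairs `(a, 𝐚)`, `(b, 𝐛)` in `𝒬 ⊕ ℍ ^ m`. -/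
def rePair {m : ℕ} (a b : Val m) : ℝ :=
  ((a.1 : ℍ[ℝ]) * star (b.1 : ℍ[ℝ]) + herm a.2 b.2).re

/-! ### Calculus on the jet space -/

/-- The infinite jet space: a point `p` consists of the value `p.1` of `x` and the values `p.2 k`
of the `k`-th `x`-derivative of the pair `(u, 𝐮)`, for all `k`. -/
abbrev Jet (m : ℕ) : Type := ℝ × (ℕ → Val m)

/-- A function on the jet space: it is smooth and depends only on `x` and on finitely many of
the derivatives of `(u, 𝐮)`. -/
def IsLocal {m : ℕ} {W : Type} [NormedAddCommGroup W] [NormedSpace ℝ W] (f : Jet m → W) : Prop :=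
  ∃ (k : ℕ) (F : ℝ × (Fin k → Val m) → W),
    ContDiff ℝ ∞ F ∧ ∀ p, f p = F (p.1, fun i => p.2 i)

/-- The total `x`-derivative `∂/∂x + u_x ∂/∂u + u_xx ∂/∂u_x + ⋯`. -/
def Dx {m : ℕ} {W : Type} [NormedAddCommGroup W] [NormedSpace ℝ W] (f : Jet m → W) : Jet m → W :=
  fun p => lineDeriv ℝ f p (1, fun k => p.2 (k + 1))

/-- `f` is the total derivative of a function on the jet space. -/
def IsTotalDeriv {m : ℕ} {W : Type} [NormedAddCommGroup W] [NormedSpace ℝ W]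
    (f : Jet m → W) : Prop :=
  ∃ g : Jet m → W, IsLocal g ∧ Dx g = f

open Classical in
/-- The formal inverse of `Dx`: on a total derivative `f` it is the function `g` on the jet space
with `Dx g = f` that vanishes at `x = 0, (u, 𝐮) = 0, (u, 𝐮)_x = 0, …`, so that no constant
of integration appears. (The value on other functions is a convention.) -/
def DxInv {m : ℕ} {W : Type} [NormedAddCommGroup W] [NormedSpace ℝ W]
    (f : Jet m → W) : Jet m → W :=
  if h : ∃ g : Jet m → W, IsLocal g ∧ Dx g = f ∧ g 0 = 0 then h.choose else 0

/-- Equality of the functionals `∫ f dx` and `∫ g dx`, that is, equality of densities modulo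
total `x`-derivatives. -/
def EqFunctional {m : ℕ} (f g : Jet m → ℝ) : Prop :=
  IsTotalDeriv (fun p => f p - g p)

/-- The prolongation to the jet space of the evolutionary vector field
`h · ∂/∂u + Re (𝐡 · ∂/∂𝐮)` with characteristic `X = (h, 𝐡)`, acting on functions:
the component along `∂/∂u_(k)` is the `k`-th total derivative of `X`. -/
def prolong {m : ℕ} {W : Type} [NormedAddCommGroup W] [NormedSpace ℝ W]
    (X : Jet m → Val m) (f : Jet m → W) : Jet m → W :=
  fun p => lineDeriv ℝ f p (0, fun k => Dx^[k] X p)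

/-- The density `Re (⟨f, g⟩ + ⟨𝐟, 𝐠⟩)`. -/
def pairing {m : ℕ} (f g : Jet m → Val m) : Jet m → ℝ := fun p => rePair (f p) (g p)

/-- `w = (-δ𝔊/δu, δ𝔊/δ(conj 𝐮))` is the pair of variational derivatives of `𝔊 = ∫ G dx`:
`∫ pr(X) G dx = ∫ Re ⟨X, w⟩ dx` for every evolutionary vector field `X`. -/
def IsVarDeriv {m : ℕ} (G : Jet m → ℝ) (w : Jet m → Val m) : Prop :=
  IsLocal w ∧
    ∀ X : Jet m → Val m, IsLocal X → EqFunctional (prolong X G) (pairing X w)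

open Classical in
/-- The pair of variational derivatives `(-δ𝔊/δu, δ𝔊/δ(conj 𝐮))` of `𝔊 = ∫ G dx`. -/
def varDeriv {m : ℕ} (G : Jet m → ℝ) : Jet m → Val m :=
  if h : ∃ w, IsVarDeriv G w then h.choose else 0

/-! ### The operators -/

/-- The coordinate function `(u, 𝐮)` on the jet space. -/
def uFun (m : ℕ) : Jet m → Val m := fun p => p.2 0

/-- The coordinate function `(u_x, 𝐮_x)` on the jet space. -/
def uxFun (m : ℕ) : Jet m → Val m := fun p => p.2 1

/-- The density `C(u, w) - ½ C(𝐮, 𝐰)`. -/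
def scalarCurr {m : ℕ} (w : Jet m → Val m) : Jet m → ImQ :=
  fun p => commQ (p.2 0).1 (w p).1 - (1 / 2 : ℝ) • commV (p.2 0).2 (w p).2

/-- The density `𝐂(𝐮, 𝐰)`. -/
def matrixCurr {m : ℕ} (w : Jet m → Val m) : Jet m → Fin m → Fin m → ℍ[ℝ] :=
  fun p => commM (p.2 0).2 (w p).2

/-- `w∥ = - Dx⁻¹ (C(u, w) - ½ C(𝐮, 𝐰))`. -/
def wPar {m : ℕ} (w : Jet m → Val m) : Jet m → ImQ := fun p => -DxInv (scalarCurr w) p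

/-- `𝐖∥ = Dx⁻¹ 𝐂(𝐮, 𝐰)`. -/
def WPar {m : ℕ} (w : Jet m → Val m) : Jet m → Fin m → Fin m → ℍ[ℝ] := DxInv (matrixCurr w)

/-- The operator `ℋ`:
`(w, 𝐰) ↦ (Dx w + C(u, w∥) + ½ C(𝐮, 𝐰), Dx 𝐰 - w∥ 𝐮 + 𝐮 𝐖∥ + w 𝐮 - u 𝐰)`. -/
def opH {m : ℕ} (w : Jet m → Val m) : Jet m → Val m := fun p =>
  (Dx (fun q => (w q).1) p + commQ (p.2 0).1 (wPar w p)
      + (1 / 2 : ℝ) • commV (p.2 0).2 (w p).2,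
   Dx (fun q => (w q).2) p - leftMul (wPar w p) (p.2 0).2 + vecMat (p.2 0).2 (WPar w p)
      + leftMul (w p).1 (p.2 0).2 - leftMul (p.2 0).1 (w p).2)

/-- The natural domain of `ℋ`: the inverse total derivatives in it exist on the jet space. -/
def DomH {m : ℕ} (w : Jet m → Val m) : Prop :=
  IsLocal w ∧ IsTotalDeriv (scalarCurr w) ∧ IsTotalDeriv (matrixCurr w)

/-- The density `½ (-A(u, h) + A(𝐮, 𝐡))`. -/
def realCurr {m : ℕ} (h : Jet m → Val m) : Jet m → ℝ :=
  fun p => (1 / 2) * (-antiQ (p.2 0).1 (h p).1 + antiV (p.2 0).2 (h p).2)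

/-- `h∥ = Dx⁻¹ (-½ A(u, h) + ½ A(𝐮, 𝐡))`. -/
def hPar {m : ℕ} (h : Jet m → Val m) : Jet m → ℝ := DxInv (realCurr h)

/-- The operator `𝒥`:
`(h, 𝐡) ↦ (¼ Dx h + ¼ C(𝐮, 𝐡) + h∥ u, Dx 𝐡 + ½ h 𝐮 + u 𝐡 + h∥ 𝐮)`. -/
def opJ {m : ℕ} (h : Jet m → Val m) : Jet m → Val m := fun p =>
  ((1 / 4 : ℝ) • Dx (fun q => (h q).1) p + (1 / 4 : ℝ) • commV (p.2 0).2 (h p).2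
      + hPar h p • (p.2 0).1,
   Dx (fun q => (h q).2) p + (1 / 2 : ℝ) • leftMul (h p).1 (p.2 0).2
      + leftMul (p.2 0).1 (h p).2 + hPar h p • (p.2 0).2)

/-- The natural domain of `𝒥`: the inverse total derivative in it exists on the jet space. -/
def DomJ {m : ℕ} (h : Jet m → Val m) : Prop := IsLocal h ∧ IsTotalDeriv (realCurr h)

/-- The recursion operator `ℛ = ℋ 𝒥`. -/
def opR {m : ℕ} (h : Jet m → Val m) : Jet m → Val m := opH (opJ h)

/-- The natural domain of `ℛ`. -/
def DomR {m : ℕ} (h : Jet m → Val m) : Prop := DomJ h ∧ DomH (opJ h)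

/-- The adjoint recursion operator `ℛ* = 𝒥* ℋ* = 𝒥 ℋ`. -/
def opRstar {m : ℕ} (w : Jet m → Val m) : Jet m → Val m := opJ (opH w)

/-- The natural domain of `ℛ*`. -/
def DomRstar {m : ℕ} (w : Jet m → Val m) : Prop := DomH w ∧ DomJ (opH w)

/-- The density of the Poisson bracket `{𝔊₁, 𝔊₂} = Re ∫ ⟨δ𝔊₁, ℋ δ𝔊₂⟩ dx`. -/
def poisson {m : ℕ} (G₁ G₂ : Jet m → ℝ) : Jet m → ℝ :=
  pairing (varDeriv G₁) (opH (varDeriv G₂))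

/-- The density of the symplectic form `ω(X₁, X₂) = Re ∫ ⟨X₁, 𝒥 X₂⟩ dx`. -/
def symp {m : ℕ} (X₁ X₂ : Jet m → Val m) : Jet m → ℝ := pairing X₁ (opJ X₂)

/-- The contraction `(w · du + Re (𝐰 · d𝐮)) ⌟ X` of a covector field with an evolutionary vector
field. -/
def contract {m : ℕ} (w X : Jet m → Val m) : Jet m → ℝ := pairing X w

/-! ### The hierarchies -/

/-- `(h_(l), 𝐡_(l)) = ℛ ^ l (u_x, 𝐮_x)`. -/
def hSeq (m l : ℕ) : Jet m → Val m := opR^[l] (uxFun m)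

/-- `(w_(l), 𝐰_(l)) = ℛ* ^ l (u, 𝐮)`. -/
def wSeq (m l : ℕ) : Jet m → Val m := opRstar^[l] (uFun m)

/-- `H^(l) = 1 / (1 + 2 l) * Dx⁻¹ Re (⟨u, h_(l)⟩ + ⟨𝐮, 𝐡_(l)⟩)`. -/
def Ham (m l : ℕ) : Jet m → ℝ :=
  fun p => 1 / (1 + 2 * (l : ℝ)) * DxInv (pairing (uFun m) (hSeq m l)) p

end

end QuatHierarchy

/-! Everything is encoded in quaternionic matrices of size m + 2 whose entries are local functions.
Let e = E₀₁ + E₁₀ (`eMat`), so e³ = e, and let u be the matrix `uMat`. The proof rests on one formal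
series V = e + V₁ z + V₂ z² + ⋯ with z D V = [e + z u, V] and V³ = V. It exists and is unique
(`exists_laxSolution`, `IsLaxSolution.unique`): at each order the Lax equation determines the part
of the new coefficient off the commutant of e, and the cubic equation determines the part in the
commutant. Both steps are algebraic, so no integration is performed and every coefficient is local.

Coefficientwise, D V_n - [u, V_n] = [e, V_(n+1)]. The components in the commutant of e say that the
currents under the inverse total derivatives are total derivatives, with primitives read off from
V_n; the other components are the operators ℋ and 𝒥. Uniqueness turns symmetries of the equation
into symmetries of V, which fix the shape of V_n and the constants of integration. The result is
`exists_hierarchy`: V_(2l+1) carries w_(l) and V_(2l+2) carries h_(l).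

Commutation: a flow δu = [e, V_(K+1)] forces z^K δV = [V_0 + ⋯ + V_K z^K, V], and the formula for δ
V_(N+1) is symmetric in the two flows (`IsLaxSolution.deriv_coeff_comm`).

Hamiltonians: `IsLaxSolution.trace_identity` says that tr(δV_(n+1) e) + n tr(V_n δu) is a total
derivative. For n = 2l + 1 this makes w_(l) the variational derivative of H^(l), and n is the source
of the factor 1/(1 + 2l).

Skew-adjointness of ℋ and 𝒥 is integration by parts for D - [u, ·] under the trace (`opH_skew`,
`opJ_skew`). It gives the adjointness statement and, by moving recursion operators across the
pairing, involutivity. Variational derivatives exist by integration by parts and are unique by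
`eq_zero_of_pairing`. -/

namespace QuatHierarchy
noncomputable section

/-! ### Local functions and derivatives along vector fields -/

section Calculus

variable {m : ℕ} {W W' W'' : Type} [NormedAddCommGroup W] [NormedSpace ℝ W]
  [NormedAddCommGroup W'] [NormedSpace ℝ W'] [NormedAddCommGroup W''] [NormedSpace ℝ W'']

/-- Truncation of a jet to its first `k` derivatives. -/
def jetProj (m k : ℕ) : Jet m →ₗ[ℝ] ℝ × (Fin k → Val m) where
  toFun p := (p.1, fun i => p.2 i)
  map_add' _ _ := rfl
  map_smul' _ _ := rfl

theorem jetProj_apply (k : ℕ) (p : Jet m) : jetProj m k p = (p.1, fun i : Fin k => p.2 i) := rfl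

/-- `f` is a smooth function of `x` and the first `k` derivatives. -/
def IsLocalOrder (k : ℕ) (f : Jet m → W) : Prop :=
  ∃ F : ℝ × (Fin k → Val m) → W, ContDiff ℝ ∞ F ∧ ∀ p, f p = F (jetProj m k p)

theorem isLocal_iff {f : Jet m → W} : IsLocal f ↔ ∃ k, IsLocalOrder k f := Iff.rfl

theorem IsLocalOrder.isLocal {k : ℕ} {f : Jet m → W} (h : IsLocalOrder k f) : IsLocal f := ⟨k, h⟩

theorem IsLocalOrder.mono {k l : ℕ} (hkl : k ≤ l) {f : Jet m → W} (h : IsLocalOrder k f) :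
    IsLocalOrder l f := by
  obtain ⟨F, hF, hf⟩ := h
  refine ⟨fun q => F (q.1, fun i => q.2 (Fin.castLE hkl i)), hF.comp ?_, fun p => hf p⟩
  fun_prop

theorem IsLocalOrder.prodMk {k : ℕ} {f : Jet m → W} {g : Jet m → W'} (hf : IsLocalOrder k f)
    (hg : IsLocalOrder k g) : IsLocalOrder k (fun p => (f p, g p)) := by
  obtain ⟨F, hF, hf⟩ := hf
  obtain ⟨G, hG, hg⟩ := hg
  exact ⟨fun q => (F q, G q), hF.prodMk hG, fun p => by simp [hf p, hg p]⟩

theorem IsLocal.exists_common {f : Jet m → W} {g : Jet m → W'} (hf : IsLocal f) (hg : IsLocal g) :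
    ∃ k, IsLocalOrder k f ∧ IsLocalOrder k g := by
  obtain ⟨k, hf⟩ := isLocal_iff.1 hf
  obtain ⟨l, hg⟩ := isLocal_iff.1 hg
  exact ⟨max k l, hf.mono (le_max_left _ _), hg.mono (le_max_right _ _)⟩

theorem IsLocal.prodMk {f : Jet m → W} {g : Jet m → W'} (hf : IsLocal f) (hg : IsLocal g) :
    IsLocal (fun p => (f p, g p)) := by
  obtain ⟨k, h1, h2⟩ := hf.exists_common hg
  exact (h1.prodMk h2).isLocal

theorem IsLocalOrder.comp {k : ℕ} {f : Jet m → W} (hf : IsLocalOrder k f) {G : W → W'}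
    (hG : ContDiff ℝ ∞ G) : IsLocalOrder k (fun p => G (f p)) := by
  obtain ⟨F, hF, hf⟩ := hf
  exact ⟨fun q => G (F q), hG.comp hF, fun p => by simp [hf p]⟩

theorem IsLocal.comp {f : Jet m → W} (hf : IsLocal f) {G : W → W'}
    (hG : ContDiff ℝ ∞ G) : IsLocal (fun p => G (f p)) := by
  obtain ⟨k, hf⟩ := isLocal_iff.1 hf
  exact (hf.comp hG).isLocal

theorem isLocal_pi {ι : Type} [Fintype ι] {E : ι → Type} [∀ i, NormedAddCommGroup (E i)]
    [∀ i, NormedSpace ℝ (E i)] {f : ∀ i, Jet m → E i} (hf : ∀ i, IsLocal (f i)) :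
    IsLocal (fun p i => f i p) := by
  choose k hk using fun i => isLocal_iff.1 (hf i)
  choose F hF hf using fun i => (hk i).mono (Finset.le_sup (f := k) (Finset.mem_univ i))
  exact ⟨Finset.univ.sup k, fun q i => F i q, contDiff_pi.2 hF, fun p => funext fun i => hf i p⟩

theorem isLocal_const (c : W) : IsLocal (fun _ : Jet m => c) :=
  ⟨0, fun _ => c, contDiff_const, fun _ => rfl⟩

theorem isLocalOrder_coord (k : ℕ) : IsLocalOrder (k + 1) (fun p : Jet m => p.2 k) :=
  ⟨fun q => q.2 (Fin.last k), by fun_prop, fun _ => rfl⟩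

theorem isLocal_coord (k : ℕ) : IsLocal (fun p : Jet m => p.2 k) := (isLocalOrder_coord k).isLocal

theorem isLocal_jetProj (k : ℕ) : IsLocal (fun p : Jet m => jetProj m k p) :=
  ⟨k, id, contDiff_id, fun _ => rfl⟩

theorem IsLocal.clm (L : W →L[ℝ] W') {f : Jet m → W} (hf : IsLocal f) :
    IsLocal (fun p => L (f p)) := hf.comp L.contDiff

theorem IsLocal.bilin (B : W →L[ℝ] W' →L[ℝ] W'') {f : Jet m → W} {g : Jet m → W'}
    (hf : IsLocal f) (hg : IsLocal g) : IsLocal (fun p => B (f p) (g p)) :=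
  (hf.prodMk hg).comp (G := fun x : W × W' => B x.1 x.2) B.isBoundedBilinearMap.contDiff

theorem IsLocal.add {f g : Jet m → W} (hf : IsLocal f) (hg : IsLocal g) :
    IsLocal (fun p => f p + g p) :=
  (hf.prodMk hg).comp (G := fun x : W × W => x.1 + x.2) (by fun_prop)

theorem IsLocal.sub {f g : Jet m → W} (hf : IsLocal f) (hg : IsLocal g) :
    IsLocal (fun p => f p - g p) :=
  (hf.prodMk hg).comp (G := fun x : W × W => x.1 - x.2) (by fun_prop)

theorem IsLocal.neg {f : Jet m → W} (hf : IsLocal f) : IsLocal (fun p => -f p) :=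
  hf.comp contDiff_neg

theorem IsLocal.const_smul (c : ℝ) {f : Jet m → W} (hf : IsLocal f) :
    IsLocal (fun p => c • f p) := hf.comp (contDiff_const_smul c)

theorem IsLocal.smul {c : Jet m → ℝ} {f : Jet m → W} (hc : IsLocal c) (hf : IsLocal f) :
    IsLocal (fun p => c p • f p) := IsLocal.bilin (ContinuousLinearMap.lsmul ℝ ℝ) hc hf

/-- Directional derivative along a vector field on the jet space. -/
def along (v : Jet m → Jet m) (f : Jet m → W) : Jet m → W := fun p => lineDeriv ℝ f p (v p)

/-- The vector field whose derivative is `Dx`. -/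
def totalField (m : ℕ) : Jet m → Jet m := fun p => (1, fun k => p.2 (k + 1))

/-- The prolonged vector field with characteristic `X`. -/
def prolongField (X : Jet m → Val m) : Jet m → Jet m := fun p => (0, fun k => Dx^[k] X p)

/-- Vector fields with local components. -/
def IsLocalField (v : Jet m → Jet m) : Prop :=
  IsLocal (fun p => (v p).1) ∧ ∀ k, IsLocal (fun p => (v p).2 k)

theorem isLocalField_total : IsLocalField (totalField m) :=
  ⟨isLocal_const 1, fun k => isLocal_coord (k + 1)⟩

theorem IsLocalField.jetProj {v : Jet m → Jet m} (hv : IsLocalField v) (k : ℕ) :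
    IsLocal (fun p => jetProj m k (v p)) :=
  hv.1.prodMk (isLocal_pi fun i : Fin k => hv.2 i)

/-- The jet space is an infinite product without a norm, so derivatives are taken along lines and
computed as Fréchet derivatives on a finite truncation. -/
theorem lineDeriv_comp_jetProj {k : ℕ} {F : ℝ × (Fin k → Val m) → W} (hF : ContDiff ℝ ∞ F)
    (p v : Jet m) : lineDeriv ℝ (fun p => F (jetProj m k p)) p v =
      fderiv ℝ F (jetProj m k p) (jetProj m k v) := by
  rw [← (hF.differentiable (by simp) _).lineDeriv_eq_fderiv]
  simp [lineDeriv]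

theorem lineDifferentiableAt_of_isLocal {f : Jet m → W} (hf : IsLocal f) (p v : Jet m) :
    LineDifferentiableAt ℝ f p v := by
  obtain ⟨k, F, hF, hf⟩ := isLocal_iff.1 hf
  have : f = fun p => F (jetProj m k p) := funext hf
  subst this
  have h := (hF.differentiable (by simp) (jetProj m k p)).lineDifferentiableAt
    (v := jetProj m k v)
  simpa [LineDifferentiableAt] using h

theorem lineDeriv_smooth_comp {f : Jet m → W} (hf : IsLocal f) {G : W → W'}
    (hG : ContDiff ℝ ∞ G) (p v : Jet m) :
    lineDeriv ℝ (fun q => G (f q)) p v = fderiv ℝ G (f p) (lineDeriv ℝ f p v) := by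
  obtain ⟨k, F, hF, hf⟩ := isLocal_iff.1 hf
  have : f = fun p => F (jetProj m k p) := funext hf
  subst this
  have := lineDeriv_comp_jetProj (hG.comp hF) p v
  simp only [Function.comp_def] at this
  rw [this, lineDeriv_comp_jetProj hF, fderiv_fun_comp _ (hG.differentiable (by simp) _)
    (hF.differentiable (by simp) _)]
  rfl

theorem lineDeriv_prodMk {f : Jet m → W} {g : Jet m → W'} (hf : IsLocal f) (hg : IsLocal g)
    (p v : Jet m) :
    lineDeriv ℝ (fun q => (f q, g q)) p v = (lineDeriv ℝ f p v, lineDeriv ℝ g p v) :=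
  HasDerivAt.deriv ((lineDifferentiableAt_of_isLocal hf p v).hasDerivAt.prodMk
    (lineDifferentiableAt_of_isLocal hg p v).hasDerivAt)

theorem lineDeriv_clm (L : W →L[ℝ] W') {f : Jet m → W} (hf : IsLocal f) (p v : Jet m) :
    lineDeriv ℝ (fun q => L (f q)) p v = L (lineDeriv ℝ f p v) := by
  rw [lineDeriv_smooth_comp hf L.contDiff, L.fderiv]

theorem lineDeriv_bilin (B : W →L[ℝ] W' →L[ℝ] W'') {f : Jet m → W} {g : Jet m → W'}
    (hf : IsLocal f) (hg : IsLocal g) (p v : Jet m) :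
    lineDeriv ℝ (fun q => B (f q) (g q)) p v =
      B (lineDeriv ℝ f p v) (g p) + B (f p) (lineDeriv ℝ g p v) := by
  have h := lineDeriv_smooth_comp (hf.prodMk hg) (G := fun x : W × W' => B x.1 x.2)
    B.isBoundedBilinearMap.contDiff p v
  rw [lineDeriv_prodMk hf hg] at h
  refine h.trans ?_
  rw [B.isBoundedBilinearMap.fderiv]
  simp [add_comm]

theorem lineDeriv_coord (k : ℕ) (p v : Jet m) :
    lineDeriv ℝ (fun p : Jet m => p.2 k) p v = v.2 k := by
  have h := lineDeriv_comp_jetProj (m := m) (k := k + 1) (F := fun q => q.2 (Fin.last k))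
    (by fun_prop) p v
  refine h.trans ?_
  have : (fun q : ℝ × (Fin (k + 1) → Val m) => q.2 (Fin.last k)) =
    ((ContinuousLinearMap.proj (R := ℝ) (Fin.last k)).comp
      (ContinuousLinearMap.snd ℝ ℝ (Fin (k + 1) → Val m))) := rfl
  rw [this, ContinuousLinearMap.fderiv]
  rfl

theorem lineDeriv_pi {ι : Type} [Fintype ι] {E : ι → Type} [∀ i, NormedAddCommGroup (E i)]
    [∀ i, NormedSpace ℝ (E i)] {f : ∀ i, Jet m → E i} (hf : ∀ i, IsLocal (f i)) (p v : Jet m) :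
    lineDeriv ℝ (fun q i => f i q) p v = fun i => lineDeriv ℝ (f i) p v :=
  HasDerivAt.deriv (hasDerivAt_pi.2 fun i =>
    (lineDifferentiableAt_of_isLocal (hf i) p v).hasDerivAt)

theorem lineDeriv_add {f g : Jet m → W} (hf : IsLocal f) (hg : IsLocal g) (p v : Jet m) :
    lineDeriv ℝ (fun q => f q + g q) p v = lineDeriv ℝ f p v + lineDeriv ℝ g p v :=
  HasDerivAt.deriv ((lineDifferentiableAt_of_isLocal hf p v).hasDerivAt.add
    (lineDifferentiableAt_of_isLocal hg p v).hasDerivAt)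

theorem IsLocal.along {v : Jet m → Jet m} (hv : IsLocalField v) {f : Jet m → W} (hf : IsLocal f) :
    IsLocal (along v f) := by
  obtain ⟨k, F, hF, hf⟩ := isLocal_iff.1 hf
  have : f = fun p => F (_root_.QuatHierarchy.jetProj m k p) := funext hf
  subst this
  have h1 : IsLocal (fun p : Jet m => fderiv ℝ F (_root_.QuatHierarchy.jetProj m k p)) :=
    (isLocal_jetProj k).comp (hF.fderiv_right (m := ∞) (by simp))
  have h2 := h1.bilin (ContinuousLinearMap.id ℝ _) (hv.jetProj k)
  have h3 : QuatHierarchy.along v (fun p => F (_root_.QuatHierarchy.jetProj m k p)) = _ :=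
    funext fun p => lineDeriv_comp_jetProj hF p (v p)
  rw [h3]
  exact h2

theorem IsLocal.Dx {f : Jet m → W} (hf : IsLocal f) : IsLocal (Dx f) :=
  hf.along isLocalField_total

theorem IsLocal.iterate_Dx {f : Jet m → W} (hf : IsLocal f) (k : ℕ) :
    IsLocal (QuatHierarchy.Dx^[k] f) := by
  induction k with
  | zero => exact hf
  | succ k ih => rw [Function.iterate_succ_apply']; exact ih.Dx

theorem isLocalField_prolong {X : Jet m → Val m} (hX : IsLocal X) :
    IsLocalField (prolongField X) :=
  ⟨isLocal_const 0, fun k => hX.iterate_Dx k⟩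

/-- Derivatives along vector fields with commuting components commute. -/
theorem along_comm {v w : Jet m → Jet m} (hv : IsLocalField v) (hw : IsLocalField w)
    (h1 : along v (fun p => (w p).1) = along w (fun p => (v p).1))
    (h2 : ∀ k, along v (fun p => (w p).2 k) = along w (fun p => (v p).2 k))
    {f : Jet m → W} (hf : IsLocal f) : along v (along w f) = along w (along v f) := by
  obtain ⟨k, F, hF, hf⟩ := isLocal_iff.1 hf
  have : f = fun p => F (jetProj m k p) := funext hf
  subst this
  have hl (v : Jet m → Jet m) : along v (fun p => F (jetProj m k p)) =
      fun p => fderiv ℝ F (jetProj m k p) (jetProj m k (v p)) :=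
    funext fun p => lineDeriv_comp_jetProj hF p (v p)
  have hF' : ContDiff ℝ ∞ (fderiv ℝ F) := hF.fderiv_right (m := ∞) (by simp)
  have h3 : IsLocal (fun p : Jet m => fderiv ℝ F (jetProj m k p)) := (isLocal_jetProj k).comp hF'
  have hproj (v w : Jet m → Jet m) (hw : IsLocalField w) :
      along v (fun p => jetProj m k (w p)) = fun p =>
        (along v (fun p => (w p).1) p, fun i : Fin k => along v (fun p => (w p).2 i) p) := by
    funext p
    refine (lineDeriv_prodMk hw.1 (isLocal_pi fun i : Fin k => hw.2 i) p (v p)).trans ?_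
    rw [lineDeriv_pi (fun i : Fin k => hw.2 i)]
    rfl
  have key (v w : Jet m → Jet m) (hw : IsLocalField w) (p : Jet m) :
      along v (fun p => fderiv ℝ F (jetProj m k p) (jetProj m k (w p))) p =
      fderiv ℝ (fderiv ℝ F) (jetProj m k p) (jetProj m k (v p)) (jetProj m k (w p)) +
      fderiv ℝ F (jetProj m k p) (along v (fun p => jetProj m k (w p)) p) := by
    refine (lineDeriv_bilin (ContinuousLinearMap.id ℝ _) h3 (hw.jetProj k) p (v p)).trans ?_
    rw [lineDeriv_comp_jetProj hF']
    rfl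
  -- Each side is F'' evaluated on the two directions plus F' applied to the derivative of one field
  -- along the other. The latter terms agree by `h1` and `h2`, the former by symmetry of F''.
  funext p
  rw [hl, hl, key v w hw, key w v hv, hproj v w hw, hproj w v hv, h1]
  simp only [h2]
  congr 1
  exact (hF.contDiffAt.isSymmSndFDerivAt (by
    simp only [minSmoothness_of_isRCLikeNormedField]
    exact WithTop.coe_le_coe.2 (le_top : (2 : ℕ∞) ≤ ⊤))) _ _

/-- It suffices to compare the two fields on coordinates: on u_(k) both orders give the (k+1)-st
total derivative of X. -/
theorem Dx_prolong {X : Jet m → Val m} (hX : IsLocal X) {f : Jet m → W} (hf : IsLocal f) :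
    Dx (prolong X f) = prolong X (Dx f) := by
  refine along_comm isLocalField_total (isLocalField_prolong hX) ?_ (fun k => ?_) hf
  · funext p; simp [along, prolongField, totalField, lineDeriv]
  · funext p
    refine Eq.trans ?_ (lineDeriv_coord (k + 1) p _).symm
    simp only [prolongField, Function.iterate_succ_apply']
    rfl

end Calculus
end
end QuatHierarchy

namespace QuatHierarchy
noncomputable section

/-! ### Formal solutions of Lax equations -/

section Cubic

variable {A : Type*} [Ring A] [Algebra ℝ A]

/-- The inverse of the commutator with an element `v` such that `v ^ 3 = v`, on its image. -/
def adInv (v w : A) : A := v * w - w * v + (3 / 4 : ℝ) • (v * v * w * v - v * w * v * v)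

/-- The linearization of `v ↦ v ^ 3 - v`. -/
def cubicLin (v w : A) : A := v * v * w + v * w * v + w * v * v - w

/-- Left and right multiplication by v commute and have eigenvalues i, j in {-1, 0, 1}. On the block
(i, j), `cubicLin v` is the scalar i² + ij + j² - 1, which vanishes exactly when i ≠ j, and `adInv
v` is (i - j)(1 + 3ij/4), which for i ≠ j equals 1/(i - j). -/
theorem commutator_adInv {v w : A} (hv : v * v * v = v) (hw : cubicLin v w = 0) :
    v * adInv v w - adInv v w * v = w := by
  have h1 : v * (v * v) = v := by rw [← mul_assoc, hv]
  have h2 (x : A) : v * (v * (v * x)) = v * x := by rw [← mul_assoc, ← mul_assoc, hv]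
  have h3 : v * cubicLin v w * v = 0 := by simp [hw]
  have h4 : v * adInv v w - adInv v w * v =
      w + cubicLin v w - (3 / 2 : ℝ) • (v * cubicLin v w * v) := by
    simp only [adInv, cubicLin, mul_add, add_mul, mul_sub, sub_mul, mul_smul_comm, smul_mul_assoc,
      mul_assoc, h1, h2]
    module
  rw [h4, h3, hw]
  simp

theorem cubicLin_adInv {v w : A} (hv : v * v * v = v) :
    cubicLin v (adInv v w) = 0 := by
  have h1 : v * (v * v) = v := by rw [← mul_assoc, hv]
  have h2 (x : A) : v * (v * (v * x)) = v * x := by rw [← mul_assoc, ← mul_assoc, hv]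
  simp only [adInv, cubicLin, mul_add, add_mul, mul_sub, sub_mul, mul_smul_comm, smul_mul_assoc,
      mul_assoc, h1, h2]
  module

/-- An element commuting with v lies in the blocks i = j, where `cubicLin v` acts by -1 or 2 and is
therefore injective. -/
theorem cubicLin_eq_zero {v w : A} (hv : v * v * v = v)
    (h : v * cubicLin v w - cubicLin v w * v = 0) (h' : cubicLin v (cubicLin v w) = 0) :
    cubicLin v w = 0 := by
  have hc : cubicLin v w * v = v * cubicLin v w := (sub_eq_zero.1 h).symm
  generalize cubicLin v w = y at *
  have h1 : v * (v * v) = v := by rw [← mul_assoc, hv]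
  have h2 (x : A) : v * (v * (v * x)) = v * x := by rw [← mul_assoc, ← mul_assoc, hv]
  have h3 : cubicLin v y = (3 : ℝ) • (v * (v * y)) - y := by
    simp only [cubicLin, mul_assoc, hc]
    module
  rw [h3] at h'
  have h4 : v * (v * ((3 : ℝ) • (v * (v * y)) - y)) = (2 : ℝ) • (v * (v * y)) := by
    simp only [mul_sub, mul_smul_comm, h2]
    module
  rw [h'] at h4
  have h5 : v * (v * y) = 0 := by
    have := h4.symm
    simpa using this
  simpa [h5] using h'

/-- The first condition confines w to the blocks i = j, the second to the blocks i ≠ j. -/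
theorem eq_zero_of_cubicLin {v w : A} (hv : v * v * v = v)
    (h : v * w - w * v = 0) (h' : cubicLin v w = 0) : w = 0 := by
  have := commutator_adInv hv h'
  have hc : w * v = v * w := (sub_eq_zero.1 h).symm
  have h1 : adInv v w = 0 := by
    simp [adInv, mul_assoc, hc]
  rw [h1] at this
  simpa using this.symm

end Cubic

open PowerSeries

/-! ### Power series over a noncommutative ring and construction of the Lax solution. -/

section Series

variable {A : Type*} [Ring A]

/-- The range includes j = N: the first possibly nonzero coefficient meets only the constant term of
the other factor. -/
theorem coeff_mul_of_low_left {f : A⟦X⟧} {N : ℕ} (hf : ∀ j < N, coeff j f = 0) (g : A⟦X⟧)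
    {j : ℕ} (hj : j ≤ N) : coeff j (f * g) = coeff j f * coeff 0 g := by
  rw [coeff_mul, Finset.sum_eq_single (j, 0)]
  · rintro ⟨a, b⟩ hab hne
    rw [Finset.HasAntidiagonal.mem_antidiagonal] at hab
    have : a < N := by
      rcases Nat.eq_zero_or_pos b with rfl | hb
      · exact absurd (by simpa using hab) (by simpa using hne)
      · simp only at hab; omega
    simp [hf a this]
  · simp

theorem coeff_mul_of_low_right (f : A⟦X⟧) {g : A⟦X⟧} {N : ℕ} (hg : ∀ j < N, coeff j g = 0)
    {j : ℕ} (hj : j ≤ N) : coeff j (f * g) = coeff 0 f * coeff j g := by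
  rw [coeff_mul, Finset.sum_eq_single (0, j)]
  · rintro ⟨a, b⟩ hab hne
    rw [Finset.HasAntidiagonal.mem_antidiagonal] at hab
    have : b < N := by
      rcases Nat.eq_zero_or_pos a with rfl | hb
      · exact absurd (by simpa using hab) (by simpa using hne)
      · simp only at hab; omega
    simp [hg b this]
  · simp

/-- Coefficientwise action of an additive map on power series. -/
def seriesMap {A B : Type*} [Ring A] [Ring B] (D : A →+ B) : A⟦X⟧ →+ B⟦X⟧ where
  toFun f := PowerSeries.mk fun n => D (coeff n f)
  map_zero' := by ext; simp
  map_add' f g := by ext; simp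

@[simp] theorem coeff_seriesMap {A B : Type*} [Ring A] [Ring B] (D : A →+ B) (f : A⟦X⟧) (n : ℕ) :
    coeff n (seriesMap D f) = D (coeff n f) := by
  simp [seriesMap]

/-- The Leibniz rule for an additive endomorphism of a ring. -/
def IsDeriv (D : A →+ A) : Prop := ∀ a b, D (a * b) = D a * b + a * D b

theorem IsDeriv.series {D : A →+ A} (hD : IsDeriv D) : IsDeriv (seriesMap D) := by
  intro f g
  ext n
  simp [coeff_mul, map_sum, hD _ _, Finset.sum_add_distrib]

/-- The operator `z D` on power series in `z`. -/
def shiftMap (D : A →+ A) : A⟦X⟧ →+ A⟦X⟧ :=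
  (AddMonoidHom.mulLeft (X : A⟦X⟧)).comp (seriesMap D)

theorem shiftMap_apply (D : A →+ A) (f : A⟦X⟧) : shiftMap D f = X * seriesMap D f := rfl

@[simp] theorem coeff_succ_shiftMap (D : A →+ A) (f : A⟦X⟧) (n : ℕ) :
    coeff (n + 1) (shiftMap D f) = D (coeff n f) := by
  simp [shiftMap_apply, coeff_succ_X_mul]

@[simp] theorem coeff_zero_shiftMap (D : A →+ A) (f : A⟦X⟧) :
    coeff 0 (shiftMap D f) = 0 := by
  simp [shiftMap_apply]

theorem IsDeriv.shift {D : A →+ A} (hD : IsDeriv D) : IsDeriv (shiftMap D) := by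
  intro f g
  simp only [shiftMap_apply, hD.series f g, mul_add, ← mul_assoc]
  rw [(commute_X f).eq]

/-- The series `e + z u`. -/
def laxSeries (e u : A) : A⟦X⟧ := C e + X * C u

theorem coeff_zero_lax (e u : A) : coeff 0 (laxSeries e u) = e := by
  simp [laxSeries]

theorem coeff_succ_lax_mul (e u : A) (f : A⟦X⟧) (n : ℕ) :
    coeff (n + 1) (laxSeries e u * f) = e * coeff (n + 1) f + u * coeff n f := by
  simp [laxSeries, add_mul, mul_assoc, coeff_succ_X_mul]

theorem coeff_succ_mul_lax (e u : A) (f : A⟦X⟧) (n : ℕ) :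
    coeff (n + 1) (f * laxSeries e u) = coeff (n + 1) f * e + coeff n f * u := by
  have : f * laxSeries e u = f * C e + X * (f * C u) := by
    rw [laxSeries, mul_add, ← mul_assoc, ← mul_assoc, (commute_X f).eq]
  rw [this]
  simp [coeff_succ_X_mul]

/-- The defect of the Lax equation `z D V = [e + z u, V]`. -/
def laxDefect (D : A →+ A) (e u : A) : A⟦X⟧ →+ A⟦X⟧ :=
  shiftMap D - (AddMonoidHom.mulLeft (laxSeries e u) - AddMonoidHom.mulRight (laxSeries e u))

theorem laxDefect_apply (D : A →+ A) (e u : A) (f : A⟦X⟧) :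
    laxDefect D e u f = shiftMap D f - (laxSeries e u * f - f * laxSeries e u) := rfl

theorem coeff_zero_laxDefect (D : A →+ A) (e u : A) (f : A⟦X⟧) :
    coeff 0 (laxDefect D e u f) = -(e * coeff 0 f - coeff 0 f * e) := by
  simp only [laxDefect_apply, map_sub, coeff_zero_shiftMap]
  rw [coeff_mul_of_low_left (N := 0) (by simp) _ le_rfl,
    coeff_mul_of_low_left (N := 0) (by simp) _ le_rfl, coeff_zero_lax]
  simp

theorem coeff_succ_laxDefect (D : A →+ A) (e u : A) (f : A⟦X⟧) (n : ℕ) :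
    coeff (n + 1) (laxDefect D e u f) = D (coeff n f) - (u * coeff n f - coeff n f * u)
      - (e * coeff (n + 1) f - coeff (n + 1) f * e) := by
  simp only [laxDefect_apply, map_sub, coeff_succ_shiftMap, coeff_succ_lax_mul, coeff_succ_mul_lax]
  abel

theorem IsDeriv.laxDefect {D : A →+ A} (hD : IsDeriv D) (e u : A) :
    IsDeriv (laxDefect D e u) := by
  intro f g
  simp only [laxDefect_apply, hD.shift f g]
  noncomm_ring

/-- For the Lax defect N this expresses N(V³ - V) through N(V), the compatibility between the two
equations imposed on V. -/
theorem IsDeriv.cube {D : A →+ A} (hD : IsDeriv D) (v : A) :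
    D (v * v * v - v) = cubicLin v (D v) := by
  rw [map_sub, hD, hD, cubicLin]
  noncomm_ring

theorem coeff_cubicLin_of_low {f g : A⟦X⟧} {N : ℕ} (hg : ∀ j < N, coeff j g = 0) {j : ℕ}
    (hj : j ≤ N) : coeff j (cubicLin f g) = cubicLin (coeff 0 f) (coeff j g) := by
  have h0 (k : ℕ) (hk : k < N) : coeff k (f * g) = 0 := by
    rw [coeff_mul_of_low_right f hg hk.le, hg k hk, mul_zero]
  have h1 (k : ℕ) (hk : k < N) : coeff k (g * f) = 0 := by
    rw [coeff_mul_of_low_left hg f hk.le, hg k hk, zero_mul]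
  simp only [cubicLin, map_sub, map_add]
  rw [mul_assoc f f g, coeff_mul_of_low_right f h0 hj, coeff_mul_of_low_right f hg hj,
    coeff_mul_of_low_left h0 f hj, coeff_mul_of_low_right f hg hj,
    coeff_mul_of_low_left h1 f hj, coeff_mul_of_low_left hg f hj]
  simp only [mul_assoc]

variable [Algebra ℝ A]

/-- A perturbed version of the uniqueness of solutions of the Lax equation. -/
theorem eq_zero_of_laxDefect {D : A →+ A} {e u : A} (he : e * e * e = e)
    {V V' Z : A⟦X⟧} (hV : coeff 0 V = e) (hV' : coeff 0 V' = e)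
    (h1 : laxDefect D e u Z = 0) (h2 : V' * V' * Z + V' * Z * V + Z * V * V = Z) : Z = 0 := by
  ext n
  induction n using Nat.strong_induction_on with
  | _ n ih =>
    simp only [map_zero] at ih ⊢
    -- At the first order not yet known to vanish, V and V' enter only through their constant term
    -- e. Then `h1` makes the coefficient commute with e, and `h2` puts it in the kernel of
    -- `cubicLin e`.
    refine eq_zero_of_cubicLin he ?_ ?_
    · have := congrArg (coeff n) h1
      rcases n with _ | n
      · rw [coeff_zero_laxDefect, map_zero, neg_eq_zero] at this
        exact this
      · rw [coeff_succ_laxDefect, ih n (by omega)] at this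
        simp only [map_zero, mul_zero, zero_mul, sub_zero, zero_sub, neg_eq_zero] at this
        exact this
    · have h3 (k : ℕ) (hk : k < n) : coeff k (V' * Z) = 0 := by
        rw [coeff_mul_of_low_right V' ih hk.le, ih k hk, mul_zero]
      have h4 (k : ℕ) (hk : k < n) : coeff k (Z * V) = 0 := by
        rw [coeff_mul_of_low_left ih V hk.le, ih k hk, zero_mul]
      have := congrArg (coeff n) h2
      rw [map_add, map_add, mul_assoc V' V' Z, coeff_mul_of_low_right V' h3 le_rfl,
        coeff_mul_of_low_right V' ih le_rfl, coeff_mul_of_low_left h3 V le_rfl,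
        coeff_mul_of_low_right V' ih le_rfl, coeff_mul_of_low_left h4 V le_rfl,
        coeff_mul_of_low_left ih V le_rfl, hV, hV'] at this
      rw [cubicLin, mul_assoc e e]
      exact sub_eq_zero.2 this

/-- A solution of the Lax equation `z D V = [e + z u, V]` with `V ^ 3 = V` and `V = e + O(z)`. -/
structure IsLaxSolution (D : A →+ A) (e u : A) (V : A⟦X⟧) : Prop where
  coeff_zero : coeff 0 V = e
  lax : laxDefect D e u V = 0
  cube : V * V * V = V

/-- With Z = V - V' one has V³ - V'³ = V'V'Z + V'ZV + ZVV, which is why the vanishing criterion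
allows two different series. -/
theorem IsLaxSolution.unique {D : A →+ A} {e u : A} (he : e * e * e = e)
    {V V' : A⟦X⟧} (hV : IsLaxSolution D e u V) (hV' : IsLaxSolution D e u V') : V = V' := by
  refine sub_eq_zero.1 (eq_zero_of_laxDefect (D := D) (u := u) he hV.coeff_zero hV'.coeff_zero ?_ ?_)
  · rw [map_sub, hV.lax, hV'.lax, sub_zero]
  · calc _ = V * V * V - V' * V' * V' := by noncomm_ring
      _ = _ := by rw [hV.cube, hV'.cube]

/-- A correction c at order n + 1 must satisfy [e, c] = w₁ and `cubicLin e` c = -p₁, where w₁ and p₁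
are the coefficients of the Lax and cube defects. This is solvable when w₁ has only blocks i ≠ j and
p₁ only blocks i = j. Since the Lax defect is a derivation, `cubicLin e` w₁ = -[e, p₁]; the left
side lives in blocks i = j and the right side in blocks i ≠ j, so both vanish. -/
theorem laxStep {D : A →+ A} (hD : IsDeriv D) {e u : A} (he : e * e * e = e)
    {n : ℕ} {V : A⟦X⟧} (h0 : coeff 0 V = e) (h1 : ∀ j ≤ n, coeff j (laxDefect D e u V) = 0)
    (h2 : ∀ j ≤ n, coeff j (V * V * V - V) = 0) :
    ∃ c : A, ∀ j ≤ n + 1, coeff j (laxDefect D e u (V + monomial (n + 1) c)) = 0 ∧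
      coeff j ((V + monomial (n + 1) c) * (V + monomial (n + 1) c) * (V + monomial (n + 1) c)
        - (V + monomial (n + 1) c)) = 0 := by
  have key := congrArg (coeff (n + 1)) ((hD.laxDefect e u).cube V)
  set w := laxDefect D e u V with hw
  set p := V * V * V - V with hp
  have h1' : ∀ j < n + 1, coeff j w = 0 := fun j hj => h1 j (by omega)
  have h2' : ∀ j < n + 1, coeff j p = 0 := fun j hj => h2 j (by omega)
  rw [coeff_cubicLin_of_low h1' le_rfl, coeff_succ_laxDefect, h2 n le_rfl, h0] at key
  simp only [map_zero, mul_zero, zero_mul, sub_zero, zero_sub] at key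
  set w1 := coeff (n + 1) w
  set p1 := coeff (n + 1) p
  have h3 (x : A) : e * (e * (e * x)) = e * x := by rw [← mul_assoc, ← mul_assoc, he]
  have h4 : e * (e * e) = e := by rw [← mul_assoc, he]
  have hcomm : e * cubicLin e w1 - cubicLin e w1 * e = 0 := by
    simp only [cubicLin, mul_add, add_mul, mul_sub, sub_mul, mul_assoc, h3, h4]
    abel
  have hsq : cubicLin e (cubicLin e w1) = 0 := by
    rw [← key]
    simp only [cubicLin, mul_sub, sub_mul, mul_assoc, h3, h4, mul_neg, neg_mul]
    abel
  have hw1 : cubicLin e w1 = 0 := cubicLin_eq_zero he hcomm hsq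
  rw [hw1, neg_eq_zero, sub_eq_zero] at key
  have hy : cubicLin e (p1 - (3 / 2 : ℝ) • (e * e * p1)) = -p1 := by
    have h5 : p1 * e = e * p1 := key.symm
    simp only [cubicLin, mul_sub, sub_mul, mul_assoc, h3, mul_smul_comm, smul_mul_assoc, h5]
    module
  have hycomm : e * (p1 - (3 / 2 : ℝ) • (e * e * p1)) - (p1 - (3 / 2 : ℝ) • (e * e * p1)) * e
      = 0 := by
    have h5 : p1 * e = e * p1 := key.symm
    simp only [mul_sub, sub_mul, mul_assoc, mul_smul_comm, smul_mul_assoc, h5]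
    abel
  -- On the commutant of e, `cubicLin e` is multiplication by 3e² - 1, and 1 - (3/2)e² inverts it up
  -- to sign. The two summands cancel the two defects independently.
  refine ⟨adInv e w1 + (p1 - (3 / 2 : ℝ) • (e * e * p1)), fun j hj => ?_⟩
  set c := adInv e w1 + (p1 - (3 / 2 : ℝ) • (e * e * p1)) with hc
  have hc1 : e * c - c * e = w1 := by
    rw [hc, mul_add, add_mul, add_sub_add_comm, hycomm, commutator_adInv he hw1, add_zero]
  have hc2 : cubicLin e c = -p1 := by
    have : cubicLin e c = cubicLin e (adInv e w1) + cubicLin e (p1 - (3 / 2 : ℝ) • (e * e * p1)) := by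
      rw [hc]; simp only [cubicLin]; noncomm_ring
    rw [this, hy, cubicLin_adInv he, zero_add]
  set T : A⟦X⟧ := monomial (n + 1) c with hT
  have hTl : ∀ j < n + 1, coeff j T = 0 := fun j hj => by
    rw [hT, coeff_monomial, if_neg (by omega)]
  have hTn : coeff (n + 1) T = c := by rw [hT, coeff_monomial, if_pos rfl]
  have hT0 : coeff 0 T = 0 := hTl 0 (by omega)
  constructor
  · rw [map_add, map_add, ← hw]
    rcases j with _ | j
    · rw [coeff_zero_laxDefect D e u T, hT0, h1 0 (by omega)]; simp
    · rw [coeff_succ_laxDefect D e u T, hTl j (by omega)]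
      rcases (by omega : j = n ∨ j < n) with rfl | hj'
      · rw [hTn, hc1]; simp [w1]
      · rw [hTl (j + 1) (by omega), h1 _ (by omega)]; simp
  · have : (V + T) * (V + T) * (V + T) - (V + T) = p + cubicLin V T +
        T * (T * V + V * T + T * T) + V * T * T := by
      rw [hp, cubicLin]; noncomm_ring
    rw [this]
    have hS0 : coeff 0 (T * V + V * T + T * T) = 0 := by
      simp only [map_add]
      rw [coeff_mul_of_low_left hTl _ (by omega), coeff_mul_of_low_right _ hTl (by omega),
        coeff_mul_of_low_left hTl _ (by omega), hT0]
      simp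
    have hVT : ∀ j < n + 1, coeff j (V * T) = 0 := fun j hj => by
      rw [coeff_mul_of_low_right _ hTl (by omega), hTl j hj, mul_zero]
    rw [map_add, map_add, map_add, coeff_mul_of_low_left hVT _ hj, hT0,
      coeff_mul_of_low_left hTl _ hj, hS0, coeff_cubicLin_of_low hTl hj, h0]
    rcases (by omega : j = n + 1 ∨ j ≤ n) with rfl | hj'
    · rw [hTn, hc2]; simp [p1]
    · rw [hTl j (by omega), h2 j hj']; simp [cubicLin]

theorem exists_laxSolution {D : A →+ A} (hD : IsDeriv D) {e : A} (u : A) (he : e * e * e = e) :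
    ∃ V : A⟦X⟧, IsLaxSolution D e u V := by
  let P : ℕ → A⟦X⟧ → Prop := fun n V => coeff 0 V = e ∧
    (∀ j ≤ n, coeff j (laxDefect D e u V) = 0) ∧ ∀ j ≤ n, coeff j (V * V * V - V) = 0
  -- Placing the hypothesis inside the existential lets c be chosen for every series, so the
  -- recursion below needs no proof terms.
  have hstep (n : ℕ) (V : A⟦X⟧) : ∃ c : A, P n V → P (n + 1) (V + monomial (n + 1) c) := by
    by_cases h : P n V
    · obtain ⟨c, hc⟩ := laxStep hD he h.1 h.2.1 h.2.2
      refine ⟨c, fun _ => ⟨?_, fun j hj => (hc j hj).1, fun j hj => (hc j hj).2⟩⟩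
      rw [map_add, h.1, coeff_monomial, if_neg (by omega), add_zero]
    · exact ⟨0, fun h' => absurd h' h⟩
  choose c hc using hstep
  let s : ℕ → A⟦X⟧ := fun n => Nat.rec (C e) (fun n V => V + monomial (n + 1) (c n V)) n
  have hs (n : ℕ) : s (n + 1) = s n + monomial (n + 1) (c n (s n)) := rfl
  have hP (n : ℕ) : P n (s n) := by
    induction n with
    | zero =>
      have h0 : coeff 0 (C e : A⟦X⟧) = e := by simp
      refine ⟨h0, fun j hj => ?_, fun j hj => ?_⟩
      · obtain rfl : j = 0 := by omega
        rw [coeff_zero_laxDefect]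
        simp [s]
      · obtain rfl : j = 0 := by omega
        have : (C e : A⟦X⟧) * C e * C e - C e = 0 := by
          rw [← map_mul, ← map_mul, he, sub_self]
        change coeff 0 ((C e : A⟦X⟧) * C e * C e - C e) = 0
        rw [this, map_zero]
    | succ n ih => rw [hs]; exact hc n (s n) ih
  have hagree (j k : ℕ) : coeff j (s (j + k)) = coeff j (s j) := by
    induction k with
    | zero => rfl
    | succ k ih =>
      rw [← add_assoc, hs, map_add, ih, coeff_monomial, if_neg (by omega), add_zero]
  let V : A⟦X⟧ := PowerSeries.mk fun n => coeff n (s n)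
  -- The limit agrees with the n-th approximation through order n, and both equations at order n
  -- involve no later coefficient.
  have hlow (n : ℕ) : ∀ j < n + 1, coeff j (V - s n) = 0 := fun j hj => by
    obtain ⟨k, rfl⟩ := Nat.exists_eq_add_of_le (Nat.lt_succ_iff.1 hj)
    rw [map_sub, hagree, coeff_mk, sub_self]
  refine ⟨V, by simp [V, (hP 0).1], ?_, ?_⟩
  · ext n
    have h1 : laxDefect D e u V = laxDefect D e u (s n) + laxDefect D e u (V - s n) := by
      rw [← map_add]; simp
    rw [h1, map_add, (hP n).2.1 n le_rfl]
    rcases n with _ | n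
    · rw [coeff_zero_laxDefect, hlow 0 0 (by omega)]; simp
    · rw [coeff_succ_laxDefect, hlow (n + 1) n (by omega), hlow (n + 1) (n + 1) (by omega)]; simp
  · rw [← sub_eq_zero]
    ext n
    have h1 : V * V * V - V = (s n * s n * s n - s n) + ((V - s n) * (V * V) +
        s n * ((V - s n) * V) + s n * s n * (V - s n) - (V - s n)) := by noncomm_ring
    have h2 : ∀ j < n + 1, coeff j ((V - s n) * V) = 0 := fun j hj => by
      rw [coeff_mul_of_low_left (hlow n) _ hj.le, hlow n j hj, zero_mul]
    rw [h1, map_add, (hP n).2.2 n le_rfl, map_sub, map_add, map_add,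
      coeff_mul_of_low_left (hlow n) _ (by omega), coeff_mul_of_low_right _ h2 (by omega),
      coeff_mul_of_low_right _ (hlow n) (by omega), hlow n n (by omega), h2 n (by omega)]
    simp

end Series
end
end QuatHierarchy

namespace QuatHierarchy
noncomputable section
open PowerSeries

/-! ### Symmetries of the Lax solution. -/

section LaxSolutions

variable {A : Type*} [Ring A] {D : A →+ A} {e u : A} {V : A⟦X⟧}

theorem IsLaxSolution.coeff_succ (hV : IsLaxSolution D e u V) (n : ℕ) :
    D (coeff n V) - (u * coeff n V - coeff n V * u) =
      e * coeff (n + 1) V - coeff (n + 1) V * e := by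
  have := congrArg (coeff (n + 1)) hV.lax
  rw [coeff_succ_laxDefect, map_zero] at this
  exact sub_eq_zero.1 this

theorem laxDefect_eq_zero_iff {f : A⟦X⟧} (h0 : e * coeff 0 f - coeff 0 f * e = 0)
    (h : ∀ n, D (coeff n f) - (u * coeff n f - coeff n f * u) =
      e * coeff (n + 1) f - coeff (n + 1) f * e) : laxDefect D e u f = 0 := by
  ext n
  rcases n with _ | n
  · rw [coeff_zero_laxDefect, h0]; simp
  · rw [coeff_succ_laxDefect, h]; simp

/-- The map `∑ a_n z ^ n ↦ ∑ (-1) ^ n φ(a_n) z ^ n`. -/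
def twist (φ : A →+ A) : A⟦X⟧ →+ A⟦X⟧ where
  toFun f := PowerSeries.mk fun n => (-1 : ℤ) ^ n • φ (coeff n f)
  map_zero' := by ext; simp
  map_add' f g := by ext; simp

@[simp] theorem coeff_twist (φ : A →+ A) (f : A⟦X⟧) (n : ℕ) :
    coeff n (twist φ f) = (-1 : ℤ) ^ n • φ (coeff n f) := by
  simp [twist]

theorem twist_mul {φ : A →+ A} (hφ : ∀ a b, φ (a * b) = φ a * φ b) (f g : A⟦X⟧) :
    twist φ (f * g) = twist φ f * twist φ g := by
  ext n
  rw [coeff_twist, coeff_mul, coeff_mul, map_sum, Finset.smul_sum]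
  refine Finset.sum_congr rfl fun x hx => ?_
  rw [Finset.HasAntidiagonal.mem_antidiagonal] at hx
  rw [coeff_twist, coeff_twist, hφ, smul_mul_smul_comm, ← pow_add, hx]

theorem twist_mul_anti {φ : A →+ A} (hφ : ∀ a b, φ (a * b) = φ b * φ a) (f g : A⟦X⟧) :
    twist φ (f * g) = twist φ g * twist φ f := by
  ext n
  rw [coeff_twist, coeff_mul, coeff_mul, map_sum, Finset.smul_sum, ← Finset.Nat.sum_antidiagonal_swap]
  refine Finset.sum_congr rfl fun x hx => ?_
  rw [Finset.HasAntidiagonal.mem_antidiagonal] at hx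
  rw [coeff_twist, coeff_twist, hφ, smul_mul_smul_comm, ← pow_add, hx]
  rfl

section

variable [Algebra ℝ A]

/-- Under z ↦ -z followed by φ, the potential e + z u becomes its negative, so -φ(V(-z)) solves the
same equations with the same constant term; uniqueness identifies it with V. -/
theorem IsLaxSolution.map_coeff_of_mul (he : e * e * e = e) (hV : IsLaxSolution D e u V)
    {φ : A →+ A} (hφ : ∀ a b, φ (a * b) = φ a * φ b) (hD : ∀ a, φ (D a) = D (φ a))
    (hφe : φ e = -e) (hφu : φ u = u) (n : ℕ) :
    (-1 : ℤ) ^ n • φ (coeff n V) = -coeff n V := by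
  have h : IsLaxSolution D e u (-twist φ V) := by
    refine ⟨?_, ?_, ?_⟩
    · rw [map_neg, coeff_twist, hV.coeff_zero, hφe]; simp
    · rw [map_neg, laxDefect_eq_zero_iff, neg_zero]
      · rw [coeff_twist, hV.coeff_zero, hφe]; simp
      · intro n
        have h1 := congrArg φ (hV.coeff_succ n)
        simp only [map_sub, hφ, hφe, hφu, hD] at h1
        rw [coeff_twist, coeff_twist, map_zsmul, pow_succ]
        simp only [mul_smul_comm, smul_mul_assoc, ← smul_sub, mul_smul, h1]
        congr 1
        simp only [neg_smul, one_smul, mul_neg, neg_mul]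
        abel
    · rw [neg_mul_neg, mul_neg, ← twist_mul hφ, ← twist_mul hφ, hV.cube]
  have := congrArg (coeff n) (hV.unique he h)
  rw [map_neg, coeff_twist] at this
  exact neg_eq_iff_eq_neg.1 this.symm

/-- Here φ reverses commutators, which absorbs the sign from z ↦ -z, so φ(V(-z)) is again the
normalised solution. -/
theorem IsLaxSolution.map_coeff_of_anti (he : e * e * e = e) (hV : IsLaxSolution D e u V)
    {φ : A →+ A} (hφ : ∀ a b, φ (a * b) = φ b * φ a) (hD : ∀ a, φ (D a) = D (φ a))
    (hφe : φ e = e) (hφu : φ u = -u) (n : ℕ) :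
    (-1 : ℤ) ^ n • φ (coeff n V) = coeff n V := by
  have h : IsLaxSolution D e u (twist φ V) := by
    refine ⟨?_, ?_, ?_⟩
    · rw [coeff_twist, hV.coeff_zero, hφe]; simp
    · rw [laxDefect_eq_zero_iff]
      · rw [coeff_twist, hV.coeff_zero, hφe]; simp
      · intro n
        have h1 := congrArg φ (hV.coeff_succ n)
        simp only [map_sub, hφ, hφe, hφu, hD] at h1
        rw [coeff_twist, coeff_twist, map_zsmul, pow_succ]
        have h2 : D (φ (coeff n V)) - (u * φ (coeff n V) - φ (coeff n V) * u) =
            -(e * φ (coeff (n + 1) V) - φ (coeff (n + 1) V) * e) := by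
          rw [neg_sub, ← h1]
          noncomm_ring
        simp only [mul_smul_comm, smul_mul_assoc, ← smul_sub, mul_smul, h2]
        congr 1
        simp only [neg_smul, one_smul]
    · rw [← twist_mul_anti hφ, ← twist_mul_anti hφ, ← mul_assoc, hV.cube]
  have := congrArg (coeff n) (hV.unique he h)
  rw [coeff_twist] at this
  exact this.symm

/-- The image of V solves the Lax equation with zero potential u, whose unique normalised solution
is the constant e. -/
theorem IsLaxSolution.map_coeff_succ_eq_zero (he : e * e * e = e) (hDe : D e = 0)
    (hV : IsLaxSolution D e u V)
    {φ : A →+ A} (hφ : ∀ a b, φ (a * b) = φ a * φ b) (hD : ∀ a, φ (D a) = D (φ a))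
    (hφe : φ e = e) (hφu : φ u = 0) (n : ℕ) : φ (coeff (n + 1) V) = 0 := by
  have h1 : IsLaxSolution D e 0 (seriesMap φ V) := by
    refine ⟨?_, ?_, ?_⟩
    · rw [coeff_seriesMap, hV.coeff_zero, hφe]
    · rw [laxDefect_eq_zero_iff]
      · rw [coeff_seriesMap, hV.coeff_zero, hφe]; simp
      · intro n
        have h1 := congrArg φ (hV.coeff_succ n)
        simpa only [map_sub, hφ, hφe, hφu, hD, coeff_seriesMap] using h1
    · have hm (f g : A⟦X⟧) : seriesMap φ (f * g) = seriesMap φ f * seriesMap φ g := by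
        ext n
        simp [coeff_mul, hφ]
      rw [← hm, ← hm, hV.cube]
  have h2 : IsLaxSolution D e 0 (C e : A⟦X⟧) := by
    refine ⟨by simp, ?_, ?_⟩
    · rw [laxDefect_eq_zero_iff]
      · simp
      · intro n
        have : D (coeff n (C e : A⟦X⟧)) = 0 := by
          rw [coeff_C]; split_ifs <;> simp [hDe]
        rw [this, coeff_C, coeff_C, if_neg (Nat.succ_ne_zero n)]
        simp
    · rw [← map_mul, ← map_mul, he]
  have := congrArg (coeff (n + 1)) (h1.unique he h2)
  rwa [coeff_seriesMap, coeff_C, if_neg (Nat.succ_ne_zero n)] at this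

end

/-! ### Evolution of the Lax solution along the flows. -/

section Flows

variable {δ : A →+ A}

/-- Applying δ to z D V = [e + z u, V] leaves, besides the equation for δV, only the variation z δu
of the potential. -/
theorem IsLaxSolution.laxDefect_seriesMap (hV : IsLaxSolution D e u V) (hδ : IsDeriv δ)
    (hDδ : ∀ a, D (δ a) = δ (D a)) (hδe : δ e = 0) :
    laxDefect D e u (seriesMap δ V) = (X * C (δ u)) * V - V * (X * C (δ u)) := by
  have hc : V * (X * C (δ u)) = X * (V * C (δ u)) := by
    rw [← mul_assoc, ← mul_assoc, (commute_X V).eq]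
  rw [hc]
  ext n
  rcases n with _ | n
  · have h0 : δ e = 0 := hδe
    rw [coeff_zero_laxDefect, coeff_seriesMap, hV.coeff_zero, h0]
    simp
  · have h1 := congrArg δ (hV.coeff_succ n)
    simp only [map_sub, hδ _ _, hδe, zero_mul, mul_zero, zero_add, add_zero] at h1
    rw [coeff_succ_laxDefect, coeff_seriesMap, coeff_seriesMap, ← h1, hDδ]
    simp only [map_sub, mul_assoc, coeff_succ_X_mul, coeff_C_mul, coeff_mul_C]
    abel

theorem laxDefect_X_pow_mul (K : ℕ) (f : A⟦X⟧) :
    laxDefect D e u (X ^ K * f) = X ^ K * laxDefect D e u f := by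
  have h1 : seriesMap D (X ^ K * f) = X ^ K * seriesMap D f := by
    ext n
    rw [coeff_seriesMap, coeff_X_pow_mul', coeff_X_pow_mul']
    split_ifs <;> simp
  have hc (g : A⟦X⟧) : g * X ^ K = X ^ K * g := ((commute_X g).pow_right K).eq
  have hc' : laxSeries e u * (X ^ K * f) = X ^ K * (laxSeries e u * f) := by
    rw [← mul_assoc, hc, mul_assoc]
  have hc'' : (X : A⟦X⟧) * (X ^ K * seriesMap D f) = X ^ K * (X * seriesMap D f) := by
    rw [← mul_assoc, hc, mul_assoc]
  rw [laxDefect_apply, laxDefect_apply, shiftMap_apply, h1, hc', hc'', shiftMap_apply]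
  noncomm_ring

variable [Algebra ℝ A]

/-- If `δ u = [e, V_(K+1)]`, then `z ^ K δ V = [V_0 + V_1 z + ⋯ + V_K z ^ K, V]`. -/
theorem IsLaxSolution.deriv_coeff (he : e * e * e = e) (hD : IsDeriv D)
    (hV : IsLaxSolution D e u V) (hδ : IsDeriv δ)
    (hDδ : ∀ a, D (δ a) = δ (D a)) (hδe : δ e = 0) (K : ℕ)
    (hδu : δ u = e * coeff (K + 1) V - coeff (K + 1) V * e) (n : ℕ) :
    δ (coeff n V) = ∑ j ∈ Finset.range (K + 1),
      (coeff j V * coeff (n + K - j) V - coeff (n + K - j) V * coeff j V) := by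
  set B : A⟦X⟧ := PowerSeries.mk fun n => if n ≤ K then coeff n V else 0 with hB
  have hBn (n : ℕ) : coeff n B = if n ≤ K then coeff n V else 0 := by rw [hB, coeff_mk]
  -- Truncation spoils the Lax equation only at order K + 1, where the missing commutator [e,
  -- V_(K+1)] is δu.
  have hDB : laxDefect D e u B = X ^ K * (X * C (δ u)) := by
    ext n
    rw [← mul_assoc, ← pow_succ, coeff_X_pow_mul']
    rcases n with _ | n
    · rw [coeff_zero_laxDefect, hBn, if_pos (Nat.zero_le K), hV.coeff_zero]; simp
    · rw [coeff_succ_laxDefect, hBn, hBn]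
      rcases lt_trichotomy n K with h | h | h
      · rw [if_pos h.le, if_pos (by omega), if_neg (by omega), hV.coeff_succ, sub_self]
      · subst h
        rw [if_pos le_rfl, if_neg (by omega), if_pos le_rfl, hV.coeff_succ, ← hδu]; simp
      · rw [if_neg (by omega), if_neg (by omega), if_pos (by omega), coeff_C, if_neg (by omega)]
        simp
  -- Since z^K is central, d = z^K δ - [B, ·] is a derivation. The inhomogeneous terms in the Lax
  -- defect of dV cancel, and V³ = V gives the linearised cubic equation for dV, so dV = 0.
  let d : A⟦X⟧ →+ A⟦X⟧ := (AddMonoidHom.mulLeft (X ^ K : A⟦X⟧)).comp (seriesMap δ) -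
    (AddMonoidHom.mulLeft B - AddMonoidHom.mulRight B)
  have hd (f : A⟦X⟧) : d f = X ^ K * seriesMap δ f - (B * f - f * B) := rfl
  have hc (g : A⟦X⟧) : g * X ^ K = X ^ K * g := ((commute_X g).pow_right K).eq
  have hdd : IsDeriv d := by
    intro f g
    have h1 : f * (X ^ K * seriesMap δ g) = X ^ K * (f * seriesMap δ g) := by
      rw [← mul_assoc, hc, mul_assoc]
    simp only [hd, hδ.series f g, mul_add, mul_sub, h1, sub_mul]
    noncomm_ring
  have hZ : d V = 0 := by
    refine eq_zero_of_laxDefect (D := D) (u := u) he hV.coeff_zero hV.coeff_zero ?_ ?_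
    · have h1 : V * (X ^ K * (X * C (δ u))) = X ^ K * (V * (X * C (δ u))) := by
        rw [← mul_assoc, hc, mul_assoc]
      rw [hd, map_sub, laxDefect_X_pow_mul, hV.laxDefect_seriesMap hδ hDδ hδe, map_sub,
        hD.laxDefect e u B V, hD.laxDefect e u V B, hV.lax, hDB, h1]
      noncomm_ring
    · have := hdd.cube V
      rw [hV.cube, sub_self, map_zero, cubicLin] at this
      exact (sub_eq_zero.1 this.symm)
  have h := congrArg (coeff (n + K)) hZ
  have hs (g : ℕ → A) : ∑ j ∈ Finset.range (n + K + 1), (if j ≤ K then g j else 0) =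
      ∑ j ∈ Finset.range (K + 1), g j := by
    rw [← Finset.sum_filter]
    congr 1
    ext j
    simp only [Finset.mem_filter, Finset.mem_range]
    omega
  rw [hd, map_sub, map_sub, coeff_X_pow_mul', if_pos (by omega), Nat.add_sub_cancel,
    coeff_seriesMap, coeff_mul, coeff_mul, Finset.Nat.sum_antidiagonal_eq_sum_range_succ_mk,
    ← Finset.Nat.sum_antidiagonal_swap, Finset.Nat.sum_antidiagonal_eq_sum_range_succ_mk,
    map_zero, sub_eq_zero] at h
  simp only [Prod.swap_prod_mk, hBn, ite_mul, mul_ite, zero_mul, mul_zero] at h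
  rw [hs, hs] at h
  rw [h, Finset.sum_sub_distrib]

/-- With M = N + K + 1, the two sides are the sums of [V_j, V_(M-j)] over j ≤ K and over j ≤ N. The
reflection j ↦ M - j carries j ≤ N to K < j ≤ M with a sign, and the sum over all j ≤ M vanishes. -/
theorem IsLaxSolution.deriv_coeff_comm (he : e * e * e = e) (hD : IsDeriv D)
    (hV : IsLaxSolution D e u V) {δ' : A →+ A} (hδ : IsDeriv δ) (hδ' : IsDeriv δ')
    (hDδ : ∀ a, D (δ a) = δ (D a)) (hDδ' : ∀ a, D (δ' a) = δ' (D a))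
    (hδe : δ e = 0) (hδe' : δ' e = 0) (K N : ℕ)
    (hδu : δ u = e * coeff (K + 1) V - coeff (K + 1) V * e)
    (hδu' : δ' u = e * coeff (N + 1) V - coeff (N + 1) V * e) :
    δ (coeff (N + 1) V) = δ' (coeff (K + 1) V) := by
  rw [hV.deriv_coeff he hD hδ hDδ hδe K hδu, hV.deriv_coeff he hD hδ' hDδ' hδe' N hδu']
  set g : ℕ → A := fun j => coeff j V * coeff (N + 1 + K - j) V with hg
  have h1 (j : ℕ) (hj : j ≤ N + 1 + K) :
      coeff (N + 1 + K - j) V * coeff j V = g (N + 1 + K - j) := by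
    rw [hg]; simp only; rw [Nat.sub_sub_self hj]
  have e1 : ∑ j ∈ Finset.range (K + 1),
      (coeff j V * coeff (N + 1 + K - j) V - coeff (N + 1 + K - j) V * coeff j V) =
      ∑ j ∈ Finset.range (K + 1), (g j - g (N + 1 + K - j)) :=
    Finset.sum_congr rfl fun j hj => by
      rw [Finset.mem_range] at hj
      rw [h1 j (by omega)]
  have e2 : ∑ j ∈ Finset.range (N + 1),
      (coeff j V * coeff (K + 1 + N - j) V - coeff (K + 1 + N - j) V * coeff j V) =
      ∑ j ∈ Finset.range (N + 1), (g j - g (N + 1 + K - j)) :=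
    Finset.sum_congr rfl fun j hj => by
      rw [Finset.mem_range] at hj
      rw [show K + 1 + N - j = N + 1 + K - j by omega, h1 j (by omega)]
  have e3 (a b : ℕ) (hab : a + b = N + 1 + K) : ∑ j ∈ Finset.range (a + 1), g (N + 1 + K - j) =
      ∑ j ∈ Finset.range (N + 1 + K + 1), g j - ∑ j ∈ Finset.range b, g j := by
    rw [show N + 1 + K + 1 = b + (a + 1) by omega, Finset.sum_range_add g b (a + 1), add_sub_cancel_left,
      ← Finset.sum_range_reflect]
    refine Finset.sum_congr rfl fun j hj => ?_
    rw [Finset.mem_range] at hj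
    congr 1
    omega
  rw [e1, e2, Finset.sum_sub_distrib, Finset.sum_sub_distrib, e3 K (N + 1) (by omega),
    e3 N (K + 1) (by omega)]
  abel

end Flows

/-! ### The trace identity. -/

section Trace

/-- Since N v = 0, the hypotheses read [v, N p] = [a, v] and [v, N q] = [b, v]. Under the trace a
and b can thus be traded for N p and N q, and the outcome is the Leibniz expansion of N(p v q - q v
p). -/
theorem trace_commutator_identity {S B : Type*} [Ring S] [AddCommGroup B] (τ : S →+ B)
    (hτ : ∀ a b, τ (a * b) = τ (b * a)) {N : S →+ S} (hN : IsDeriv N) {v p q a b : S}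
    (hv : N v = 0) (ha : N (v * p - p * v) = a * v - v * a)
    (hb : N (v * q - q * v) = b * v - v * b) :
    τ ((v * p - p * v) * b) - τ ((v * q - q * v) * a) = τ (N (p * v * q - q * v * p)) := by
  rw [map_sub, hN, hN, hv] at ha hb
  simp only [zero_mul, mul_zero, zero_add, add_zero] at ha hb
  have h1 : τ ((v * p - p * v) * b) = τ (p * (v * N q - N q * v)) := by
    rw [hb, sub_mul, mul_sub, map_sub, map_sub, mul_assoc, hτ v]
    simp only [mul_assoc]
  have h2 : τ ((v * q - q * v) * a) = τ (q * (v * N p - N p * v)) := by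
    rw [ha, sub_mul, mul_sub, map_sub, map_sub, mul_assoc, hτ v]
    simp only [mul_assoc]
  rw [h1, h2]
  simp only [map_sub, hN _ _, hv, mul_sub, map_add, mul_zero, add_zero, ← mul_assoc]
  rw [hτ (p * N q) v, hτ (q * N p) v, mul_assoc (N p), hτ (N p), mul_assoc (N q), hτ (N q)]
  simp only [← mul_assoc]
  abel

variable {δ : A →+ A}

theorem coeff_trace_comm {B : Type*} [AddCommGroup B] {t : A →+ B}
    (ht : ∀ a b, t (a * b) = t (b * a)) (n : ℕ) (f g : A⟦X⟧) :
    t (coeff n (f * g)) = t (coeff n (g * f)) := by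
  rw [coeff_mul, coeff_mul, map_sum, map_sum, ← Finset.Nat.sum_antidiagonal_swap]
  exact Finset.sum_congr rfl fun x _ => ht _ _

/-- The Euler operator `z d/dz`. -/
def eulerSeries : A⟦X⟧ →+ A⟦X⟧ where
  toFun f := PowerSeries.mk fun n => n • coeff n f
  map_zero' := by ext; simp
  map_add' f g := by ext; simp

@[simp] theorem coeff_eulerSeries (f : A⟦X⟧) (n : ℕ) :
    coeff n (eulerSeries f) = n • coeff n f := by
  simp [eulerSeries]

theorem isDeriv_eulerSeries : IsDeriv (eulerSeries (A := A)) := by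
  intro f g
  ext n
  rw [map_add, coeff_eulerSeries, coeff_mul, coeff_mul, coeff_mul, Finset.smul_sum,
    ← Finset.sum_add_distrib]
  refine Finset.sum_congr rfl fun x hx => ?_
  rw [Finset.HasAntidiagonal.mem_antidiagonal] at hx
  rw [coeff_eulerSeries, coeff_eulerSeries, smul_mul_assoc, mul_smul_comm, ← add_smul, hx]

/-- Differentiating the explicit factors z produces [z u, V] - z D V, which by the Lax equation
itself equals -[e, V]. -/
theorem IsLaxSolution.laxDefect_euler (hV : IsLaxSolution D e u V) :
    laxDefect D e u (eulerSeries V) = (-C e) * V - V * (-C e) := by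
  ext n
  rcases n with _ | n
  · rw [coeff_zero_laxDefect, coeff_eulerSeries, map_sub, neg_mul, map_neg, coeff_C_mul, mul_neg,
      map_neg, coeff_mul_C, hV.coeff_zero]
    simp
  · have h1 := hV.coeff_succ n
    have h2 : D (coeff n (eulerSeries V)) - (u * coeff n (eulerSeries V) -
        coeff n (eulerSeries V) * u) = n • (e * coeff (n + 1) V - coeff (n + 1) V * e) := by
      rw [← h1, coeff_eulerSeries, map_nsmul, mul_smul_comm, smul_mul_assoc, ← smul_sub, ← smul_sub]
    rw [coeff_succ_laxDefect, h2, coeff_eulerSeries, map_sub, neg_mul, map_neg, coeff_C_mul,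
      mul_neg, map_neg, coeff_mul_C, mul_smul_comm, smul_mul_assoc, ← smul_sub, succ_nsmul]
    abel

variable [Algebra ℝ A]

/-- The trace identity: the variation of `tr (V_(n+1) e)` is `- n tr (V_n δu)`, up to a total
derivative. -/
theorem IsLaxSolution.trace_identity {B : Type*} [AddCommGroup B] {t : A →+ B}
    (ht : ∀ a b, t (a * b) = t (b * a)) (hD : IsDeriv D)
    (hV : IsLaxSolution D e u V) (hδ : IsDeriv δ)
    (hDδ : ∀ a, D (δ a) = δ (D a)) (hδe : δ e = 0) (n : ℕ) :
    ∃ g : A, t (δ (coeff (n + 1) V) * e) + n • t (coeff n V * δ u) = t (D g) := by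
  -- Every derivation sends V into the kernel of `cubicLin V`, so δV and z dV/dz are commutators of
  -- V with explicit elements p and q.
  have hc {d : A⟦X⟧ →+ A⟦X⟧} (hd : IsDeriv d) : cubicLin V (d V) = 0 := by
    rw [← hd.cube, hV.cube, sub_self, map_zero]
  have hp := commutator_adInv hV.cube (hc hδ.series)
  have hq := commutator_adInv hV.cube (hc isDeriv_eulerSeries)
  set p := adInv V (seriesMap δ V)
  set q := adInv V (eulerSeries V)
  let τ : A⟦X⟧ →+ B := t.comp (coeff (R := A) (n + 1)).toAddMonoidHom
  have hτ (f : A⟦X⟧) : τ f = t (coeff (n + 1) f) := rfl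
  have key := trace_commutator_identity (τ := τ) (fun f g => coeff_trace_comm ht (n + 1) f g)
    (hD.laxDefect e u) (v := V) (p := p) (q := q) (a := X * C (δ u)) (b := -C e) hV.lax
    (by rw [hp]; exact hV.laxDefect_seriesMap hδ hDδ hδe)
    (by rw [hq]; exact hV.laxDefect_euler)
  rw [hp, hq] at key
  set G := p * V * q - q * V * p
  refine ⟨-coeff n G, ?_⟩
  have h1 : eulerSeries V * (X * C (δ u)) = X * (eulerSeries V * C (δ u)) := by
    rw [← mul_assoc, ← mul_assoc, (commute_X _).eq]
  have h2 (a b : A) : t (a * b - b * a) = 0 := by rw [map_sub, ht, sub_self]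
  clear_value G
  -- The factor z in z δu lowers the index by one, so the Euler weight that appears is n, not n + 1.
  rw [hτ, hτ, hτ, coeff_succ_laxDefect, h1, mul_neg, map_neg, coeff_mul_C, coeff_succ_X_mul,
    coeff_mul_C, coeff_seriesMap, coeff_eulerSeries, smul_mul_assoc, map_nsmul, map_neg, map_sub,
    map_sub, h2, h2, sub_zero, sub_zero] at key
  rw [map_neg, map_neg, ← key]
  abel

end Trace

end LaxSolutions
end
end QuatHierarchy

namespace QuatHierarchy
noncomputable section

/-! ### The kernel of the total derivative and functionals -/

section Kernel

variable {m : ℕ} {W W' W'' : Type} [NormedAddCommGroup W] [NormedSpace ℝ W]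
  [NormedAddCommGroup W'] [NormedSpace ℝ W'] [NormedAddCommGroup W''] [NormedSpace ℝ W'']

theorem Dx_add {f g : Jet m → W} (hf : IsLocal f) (hg : IsLocal g) :
    Dx (fun p => f p + g p) = fun p => Dx f p + Dx g p :=
  funext fun p => lineDeriv_add hf hg p _

theorem Dx_clm (L : W →L[ℝ] W') {f : Jet m → W} (hf : IsLocal f) :
    Dx (fun p => L (f p)) = fun p => L (Dx f p) :=
  funext fun p => lineDeriv_clm L hf p _

theorem Dx_bilin (B : W →L[ℝ] W' →L[ℝ] W'') {f : Jet m → W} {g : Jet m → W'}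
    (hf : IsLocal f) (hg : IsLocal g) :
    Dx (fun p => B (f p) (g p)) = fun p => B (Dx f p) (g p) + B (f p) (Dx g p) :=
  funext fun p => lineDeriv_bilin B hf hg p _

theorem Dx_const_smul (c : ℝ) {f : Jet m → W} (hf : IsLocal f) :
    Dx (fun p => c • f p) = fun p => c • Dx f p :=
  Dx_clm (c • ContinuousLinearMap.id ℝ W) hf

theorem Dx_neg {f : Jet m → W} (hf : IsLocal f) : Dx (fun p => -f p) = fun p => -Dx f p :=
  Dx_clm (-ContinuousLinearMap.id ℝ W) hf

theorem Dx_sub {f g : Jet m → W} (hf : IsLocal f) (hg : IsLocal g) :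
    Dx (fun p => f p - g p) = fun p => Dx f p - Dx g p := by
  simp only [sub_eq_add_neg]
  rw [Dx_add hf hg.neg, Dx_neg hg]

theorem Dx_const (c : W) : Dx (fun _ : Jet m => c) = fun _ => 0 := by
  funext p; simp [Dx, lineDeriv]

/-- The jet with value `v` of the `k`-th derivative and all other components zero. -/
def jetSingle (k : ℕ) (v : Val m) : Jet m := (0, Pi.single k v)

theorem jetProj_jetSingle {k l : ℕ} (hkl : k ≤ l) (v : Val m) :
    jetProj m k (jetSingle l v) = 0 := by
  rw [jetProj_apply]
  refine Prod.ext rfl (funext fun i => ?_)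
  exact Pi.single_eq_of_ne (by omega) _

theorem IsLocalOrder.add_jetSingle {k l : ℕ} (hkl : k ≤ l) {f : Jet m → W}
    (hf : IsLocalOrder k f) (p : Jet m) (v : Val m) : f (p + jetSingle l v) = f p := by
  obtain ⟨F, -, hf⟩ := hf
  rw [hf, hf, map_add, jetProj_jetSingle hkl, add_zero]

/-- The variable u_(k+1) enters D g only as the coefficient of ∂g/∂u_(k), so the dependence is
affine. -/
theorem Dx_add_jetSingle {k : ℕ} {g : Jet m → W} (hg : IsLocalOrder (k + 1) g) (p : Jet m)
    (v : Val m) : Dx g (p + jetSingle (k + 1) v) = Dx g p + lineDeriv ℝ g p (jetSingle k v) := by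
  obtain ⟨F, hF, hg⟩ := hg
  have : g = fun p => F (jetProj m (k + 1) p) := funext hg
  subst this
  have h1 : (1, fun j => (p + jetSingle (k + 1) v).2 (j + 1)) =
      ((1, fun j => p.2 (j + 1)) : Jet m) + jetSingle k v := by
    refine Prod.ext (by simp [jetSingle]) (funext fun j => ?_)
    simp [jetSingle, Pi.single_apply]
  rw [Dx, Dx, lineDeriv_comp_jetProj hF, lineDeriv_comp_jetProj hF, lineDeriv_comp_jetProj hF,
    h1, map_add, map_add, map_add, jetProj_jetSingle le_rfl, add_zero]

theorem IsLocalOrder.of_lineDeriv_eq_zero {k : ℕ} {g : Jet m → W} (hg : IsLocalOrder (k + 1) g)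
    (h : ∀ p v, lineDeriv ℝ g p (jetSingle k v) = 0) : IsLocalOrder k g := by
  have key (p : Jet m) (v : Val m) : g (p + jetSingle k v) = g p := by
    have hd (t : ℝ) : HasDerivAt (fun t : ℝ => g (p + t • jetSingle k v)) 0 t := by
      have := (lineDifferentiableAt_of_isLocal hg.isLocal (p + t • jetSingle k v)
        (jetSingle k v)).hasDerivAt
      rw [show deriv _ _ = _ from h _ _] at this
      have h2 := HasDerivAt.scomp t (h := fun s => s - t) (by simpa using this)
        ((hasDerivAt_id t).sub_const t)
      simp only [smul_zero] at h2
      refine h2.congr_of_eventuallyEq (Filter.Eventually.of_forall fun s => ?_)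
      simp only [Function.comp_apply]
      congr 1
      rw [add_assoc, ← add_smul]
      simp
    have := is_const_of_deriv_eq_zero (fun t => (hd t).differentiableAt)
      (fun t => (hd t).deriv) 1 0
    simpa using this
  obtain ⟨F, hF, hg⟩ := hg
  refine ⟨fun q => F (q.1, fun i => if h : (i : ℕ) < k then q.2 ⟨i, h⟩ else 0), hF.comp ?_,
    fun p => ?_⟩
  · refine contDiff_fst.prodMk (contDiff_pi.2 fun i => ?_)
    split_ifs <;> fun_prop
  · rw [← key p (-p.2 k), hg]
    congr 1
    refine Prod.ext (by simp [jetProj_apply, jetSingle]) (funext fun i => ?_)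
    by_cases hi : (i : ℕ) < k
    · have h0 : (Pi.single k (-p.2 k) : ℕ → Val m) i = 0 := Pi.single_eq_of_ne (by omega) _
      simp [jetProj_apply, jetSingle, hi, h0]
    · have hik : (i : ℕ) = k := by omega
      simp [jetProj_apply, jetSingle, hik]

/-- The coefficient of the top jet variable in D g is the derivative of g in its own highest
variable. Its vanishing lowers the order of g until only x is left. -/
theorem eq_const_of_Dx_eq_zero {g : Jet m → W} (hg : IsLocal g) (h : Dx g = 0) (p : Jet m) :
    g p = g 0 := by
  obtain ⟨k, hg⟩ := isLocal_iff.1 hg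
  induction k with
  | zero =>
    obtain ⟨F, hF, hg⟩ := hg
    have h1 (p : Jet m) : jetProj m 0 p = (p.1, 0) := Prod.ext rfl (Subsingleton.elim _ _)
    have h0 : g = fun p => F (jetProj m 0 p) := funext hg
    have hd (t : ℝ) : HasDerivAt (fun t : ℝ => F (t, 0)) 0 t := by
      have h2 := (hF.differentiable (by simp) (t, 0)).hasFDerivAt.comp_hasDerivAt t
        ((hasDerivAt_id t).prodMk (hasDerivAt_const t (0 : Fin 0 → Val m)))
      have h3 := congrFun h ((t, 0) : Jet m)
      rw [h0, Dx, lineDeriv_comp_jetProj hF, h1, h1] at h3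
      rw [show fderiv ℝ F (t, 0) (1, 0) = 0 from h3] at h2
      exact h2
    rw [hg, hg, h1, h1]
    exact is_const_of_deriv_eq_zero (fun t => (hd t).differentiableAt) (fun t => (hd t).deriv) _ _
  | succ k ih =>
    refine ih (hg.of_lineDeriv_eq_zero fun p v => ?_)
    have := Dx_add_jetSingle hg p v
    rw [h] at this
    simpa using this.symm

theorem eq_of_Dx_eq {f g : Jet m → W} (hf : IsLocal f) (hg : IsLocal g) (h : Dx f = Dx g)
    (h0 : f 0 = g 0) : f = g := by
  funext p
  have := eq_const_of_Dx_eq_zero (hf.sub hg) (by rw [Dx_sub hf hg, h]; funext p; simp) p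
  rw [h0, sub_self] at this
  exact sub_eq_zero.1 this

/-- Normalised primitives are unique, so the arbitrary choice in `DxInv` can be replaced by any
explicit primitive vanishing at the zero jet. -/
theorem DxInv_eq {f g : Jet m → W} (hg : IsLocal g) (h : Dx g = f) (h0 : g 0 = 0) :
    DxInv f = g := by
  have hex : ∃ g : Jet m → W, IsLocal g ∧ Dx g = f ∧ g 0 = 0 := ⟨g, hg, h, h0⟩
  rw [DxInv, dif_pos hex]
  obtain ⟨h1, h2, h3⟩ := hex.choose_spec
  exact eq_of_Dx_eq h1 hg (h2.trans h.symm) (h3.trans h0.symm)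

theorem IsTotalDeriv.spec {f : Jet m → W} (hf : IsTotalDeriv f) :
    IsLocal (DxInv f) ∧ Dx (DxInv f) = f ∧ DxInv f 0 = 0 := by
  obtain ⟨g, hg, h⟩ := hf
  have hl : IsLocal (fun p => g p - g 0) := hg.sub (isLocal_const (g 0))
  have hd : Dx (fun p => g p - g 0) = f := by
    rw [Dx_sub hg (isLocal_const _), Dx_const, h]; funext p; simp
  rw [DxInv_eq hl hd (sub_self _)]
  exact ⟨hl, hd, sub_self _⟩

theorem isTotalDeriv_zero : IsTotalDeriv (fun _ : Jet m => (0 : W)) :=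
  ⟨fun _ => 0, isLocal_const 0, Dx_const 0⟩

theorem IsTotalDeriv.add {f g : Jet m → W} (hf : IsTotalDeriv f) (hg : IsTotalDeriv g) :
    IsTotalDeriv (fun p => f p + g p) := by
  obtain ⟨a, ha, rfl⟩ := hf
  obtain ⟨b, hb, rfl⟩ := hg
  exact ⟨_, ha.add hb, Dx_add ha hb⟩

theorem IsTotalDeriv.const_smul (c : ℝ) {f : Jet m → W} (hf : IsTotalDeriv f) :
    IsTotalDeriv (fun p => c • f p) := by
  obtain ⟨a, ha, rfl⟩ := hf
  exact ⟨_, ha.const_smul c, Dx_const_smul c ha⟩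

theorem DxInv_const_smul (c : ℝ) {f : Jet m → W} (hf : IsTotalDeriv f) :
    DxInv (fun p => c • f p) = fun p => c • DxInv f p := by
  obtain ⟨h1, h2, h3⟩ := hf.spec
  refine DxInv_eq (h1.const_smul c) ?_ (by rw [h3, smul_zero])
  rw [Dx_const_smul c h1, h2]

theorem EqFunctional.refl (f : Jet m → ℝ) : EqFunctional f f := by
  simp only [EqFunctional, sub_self]
  exact isTotalDeriv_zero

theorem EqFunctional.symm {f g : Jet m → ℝ} (h : EqFunctional f g) : EqFunctional g f := by
  have := IsTotalDeriv.const_smul (-1) h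
  simpa [EqFunctional] using this

theorem EqFunctional.trans {f g h : Jet m → ℝ} (h1 : EqFunctional f g) (h2 : EqFunctional g h) :
    EqFunctional f h := by
  have := IsTotalDeriv.add h1 h2
  simpa [EqFunctional] using this

theorem EqFunctional.add {f g f' g' : Jet m → ℝ} (h1 : EqFunctional f g)
    (h2 : EqFunctional f' g') : EqFunctional (fun p => f p + f' p) (fun p => g p + g' p) := by
  have := IsTotalDeriv.add h1 h2
  simp only [EqFunctional, add_sub_add_comm]
  exact this

theorem EqFunctional.const_mul (c : ℝ) {f g : Jet m → ℝ} (h1 : EqFunctional f g) :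
    EqFunctional (fun p => c * f p) (fun p => c * g p) := by
  have := IsTotalDeriv.const_smul c h1
  simp only [EqFunctional, ← mul_sub]
  exact this

theorem EqFunctional.neg {f g : Jet m → ℝ} (h1 : EqFunctional f g) :
    EqFunctional (fun p => -f p) (fun p => -g p) := by
  simpa using h1.const_mul (-1)

theorem EqFunctional.sum {ι : Type} (s : Finset ι) {f g : ι → Jet m → ℝ}
    (h : ∀ i, EqFunctional (f i) (g i)) :
    EqFunctional (fun p => ∑ i ∈ s, f i p) (fun p => ∑ i ∈ s, g i p) := by
  classical
  induction s using Finset.induction_on with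
  | empty => simpa using EqFunctional.refl (m := m) (fun _ => 0)
  | insert a s ha ih => simpa [Finset.sum_insert ha] using (h a).add ih

/-- A total derivative is affine in the highest derivative on which it depends. -/
theorem IsTotalDeriv.affine {f : Jet m → ℝ} (hf : IsTotalDeriv f) {N : ℕ}
    (hN : IsLocalOrder (N + 2) f) (p : Jet m) (v : Val m) :
    f (p + jetSingle (N + 1) (v + v)) - f p = 2 * (f (p + jetSingle (N + 1) v) - f p) := by
  obtain ⟨g, hg, rfl⟩ := hf
  -- A primitive has order one less than its derivative: a higher variable of g would show up in f,
  -- one order above.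
  have key : IsLocalOrder (N + 1) g := by
    obtain ⟨k, hk⟩ := isLocal_iff.1 hg
    replace hk := hk.mono (show k ≤ N + 1 + k by omega)
    clear hg
    induction k with
    | zero => exact hk
    | succ k ih =>
      refine ih (IsLocalOrder.of_lineDeriv_eq_zero hk fun p v => ?_)
      have := Dx_add_jetSingle (k := N + 1 + k) hk p v
      rw [hN.add_jetSingle (show N + 2 ≤ N + 1 + k + 1 by omega)] at this
      simpa using this.symm
  rw [Dx_add_jetSingle key, Dx_add_jetSingle key]
  obtain ⟨F, hF, hg'⟩ := key
  have : g = fun p => F (jetProj m (N + 1) p) := funext hg'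
  subst this
  have : (jetSingle N (v + v) : Jet m) = jetSingle N v + jetSingle N v := by
    simp [jetSingle, Pi.single_add]
  rw [lineDeriv_comp_jetProj hF, lineDeriv_comp_jetProj hF, this, map_add, map_add]
  ring

end Kernel

/-! ### The pairing and variational derivatives -/

section Variational

variable {m : ℕ}

theorem rePair_eq (a b : Val m) : rePair a b =
    inner ℝ (a.1 : ℍ[ℝ]) (b.1 : ℍ[ℝ]) + ∑ i, inner ℝ (a.2 i) (b.2 i) := by
  simp only [rePair, herm, Quaternion.inner_def, Quaternion.re_add]
  congr 1
  exact map_sum (QuaternionAlgebra.reₗ (R := ℝ) _ _ _) _ _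

theorem rePair_comm (a b : Val m) : rePair a b = rePair b a := by
  simp only [rePair_eq, real_inner_comm]

theorem rePair_self_eq_zero {a : Val m} (h : rePair a a = 0) : a = 0 := by
  rw [rePair_eq, add_eq_zero_iff_of_nonneg real_inner_self_nonneg
    (Finset.sum_nonneg fun _ _ => real_inner_self_nonneg),
    Finset.sum_eq_zero_iff_of_nonneg fun _ _ => real_inner_self_nonneg] at h
  refine Prod.ext (Subtype.ext (inner_self_eq_zero.1 h.1)) (funext fun i => ?_)
  exact inner_self_eq_zero.1 (h.2 i (Finset.mem_univ i))

/-- `rePair` as a bilinear map. -/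
def rePairₗ (m : ℕ) : Val m →ₗ[ℝ] Val m →ₗ[ℝ] ℝ :=
  LinearMap.mk₂ ℝ rePair
    (fun a b c => by simp [rePair_eq, inner_add_left, Finset.sum_add_distrib]; ring)
    (fun r a b => by simp [rePair_eq, inner_smul_left, mul_add, Finset.mul_sum])
    (fun a b c => by simp [rePair_eq, inner_add_right, Finset.sum_add_distrib]; ring)
    (fun r a b => by simp [rePair_eq, inner_smul_right, mul_add, Finset.mul_sum])

/-- `rePair` as a continuous bilinear map. -/
def rePairL (m : ℕ) : Val m →L[ℝ] Val m →L[ℝ] ℝ := (rePairₗ m).toContinuousBilinearMap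

theorem rePairL_apply (a b : Val m) : rePairL m a b = rePair a b := rfl

theorem IsLocal.pairing {f g : Jet m → Val m} (hf : IsLocal f) (hg : IsLocal g) :
    IsLocal (pairing f g) := hf.bilin (rePairL m) hg

theorem Dx_pairing {f g : Jet m → Val m} (hf : IsLocal f) (hg : IsLocal g) :
    Dx (pairing f g) = fun p => pairing (Dx f) g p + pairing f (Dx g) p :=
  Dx_bilin (rePairL m) hf hg

theorem pairing_comm (f g : Jet m → Val m) : pairing f g = pairing g f :=
  funext fun _ => rePair_comm _ _

theorem pairing_Dx_left {f g : Jet m → Val m} (hf : IsLocal f) (hg : IsLocal g) :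
    EqFunctional (pairing (Dx f) g) (pairing f (Dx (fun p => -g p))) := by
  refine ⟨pairing f g, hf.pairing hg, ?_⟩
  rw [Dx_pairing hf hg, Dx_neg hg]
  funext p
  have : pairing f (fun p => -Dx g p) p = -pairing f (Dx g) p :=
    map_neg (rePairL m (f p)) (Dx g p)
  rw [this]
  ring

/-- Integration by parts k times; the witness is (-D)^k g. -/
theorem exists_pairing_iterate_Dx {g : Jet m → Val m} (hg : IsLocal g) (k : ℕ) :
    ∃ w, IsLocal w ∧ ∀ X : Jet m → Val m, IsLocal X →
      EqFunctional (pairing (Dx^[k] X) g) (pairing X w) := by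
  induction k generalizing g with
  | zero => exact ⟨g, hg, fun X _ => EqFunctional.refl _⟩
  | succ k ih =>
    obtain ⟨w, hw, h⟩ := ih hg.neg.Dx
    refine ⟨w, hw, fun X hX => EqFunctional.trans ?_ (h X hX)⟩
    rw [Function.iterate_succ_apply']
    exact pairing_Dx_left (hX.iterate_Dx k) hg

theorem rePairₗ_nondegenerate (m : ℕ) : (rePairₗ m).Nondegenerate :=
  ⟨fun x hx => rePair_self_eq_zero (hx x), fun x hx => rePair_self_eq_zero (hx x)⟩

/-- The Riesz representation with respect to `rePair`. -/
theorem exists_riesz (m : ℕ) : ∃ R : (Val m →L[ℝ] ℝ) →L[ℝ] Val m,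
    ∀ (φ : Val m →L[ℝ] ℝ) (v : Val m), rePair v (R φ) = φ v := by
  let T := LinearMap.BilinForm.toDual (rePairₗ m) (rePairₗ_nondegenerate m)
  let b := Module.finBasis ℝ (Val m)
  refine ⟨∑ i, (ContinuousLinearMap.apply ℝ ℝ (b i)).smulRight (T.symm (b.coord i)),
    fun φ v => ?_⟩
  have hT (i) : rePair v (T.symm (b.coord i)) = b.coord i v := by
    rw [rePair_comm]
    exact LinearMap.congr_fun (T.apply_symm_apply (b.coord i)) v
  rw [← rePairL_apply, _root_.sum_apply, map_sum]
  conv_rhs => rw [← b.sum_repr v, map_sum]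
  refine Finset.sum_congr rfl fun i _ => ?_
  rw [ContinuousLinearMap.smulRight_apply, map_smul, map_smul, rePairL_apply, hT]
  simp [mul_comm]

theorem exists_isVarDeriv {G : Jet m → ℝ} (hG : IsLocal G) : ∃ w, IsVarDeriv G w := by
  obtain ⟨k, F, hF, hG⟩ := isLocal_iff.1 hG
  have : G = fun p => F (jetProj m k p) := funext hG
  subst this
  obtain ⟨R, hR⟩ := exists_riesz m
  let ι (i : Fin k) : Val m →L[ℝ] ℝ × (Fin k → Val m) :=
    (ContinuousLinearMap.inr ℝ ℝ _).comp (ContinuousLinearMap.single ℝ (fun _ : Fin k => Val m) i)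
  have hdF : IsLocal (fun p : Jet m => fderiv ℝ F (jetProj m k p)) :=
    (isLocal_jetProj k).comp (hF.fderiv_right (m := ∞) (by simp))
  -- The partial derivative of G in u_(i), turned into a vector by Riesz representation; being
  -- linear in F', it stays local.
  let g (i : Fin k) : Jet m → Val m := fun p => R ((fderiv ℝ F (jetProj m k p)).comp (ι i))
  have hg (i : Fin k) : IsLocal (g i) :=
    hdF.comp (G := fun φ => R (φ.comp (ι i)))
      (R.contDiff.comp (contDiff_id.clm_comp contDiff_const))
  have hpr (X : Jet m → Val m) : prolong X (fun p => F (jetProj m k p)) =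
      fun p => ∑ i : Fin k, pairing (Dx^[i] X) (g i) p := by
    funext p
    rw [prolong, lineDeriv_comp_jetProj hF]
    have h1 : jetProj m k ((0, fun j => Dx^[j] X p) : Jet m) = ∑ i : Fin k, ι i (Dx^[i] X p) := by
      simp only [ι, ContinuousLinearMap.comp_apply, ← map_sum]
      refine Prod.ext (by simp [jetProj_apply, Prod.fst_sum]) (funext fun j => ?_)
      simp [jetProj_apply, Prod.snd_sum, Finset.sum_apply, Pi.single_apply]
    rw [h1, map_sum]
    refine Finset.sum_congr rfl fun i _ => ?_
    rw [pairing, hR]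
    rfl
  choose w hw h using fun i : Fin k => exists_pairing_iterate_Dx (hg i) i
  refine ⟨fun p => ∑ i, w i p, ?_, fun X hX => ?_⟩
  · exact (isLocal_pi hw).comp (G := fun v : Fin k → Val m => ∑ i, v i) (by fun_prop)
  · rw [hpr]
    have h2 : pairing X (fun p => ∑ i, w i p) = fun p => ∑ i, pairing X (w i) p :=
      funext fun p => map_sum (rePairL m (X p)) _ _
    rw [h2]
    exact EqFunctional.sum _ fun i => h i X hX

/-- Test against X = a z, where a is the square of a linear function of a derivative beyond those in
z. The density a |z|² is then quadratic in its highest derivative, while total derivatives are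
affine there, so |z|² = 0. -/
theorem eq_zero_of_pairing {z : Jet m → Val m} (hz : IsLocal z)
    (h : ∀ X : Jet m → Val m, IsLocal X → IsTotalDeriv (pairing X z)) : z = 0 := by
  obtain ⟨N, hN⟩ := isLocal_iff.1 hz
  let c : Val m := (⟨⟨0, 1, 0, 0⟩, rfl⟩, 0)
  have hc : rePair c c ≠ 0 := fun h0 => by
    have h1 := congrArg (fun a : Val m => (a.1 : ℍ[ℝ]).imI) (rePair_self_eq_zero h0)
    simp [c] at h1
  let a : Jet m → ℝ := fun p => rePair c (p.2 (N + 1)) ^ 2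
  have ha : IsLocalOrder (N + 2) a :=
    (isLocalOrder_coord (N + 1)).comp (G := fun v => (rePairL m c v) ^ 2) (by fun_prop)
  have hX : IsLocal (fun p => a p • z p) := ha.isLocal.smul hz
  have hXz : pairing (fun p => a p • z p) z = fun p => a p * rePair (z p) (z p) := by
    funext p
    change rePairL m (a p • z p) (z p) = _
    rw [map_smul]
    rfl
  have hzz : IsLocalOrder N (fun p => rePair (z p) (z p)) :=
    hN.comp (G := fun v => rePairL m v v) (by fun_prop)
  have hord : IsLocalOrder (N + 2) (pairing (fun p => a p • z p) z) := by
    rw [hXz]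
    exact (ha.prodMk (hzz.mono (by omega))).comp (G := fun x : ℝ × ℝ => x.1 * x.2) (by fun_prop)
  funext p
  -- Affinity annihilates the second difference in the direction c, which is 2 |c|⁴ |z|².
  have key := (h _ hX).affine hord p c
  have hadd (v : Val m) : rePair c ((p + jetSingle (N + 1) v).2 (N + 1)) =
      rePair c (p.2 (N + 1)) + rePair c v := by
    have : (p + jetSingle (N + 1) v).2 (N + 1) = p.2 (N + 1) + v := by simp [jetSingle]
    rw [this]
    exact map_add (rePairL m c) _ _
  have hcc : rePair c (c + c) = rePair c c + rePair c c := map_add (rePairL m c) _ _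
  rw [hXz] at key
  simp only [hzz.add_jetSingle (show N ≤ N + 1 by omega), a, hadd, hcc] at key
  refine rePair_self_eq_zero ?_
  have h3 : rePair c c ^ 2 * rePair (z p) (z p) = 0 := by linear_combination key / 2
  exact (mul_eq_zero.1 h3).resolve_left (pow_ne_zero 2 hc)

theorem IsVarDeriv.unique {G : Jet m → ℝ} {w w' : Jet m → Val m} (hw : IsVarDeriv G w)
    (hw' : IsVarDeriv G w') : w = w' := by
  have := eq_zero_of_pairing (hw.1.sub hw'.1) fun X hX => by
    have h1 := (hw.2 X hX).symm.trans (hw'.2 X hX)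
    have h2 : pairing X (fun p => w p - w' p) = fun p => pairing X w p - pairing X w' p :=
      funext fun p => map_sub (rePairL m (X p)) _ _
    rw [h2]
    exact h1
  funext p
  exact sub_eq_zero.1 (congrFun this p)

theorem isVarDeriv_varDeriv {G : Jet m → ℝ} (hG : IsLocal G) : IsVarDeriv G (varDeriv G) := by
  rw [varDeriv, dif_pos (exists_isVarDeriv hG)]
  exact (exists_isVarDeriv hG).choose_spec

theorem IsVarDeriv.varDeriv_eq {G : Jet m → ℝ} {w : Jet m → Val m} (hw : IsVarDeriv G w) :
    varDeriv G = w := by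
  have h : ∃ w, IsVarDeriv G w := ⟨w, hw⟩
  rw [varDeriv, dif_pos h]
  exact h.choose_spec.unique hw

end Variational
end
end QuatHierarchy

namespace QuatHierarchy
noncomputable section

/-! ### The symmetric Lie algebra in matrix form -/

section Shapes

/-- The index set of the matrices: two distinguished indices and `m` further ones. -/
abbrev Idx (m : ℕ) : Type := Option (Option (Fin m))

variable {m : ℕ}

theorem matrix_ext_idx {R : Type*} {X Y : Matrix (Idx m) (Idx m) R}
    (h00 : X none none = Y none none)
    (h01 : X none (some none) = Y none (some none))
    (h10 : X (some none) none = Y (some none) none)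
    (h11 : X (some none) (some none) = Y (some none) (some none))
    (h0 : ∀ j, X none (some (some j)) = Y none (some (some j)))
    (h1 : ∀ j, X (some none) (some (some j)) = Y (some none) (some (some j)))
    (h0' : ∀ j, X (some (some j)) none = Y (some (some j)) none)
    (h1' : ∀ j, X (some (some j)) (some none) = Y (some (some j)) (some none))
    (h : ∀ i j, X (some (some i)) (some (some j)) = Y (some (some i)) (some (some j))) :
    X = Y := by
  ext i j
  rcases i with _ | _ | i <;> rcases j with _ | _ | j <;> simp_all

variable {R : Type*} [Ring R]

/-- The Cartan element `E₀₁ + E₁₀`. -/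
def eMat : Matrix (Idx m) (Idx m) R
  | none, some none => 1
  | some none, none => 1
  | _, _ => 0

/-- The multiple `ρ (E₀₁ + E₁₀)` of the Cartan element. -/
def rhoMat (ρ : R) : Matrix (Idx m) (Idx m) R
  | none, some none => ρ
  | some none, none => ρ
  | _, _ => 0

/-- The signature matrix `diag(-1, 1, …, 1)`. -/
def sigMat : Matrix (Idx m) (Idx m) R := Matrix.diagonal fun i => i.elim (-1) fun _ => 1

theorem sigMat_mul_self : (sigMat : Matrix (Idx m) (Idx m) R) * sigMat = 1 := by
  rw [sigMat, Matrix.diagonal_mul_diagonal, ← Matrix.diagonal_one]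
  congr 1
  funext i
  rcases i with _ | i <;> simp

/-- The elements `diag(q, q, S)` commuting with the Cartan element. -/
def parMat (q : R) (S : Fin m → Fin m → R) : Matrix (Idx m) (Idx m) R
  | none, none => q
  | some none, some none => q
  | some (some i), some (some j) => S i j
  | _, _ => 0

theorem eMat_cube : (eMat : Matrix (Idx m) (Idx m) R) * eMat * eMat = eMat := by
  apply matrix_ext_idx <;> simp [Matrix.mul_apply, Fintype.sum_option, eMat]

theorem sigMat_conj_eMat : (sigMat : Matrix (Idx m) (Idx m) R) * eMat * sigMat = -eMat := by
  apply matrix_ext_idx <;> simp [sigMat, eMat]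

theorem eMat_commutator_rhoMat (ρ : R) :
    eMat * (rhoMat ρ : Matrix (Idx m) (Idx m) R) - rhoMat ρ * eMat = 0 := by
  apply matrix_ext_idx <;> simp [Matrix.mul_apply, Fintype.sum_option, eMat, rhoMat]

theorem eq_zero_of_neg_eq [Algebra ℝ R] {x : R} (h : -x = x) : x = 0 := by
  have h2 : (2 : ℝ) • x = 0 := by
    rw [two_smul]; nth_rewrite 1 [← h]; exact neg_add_cancel x
  calc x = (1 / 2 : ℝ) • (2 : ℝ) • x := by module
    _ = 0 := by rw [h2, smul_zero]

theorem mapMatrix_isDeriv {D : R →+ R} (hD : IsDeriv D) :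
    IsDeriv (D.mapMatrix : Matrix (Idx m) (Idx m) R →+ Matrix (Idx m) (Idx m) R) := by
  intro X Y
  ext i j
  simp only [AddMonoidHom.mapMatrix_apply, Matrix.map_apply, Matrix.mul_apply, Matrix.add_apply,
    map_sum, hD _ _, Finset.sum_add_distrib]

variable [StarRing R]

/-- The embedding of `𝒬 ⊕ ℍ ^ m` into the even part of the Lie algebra. -/
def kMat (a : R) (v : Fin m → R) : Matrix (Idx m) (Idx m) R
  | none, none => -a
  | some none, some none => a
  | some none, some (some j) => v j
  | some (some i), some none => -star (v i)
  | _, _ => 0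

/-- The embedding of `𝒬 ⊕ ℍ ^ m` into the odd part of the Lie algebra. -/
def mMat (a : R) (v : Fin m → R) : Matrix (Idx m) (Idx m) R
  | none, some none => a
  | some none, none => -a
  | none, some (some j) => v j
  | some (some i), none => star (v i)
  | _, _ => 0

theorem sigMat_conj_kMat (a : R) (v : Fin m → R) :
    sigMat * kMat a v * sigMat = kMat a v := by
  apply matrix_ext_idx <;> simp [sigMat, kMat]

theorem star_eMat : star (eMat : Matrix (Idx m) (Idx m) R) = eMat := by
  rw [Matrix.star_eq_conjTranspose]
  apply matrix_ext_idx <;> simp [eMat]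

theorem star_kMat {a : R} (ha : star a = -a) (v : Fin m → R) : star (kMat a v) = -kMat a v := by
  rw [Matrix.star_eq_conjTranspose]
  apply matrix_ext_idx <;> simp [kMat, ha]

/-- ad e exchanges the even and odd types, with factor 2 on the scalar slot and 1 on the vector
slot. This asymmetry is the origin of the halves and quarters in 𝒥. -/
theorem eMat_commutator_kMat (a : R) (v : Fin m → R) :
    eMat * kMat a v - kMat a v * eMat = mMat (a + a) v := by
  apply matrix_ext_idx <;> simp [Matrix.mul_apply, Fintype.sum_option, eMat, kMat, mMat]
  all_goals abel

theorem eMat_commutator_mMat (a : R) (v : Fin m → R) :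
    eMat * mMat a v - mMat a v * eMat = kMat (a + a) v := by
  apply matrix_ext_idx <;> simp [Matrix.mul_apply, Fintype.sum_option, eMat, kMat, mMat]
  all_goals abel

theorem kMat_injective {a b : R} {v w : Fin m → R} (h : kMat a v = kMat b w) : a = b ∧ v = w := by
  refine ⟨by simpa [kMat] using congrFun (congrFun h (some none)) (some none), funext fun j => ?_⟩
  simpa [kMat] using congrFun (congrFun h (some none)) (some (some j))

/-- [e, X] determines X up to the commutant of e, whose even skew-Hermitian elements are the block
matrices diag(q, q, S). -/
theorem eq_kMat_add_parMat [Algebra ℝ R] {X : Matrix (Idx m) (Idx m) R}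
    (h1 : sigMat * X * sigMat = X) (h2 : star X = -X) {a : R} (ha : star a = -a) {v : Fin m → R}
    (h3 : eMat * X - X * eMat = mMat (a + a) v) :
    ∃ q S, X = kMat a v + parMat q S ∧ star q = -q ∧ ∀ i j, star (S i j) = -S j i := by
  have hs (i j) := congrFun (congrFun h1 i) j
  have hst (i j) : star (X j i) = -X i j := congrFun (congrFun h2 i) j
  have hc (i j) := congrFun (congrFun h3 i) j
  have h01 : X (some none) (some none) - X none none = a + a := by
    simpa [Matrix.mul_apply, Fintype.sum_option, eMat, mMat] using hc none (some none)
  have hv (j) : X (some none) (some (some j)) = v j := by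
    simpa [Matrix.mul_apply, Fintype.sum_option, eMat, mMat] using hc none (some (some j))
  refine ⟨X (some none) (some none) - a, fun i j => X (some (some i)) (some (some j)), ?_, ?_,
    fun i j => hst _ _⟩
  · apply matrix_ext_idx
    · simp only [Matrix.add_apply, kMat, parMat]
      rw [eq_add_of_sub_eq h01]; abel
    · simpa [kMat, parMat] using eq_zero_of_neg_eq (by simpa [sigMat] using hs none (some none))
    · simpa [kMat, parMat] using eq_zero_of_neg_eq (by simpa [sigMat] using hs (some none) none)
    · simp [kMat, parMat]
    · intro j
      simpa [kMat, parMat] using eq_zero_of_neg_eq (by simpa [sigMat] using hs none (some (some j)))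
    · intro j
      simpa [kMat, parMat] using hv j
    · intro j
      simpa [kMat, parMat] using eq_zero_of_neg_eq (by simpa [sigMat] using hs (some (some j)) none)
    · intro j
      simp [kMat, parMat, ← hv, hst]
    · intro i j
      simp [kMat, parMat]
  · rw [star_sub, hst, ha]; abel

/-- In the odd Hermitian part the commutant of e is reduced to self-conjugate multiples of e. -/
theorem eq_mMat_add_rhoMat [Algebra ℝ R] {X : Matrix (Idx m) (Idx m) R}
    (h1 : sigMat * X * sigMat = -X) (h2 : star X = X) {a : R} (ha : star a = -a) {v : Fin m → R}
    (h3 : eMat * X - X * eMat = kMat (a + a) v) :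
    ∃ ρ, X = mMat a v + rhoMat ρ ∧ star ρ = ρ := by
  have hs (i j) := congrFun (congrFun h1 i) j
  have hst (i j) : star (X j i) = X i j := congrFun (congrFun h2 i) j
  have hc (i j) := congrFun (congrFun h3 i) j
  have h01 : X none (some none) - X (some none) none = a + a := by
    simpa [Matrix.mul_apply, Fintype.sum_option, eMat, kMat] using hc (some none) (some none)
  have hv (j) : X none (some (some j)) = v j := by
    simpa [Matrix.mul_apply, Fintype.sum_option, eMat, kMat] using hc (some none) (some (some j))
  refine ⟨X none (some none) - a, ?_, ?_⟩
  · apply matrix_ext_idx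
    · simpa [mMat, rhoMat] using eq_zero_of_neg_eq (by simpa [sigMat] using (hs none none).symm)
    · simp [mMat, rhoMat]
    · simp only [Matrix.add_apply, mMat, rhoMat]
      rw [eq_add_of_sub_eq h01]; abel
    · simpa [mMat, rhoMat] using
        eq_zero_of_neg_eq (by simpa [sigMat] using (hs (some none) (some none)).symm)
    · intro j
      simpa [mMat, rhoMat] using hv j
    · intro j
      simpa [mMat, rhoMat] using
        eq_zero_of_neg_eq (by simpa [sigMat] using (hs (some none) (some (some j))).symm)
    · intro j
      simp [mMat, rhoMat, ← hv, hst]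
    · intro j
      simpa [mMat, rhoMat] using
        eq_zero_of_neg_eq (by simpa [sigMat] using (hs (some (some j)) (some none)).symm)
    · intro i j
      simpa [mMat, rhoMat] using
        eq_zero_of_neg_eq (by simpa [sigMat] using (hs (some (some i)) (some (some j))).symm)
  · rw [star_sub, hst, ha, eq_add_of_sub_eq h01]; abel

variable [Algebra ℝ R] {D : R →+ R}

/-- The matrix form of the first Hamiltonian operator. -/
theorem nabla_kMat (hD : ∀ a, D (star a) = star (D a)) {u w q : R} {U Z : Fin m → R}
    {S : Fin m → Fin m → R} (hu : star u = -u) (hw : star w = -w) (hq : star q = -q)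
    (hS : ∀ i j, star (S i j) = -S j i)
    (hDq : D q = u * w - w * u - (1 / 2 : ℝ) • (∑ i, U i * star (Z i) - ∑ i, Z i * star (U i)))
    (hDS : ∀ i j, D (S i j) = -(star (U i) * Z j - star (Z i) * U j)) :
    D.mapMatrix (kMat w Z + parMat q S) -
      (kMat u U * (kMat w Z + parMat q S) - (kMat w Z + parMat q S) * kMat u U) =
    kMat (D w - (u * q - q * u) + (1 / 2 : ℝ) • (∑ i, U i * star (Z i) - ∑ i, Z i * star (U i)))
      (fun j => D (Z j) + q * U j - ∑ i, U i * S i j + w * U j - u * Z j) := by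
  -- The hypotheses on D q and D S cancel the components in the commutant of e, so only a `kMat`
  -- survives.
  apply matrix_ext_idx
  all_goals simp only [AddMonoidHom.mapMatrix_apply, Matrix.map_apply, Matrix.mul_apply,
    Matrix.add_apply, Matrix.sub_apply, Fintype.sum_option, kMat, parMat, map_add, map_neg, map_zero,
    hDq, hDS, add_zero, zero_add, mul_zero, zero_mul, Finset.sum_const_zero, mul_add,
    add_mul, mul_neg, neg_mul, Finset.sum_neg_distrib, neg_zero, sub_self, implies_true]
  · module
  · module
  · intro j
    abel
  · intro j
    simp only [star_add, star_sub, star_mul, star_sum, hS, hu, hw, hq, hD, neg_mul, mul_neg,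
      Finset.sum_neg_distrib]
    abel
  · intro i j
    abel

/-- The matrix form of the symplectic operator. -/
theorem nabla_mMat (hD : ∀ a, D (star a) = star (D a)) {u s ρ : R} {U Z : Fin m → R}
    (hu : star u = -u) (hs : star s = -s) (hρ : star ρ = ρ)
    (hρc : ∀ a, ρ * a = a * ρ)
    (hDρ : D ρ = -(u * s + s * u) +
      (1 / 2 : ℝ) • (∑ i, U i * star (Z i) + ∑ i, Z i * star (U i))) :
    D.mapMatrix (mMat s Z + rhoMat ρ) -
      (kMat u U * (mMat s Z + rhoMat ρ) - (mMat s Z + rhoMat ρ) * kMat u U) =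
    mMat (D s + (1 / 2 : ℝ) • (∑ i, U i * star (Z i) - ∑ i, Z i * star (U i)) + (ρ * u + ρ * u))
      (fun j => D (Z j) + s * U j + u * Z j + ρ * U j) := by
  have hρu : u * ρ = ρ * u := (hρc u).symm
  -- The hypothesis on D ρ cancels the component along e, and centrality of ρ merges the two
  -- products of ρ and u.
  apply matrix_ext_idx
  all_goals simp only [AddMonoidHom.mapMatrix_apply, Matrix.map_apply, Matrix.mul_apply,
    Matrix.add_apply, Matrix.sub_apply, Fintype.sum_option, kMat, mMat, rhoMat, map_add, map_neg,
    map_zero, hDρ, add_zero, zero_add, mul_zero, zero_mul, Finset.sum_const_zero, mul_add,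
    add_mul, mul_neg, neg_mul, Finset.sum_neg_distrib, neg_zero, sub_self, implies_true, hρu]
  · module
  · module
  · intro j
    abel
  · intro j
    simp only [star_add, star_mul, hρ, hu, hs, hD, mul_neg]
    abel

end Shapes
end
end QuatHierarchy

namespace QuatHierarchy
noncomputable section

/-! ### Quaternion-valued local functions and the matrix form of the operators -/

section LocalRing

variable {m : ℕ}

/-- The algebra of quaternion-valued functions on the jet space. -/
def locRing (m : ℕ) : Subalgebra ℝ (Jet m → ℍ[ℝ]) where
  carrier := {f | IsLocal f}
  mul_mem' hf hg := IsLocal.bilin (ContinuousLinearMap.mul ℝ ℍ[ℝ]) hf hg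
  add_mem' hf hg := IsLocal.add hf hg
  algebraMap_mem' r := isLocal_const (algebraMap ℝ ℍ[ℝ] r)

/-- Conjugation as a continuous linear map. -/
def starCLM : ℍ[ℝ] →L[ℝ] ℍ[ℝ] := LinearMap.toContinuousLinearMap
  { toFun := star
    map_add' := star_add
    map_smul' := fun r a => by ext <;> simp }

instance : StarRing (locRing m) where
  star f := ⟨fun p => star (f.1 p), IsLocal.clm starCLM f.2⟩
  star_involutive f := Subtype.ext (funext fun p => star_star (f.1 p))
  star_mul f g := Subtype.ext (funext fun p => star_mul (f.1 p) (g.1 p))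
  star_add f g := Subtype.ext (funext fun p => star_add (f.1 p) (g.1 p))

theorem locRing_ext {f g : locRing m} (h : ∀ p, f.1 p = g.1 p) : f = g :=
  Subtype.ext (funext h)

@[simp] theorem locRing_star_apply (f : locRing m) (p : Jet m) :
    (star f).1 p = star (f.1 p) := rfl

@[simp] theorem locRing_mul_apply (f g : locRing m) (p : Jet m) :
    (f * g).1 p = f.1 p * g.1 p := rfl

@[simp] theorem locRing_add_apply (f g : locRing m) (p : Jet m) :
    (f + g).1 p = f.1 p + g.1 p := rfl

@[simp] theorem locRing_sub_apply (f g : locRing m) (p : Jet m) :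
    (f - g).1 p = f.1 p - g.1 p := rfl

@[simp] theorem locRing_neg_apply (f : locRing m) (p : Jet m) : (-f).1 p = -f.1 p := rfl

@[simp] theorem locRing_smul_apply (c : ℝ) (f : locRing m) (p : Jet m) :
    (c • f).1 p = c • f.1 p := rfl

@[simp] theorem locRing_zero_apply (p : Jet m) : (0 : locRing m).1 p = 0 := rfl

@[simp] theorem locRing_sum_apply {ι : Type} (s : Finset ι) (f : ι → locRing m) (p : Jet m) :
    (∑ i ∈ s, f i).1 p = ∑ i ∈ s, (f i).1 p := by
  rw [AddSubmonoidClass.coe_finsetSum, Finset.sum_apply]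

/-- Differentiation of quaternion-valued functions along a vector field. -/
def alongHom (v : Jet m → Jet m) (hv : IsLocalField v) : locRing m →+ locRing m where
  toFun f := ⟨along v f.1, f.2.along hv⟩
  map_zero' := locRing_ext fun p => by
    change lineDeriv ℝ (fun _ => (0 : ℍ[ℝ])) p (v p) = 0
    simp [lineDeriv]
  map_add' f g := locRing_ext fun p => lineDeriv_add f.2 g.2 p (v p)

theorem isDeriv_alongHom (v : Jet m → Jet m) (hv : IsLocalField v) : IsDeriv (alongHom v hv) :=
  fun f g => locRing_ext fun p =>
    lineDeriv_bilin (ContinuousLinearMap.mul ℝ ℍ[ℝ]) f.2 g.2 p (v p)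

theorem alongHom_star (v : Jet m → Jet m) (hv : IsLocalField v) (f : locRing m) :
    alongHom v hv (star f) = star (alongHom v hv f) :=
  locRing_ext fun p => lineDeriv_clm starCLM f.2 p (v p)

/-- The total derivative of quaternion-valued functions. -/
def totalHom (m : ℕ) : locRing m →+ locRing m := alongHom (totalField m) isLocalField_total

theorem totalHom_apply (f : locRing m) (p : Jet m) : (totalHom m f).1 p = Dx f.1 p := rfl

/-- The action of an evolutionary vector field on quaternion-valued functions. -/
def prolongHom (X : Jet m → Val m) (hX : IsLocal X) : locRing m →+ locRing m :=
  alongHom (prolongField X) (isLocalField_prolong hX)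

theorem totalHom_prolongHom (X : Jet m → Val m) (hX : IsLocal X) (f : locRing m) :
    totalHom m (prolongHom X hX f) = prolongHom X hX (totalHom m f) :=
  Subtype.ext (Dx_prolong hX f.2)

/-- The matrix ring containing the Lie algebra. -/
abbrev LMat (m : ℕ) : Type := Matrix (Idx m) (Idx m) (locRing m)

/-- The scalar component as a quaternion-valued function. -/
def scal (w : Jet m → Val m) (hw : IsLocal w) : locRing m :=
  ⟨fun p => ((w p).1 : ℍ[ℝ]),
    IsLocal.clm (ImQ.subtypeL.comp (ContinuousLinearMap.fst ℝ ImQ (QVec m))) hw⟩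

/-- The vector components as quaternion-valued functions. -/
def vect (w : Jet m → Val m) (hw : IsLocal w) (j : Fin m) : locRing m :=
  ⟨fun p => (w p).2 j, IsLocal.clm ((ContinuousLinearMap.proj (R := ℝ) j).comp
    (ContinuousLinearMap.snd ℝ ImQ (QVec m))) hw⟩

@[simp] theorem scal_apply (w : Jet m → Val m) (hw : IsLocal w) (p : Jet m) :
    (scal w hw).1 p = (w p).1 := rfl

@[simp] theorem vect_apply (w : Jet m → Val m) (hw : IsLocal w) (j : Fin m) (p : Jet m) :
    (vect w hw j).1 p = (w p).2 j := rfl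

theorem star_imQ (a : ImQ) : star (a : ℍ[ℝ]) = -a := by
  have ha : (a : ℍ[ℝ]).re = 0 := a.2
  ext <;> simp [ha]

theorem star_scal (w : Jet m → Val m) (hw : IsLocal w) : star (scal w hw) = -scal w hw :=
  locRing_ext fun p => star_imQ (w p).1

/-- The matrix form of a pair of functions. -/
def kOf (w : Jet m → Val m) (hw : IsLocal w) : LMat m := kMat (scal w hw) (vect w hw)

theorem kOf_congr {w w' : Jet m → Val m} (h : w = w') (hw : IsLocal w) (hw' : IsLocal w') :
    kOf w hw = kOf w' hw' := by
  subst h; rfl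

theorem eq_of_kOf_eq {w w' : Jet m → Val m} {hw : IsLocal w} {hw' : IsLocal w'}
    (h : kOf w hw = kOf w' hw') : w = w' := by
  obtain ⟨h1, h2⟩ := kMat_injective h
  funext p
  refine Prod.ext (Subtype.ext (congrFun (congrArg Subtype.val h1) p)) (funext fun j => ?_)
  exact congrFun (congrArg Subtype.val (congrFun h2 j)) p

theorem alongHom_kOf (v : Jet m → Jet m) (hv : IsLocalField v) (w : Jet m → Val m)
    (hw : IsLocal w) : (alongHom v hv).mapMatrix (kOf w hw) = kOf (along v w) (hw.along hv) := by
  have h1 : alongHom v hv (scal w hw) = scal (along v w) (hw.along hv) :=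
    locRing_ext fun p => lineDeriv_clm
      (ImQ.subtypeL.comp (ContinuousLinearMap.fst ℝ ImQ (QVec m))) hw p (v p)
  have h2 (j) : alongHom v hv (vect w hw j) = vect (along v w) (hw.along hv) j :=
    locRing_ext fun p => lineDeriv_clm ((ContinuousLinearMap.proj (R := ℝ) j).comp
      (ContinuousLinearMap.snd ℝ ImQ (QVec m))) hw p (v p)
  rw [kOf, kOf]
  apply matrix_ext_idx <;> simp [kMat, alongHom_star, h1, h2]

theorem alongHom_eMat (v : Jet m → Jet m) (hv : IsLocalField v) :
    (alongHom v hv).mapMatrix (eMat : LMat m) = 0 := by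
  have h1 : alongHom v hv 1 = 0 := by
    have := isDeriv_alongHom v hv 1 1
    simpa using this
  apply matrix_ext_idx <;> simp [eMat, h1]

theorem isLocal_uFun (m : ℕ) : IsLocal (uFun m) := isLocal_coord 0

/-- The coordinates `(u, 𝐮)` in matrix form. -/
def uMat (m : ℕ) : LMat m := kOf (uFun m) (isLocal_uFun m)

/-- The total derivative on matrices. -/
def totalMat (m : ℕ) : LMat m →+ LMat m := (totalHom m).mapMatrix

theorem isDeriv_totalMat : IsDeriv (totalMat m) := mapMatrix_isDeriv (isDeriv_alongHom _ _)

/-- The action of an evolutionary vector field on matrices. -/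
def prolongMat (X : Jet m → Val m) (hX : IsLocal X) : LMat m →+ LMat m :=
  (prolongHom X hX).mapMatrix

theorem isDeriv_prolongMat (X : Jet m → Val m) (hX : IsLocal X) : IsDeriv (prolongMat X hX) :=
  mapMatrix_isDeriv (isDeriv_alongHom _ _)

theorem totalMat_prolongMat (X : Jet m → Val m) (hX : IsLocal X) (Y : LMat m) :
    totalMat m (prolongMat X hX Y) = prolongMat X hX (totalMat m Y) := by
  exact Matrix.ext fun i j => totalHom_prolongHom X hX (Y i j)

theorem prolong_uFun (X : Jet m → Val m) : prolong X (uFun m) = X :=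
  funext fun p => lineDeriv_coord 0 p _

theorem prolongMat_uMat (X : Jet m → Val m) (hX : IsLocal X) :
    prolongMat X hX (uMat m) = kOf X hX := by
  rw [uMat, prolongMat, prolongHom, alongHom_kOf]
  exact kOf_congr (prolong_uFun X) _ _

/-- The covariant derivative `D - [u, ·]`. -/
def nabla (X : LMat m) : LMat m := totalMat m X - (uMat m * X - X * uMat m)

/-- The real trace. -/
def reTrace (m : ℕ) : LMat m →+ (Jet m → ℝ) where
  toFun X p := ∑ i, ((X i i).1 p).re
  map_zero' := by funext p; simp
  map_add' X Y := by funext p; simp [Finset.sum_add_distrib]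

theorem reTrace_apply (X : LMat m) (p : Jet m) : reTrace m X p = ∑ i, ((X i i).1 p).re := rfl

theorem re_mul_comm (a b : ℍ[ℝ]) : (a * b).re = (b * a).re := by
  simp only [Quaternion.re_mul]; ring

theorem re_sum {ι : Type} (s : Finset ι) (f : ι → ℍ[ℝ]) :
    (∑ i ∈ s, f i).re = ∑ i ∈ s, (f i).re :=
  map_sum (QuaternionAlgebra.reₗ (R := ℝ) _ _ _) _ _

theorem reTrace_mul_comm (X Y : LMat m) : reTrace m (X * Y) = reTrace m (Y * X) := by
  funext p
  simp only [reTrace_apply, Matrix.mul_apply, locRing_sum_apply, locRing_mul_apply, re_sum]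
  rw [Finset.sum_comm]
  exact Finset.sum_congr rfl fun i _ => Finset.sum_congr rfl fun j _ => re_mul_comm _ _

/-- The real part as a continuous linear map. -/
def reCLM : ℍ[ℝ] →L[ℝ] ℝ :=
  LinearMap.toContinuousLinearMap (QuaternionAlgebra.reₗ (R := ℝ) (-1) 0 (-1))

theorem reCLM_apply (a : ℍ[ℝ]) : reCLM a = a.re := rfl

theorem reTrace_eq (X : LMat m) : reTrace m X = fun p =>
    (∑ i, reCLM.comp (ContinuousLinearMap.proj (R := ℝ) i) : (Idx m → ℍ[ℝ]) →L[ℝ] ℝ)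
      (fun i => (X i i).1 p) := by
  funext p
  rw [_root_.sum_apply]
  rfl

theorem isLocal_reTrace (X : LMat m) : IsLocal (reTrace m X) := by
  rw [reTrace_eq]
  exact (isLocal_pi fun i => (X i i).2).clm _

theorem along_reTrace (v : Jet m → Jet m) (hv : IsLocalField v) (X : LMat m) :
    along v (reTrace m X) = reTrace m ((alongHom v hv).mapMatrix X) := by
  funext p
  rw [reTrace_eq, reTrace_eq]
  refine (lineDeriv_clm _ (isLocal_pi fun i => (X i i).2) p (v p)).trans ?_
  congr 1
  exact lineDeriv_pi (fun i => (X i i).2) p (v p)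

theorem Dx_reTrace (X : LMat m) : Dx (reTrace m X) = reTrace m (totalMat m X) :=
  along_reTrace _ _ X

theorem isTotalDeriv_reTrace (X : LMat m) : IsTotalDeriv (reTrace m (totalMat m X)) :=
  ⟨_, isLocal_reTrace X, Dx_reTrace X⟩

theorem reTrace_commutator (X Y : LMat m) : reTrace m (X * Y - Y * X) = 0 := by
  rw [map_sub, reTrace_mul_comm, sub_self]

/-- Integration by parts: D - [u, ·] is a derivation, and the trace kills commutators. -/
theorem isTotalDeriv_reTrace_nabla (X Y : LMat m) :
    IsTotalDeriv (fun p => reTrace m (nabla X * Y) p + reTrace m (X * nabla Y) p) := by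
  have h : nabla X * Y + X * nabla Y =
      totalMat m (X * Y) - (uMat m * (X * Y) - X * Y * uMat m) := by
    rw [isDeriv_totalMat X Y, nabla, nabla]
    simp only [sub_mul, mul_sub, mul_assoc]
    abel
  have h2 : (fun p => reTrace m (nabla X * Y) p + reTrace m (X * nabla Y) p) =
      reTrace m (totalMat m (X * Y)) := by
    have := congrArg (reTrace m) h
    rw [map_add, map_sub, reTrace_commutator, sub_zero] at this
    exact this
  rw [h2]
  exact isTotalDeriv_reTrace _

theorem reTrace_kOf_mul (w v : Jet m → Val m) (hw : IsLocal w) (hv : IsLocal v) (p : Jet m) :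
    reTrace m (kOf w hw * kOf v hv) p = -2 * pairing w v p := by
  have hre (x y : ℍ[ℝ]) : (star x * y).re = (y * star x).re := re_mul_comm _ _
  have hre' (x y : ℍ[ℝ]) : (x * star y).re = (y * star x).re := by
    rw [← Quaternion.re_star, star_mul, star_star]
  simp only [reTrace_apply, Matrix.mul_apply, Fintype.sum_option, kOf, kMat, pairing, rePair, herm,
    locRing_add_apply, locRing_sum_apply, locRing_mul_apply, locRing_neg_apply, locRing_star_apply,
    scal_apply, vect_apply, star_imQ, Quaternion.re_add, re_sum, mul_neg, neg_mul,
    Quaternion.re_neg, mul_zero, locRing_zero_apply, Finset.sum_const_zero, hre,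
    Finset.sum_neg_distrib, Quaternion.re_zero, add_zero, zero_add, neg_neg]
  have : ∑ i, ((v p).2 i * star ((w p).2 i)).re = ∑ i, ((w p).2 i * star ((v p).2 i)).re :=
    Finset.sum_congr rfl fun i _ => hre' _ _
  rw [this]
  ring

theorem reTrace_kMat_mul_parMat (a q : locRing m) (v : Fin m → locRing m)
    (S : Fin m → Fin m → locRing m) : reTrace m (kMat a v * parMat q S) = 0 := by
  funext p
  simp [reTrace_apply, Matrix.mul_apply, Fintype.sum_option, kMat, parMat]

theorem reTrace_mMat_mul_eMat (a : locRing m) (v : Fin m → locRing m) :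
    reTrace m (mMat a v * eMat) = 0 := by
  funext p
  simp [reTrace_apply, Matrix.mul_apply, Fintype.sum_option, mMat, eMat]

theorem reTrace_rhoMat_mul_eMat (ρ : locRing m) (p : Jet m) :
    reTrace m (rhoMat ρ * eMat) p = 2 * (ρ.1 p).re := by
  simp [reTrace_apply, Matrix.mul_apply, Fintype.sum_option, rhoMat, eMat]
  ring

end LocalRing
end
end QuatHierarchy

namespace QuatHierarchy
noncomputable section

/-! ### The operators `ℋ` and `𝒥` in matrix form -/

section Operators

variable {m : ℕ}

theorem coe_Dx_imQ {f : Jet m → ImQ} (hf : IsLocal f) (p : Jet m) :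
    ((Dx f p : ImQ) : ℍ[ℝ]) = Dx (fun q => (f q : ℍ[ℝ])) p :=
  (lineDeriv_clm ImQ.subtypeL hf p _).symm

theorem Dx_pi_apply {ι : Type} [Fintype ι] {E : Type} [NormedAddCommGroup E] [NormedSpace ℝ E]
    {f : Jet m → ι → E} (hf : IsLocal f) (p : Jet m) (j : ι) :
    Dx f p j = Dx (fun q => f q j) p :=
  (lineDeriv_clm (ContinuousLinearMap.proj (R := ℝ) (φ := fun _ : ι => E) j) hf p _).symm

/-- The projection to the imaginary quaternions. -/
def imCLM : ℍ[ℝ] →L[ℝ] ImQ := LinearMap.toContinuousLinearMap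
  { toFun := fun a => ⟨a.im, rfl⟩
    map_add' := fun a b => Subtype.ext (by ext <;> simp)
    map_smul' := fun r a => Subtype.ext (by ext <;> simp) }

theorem imCLM_coe (a : ImQ) : imCLM (a : ℍ[ℝ]) = a := by
  have ha : (a : ℍ[ℝ]).re = 0 := a.2
  refine Subtype.ext ?_
  change (a : ℍ[ℝ]).im = a
  ext <;> simp [ha]

theorem exists_kOf {f : Jet m → Val m} {a : locRing m} {v : Fin m → locRing m}
    (h1 : ∀ p, a.1 p = (f p).1) (h2 : ∀ p j, (v j).1 p = (f p).2 j) :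
    ∃ hf : IsLocal f, kMat a v = kOf f hf := by
  have hl : IsLocal (fun p => (imCLM (a.1 p), fun j => (v j).1 p)) :=
    (IsLocal.clm imCLM a.2).prodMk (isLocal_pi fun j => (v j).2)
  have hf : (fun p => (imCLM (a.1 p), fun j => (v j).1 p)) = f := by
    funext p
    refine Prod.ext ?_ (funext fun j => h2 p j)
    simp only [h1, imCLM_coe]
  refine ⟨hf ▸ hl, ?_⟩
  rw [kOf]
  congr 1
  · exact locRing_ext h1
  · exact funext fun j => locRing_ext fun p => h2 p j

theorem totalHom_smul (c : ℝ) (f : locRing m) : totalHom m (c • f) = c • totalHom m f :=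
  Subtype.ext (Dx_const_smul c f.2)

theorem totalHom_star (f : locRing m) : totalHom m (star f) = star (totalHom m f) :=
  alongHom_star _ _ f

theorem DomH.isLocal {w : Jet m → Val m} (h : DomH w) : IsLocal w := h.1

theorem DomJ.isLocal {w : Jet m → Val m} (h : DomJ w) : IsLocal w := h.1

/-- The function `-w∥`. -/
def parScal (w : Jet m → Val m) (h : DomH w) : locRing m :=
  ⟨fun p => (DxInv (scalarCurr w) p : ImQ), IsLocal.clm ImQ.subtypeL h.2.1.spec.1⟩

/-- The function `-𝐖∥`. -/
def parEntry (w : Jet m → Val m) (h : DomH w) (i j : Fin m) : locRing m :=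
  ⟨fun p => -DxInv (matrixCurr w) p i j,
    (h.2.2.spec.1.clm ((ContinuousLinearMap.proj (R := ℝ) (φ := fun _ : Fin m => ℍ[ℝ]) j).comp
      (ContinuousLinearMap.proj (R := ℝ) (φ := fun _ : Fin m => Fin m → ℍ[ℝ]) i))).neg⟩

/-- The full matrix with even component given by `w`. -/
def kFull (w : Jet m → Val m) (h : DomH w) : LMat m :=
  kOf w h.isLocal + parMat (parScal w h) (parEntry w h)

theorem totalHom_parScal (w : Jet m → Val m) (h : DomH w) (p : Jet m) :
    (totalHom m (parScal w h)).1 p = (scalarCurr w p : ImQ) := by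
  refine (coe_Dx_imQ h.2.1.spec.1 p).symm.trans ?_
  rw [h.2.1.spec.2.1]

theorem totalHom_parEntry (w : Jet m → Val m) (h : DomH w) (i j : Fin m) (p : Jet m) :
    (totalHom m (parEntry w h i j)).1 p = -matrixCurr w p i j := by
  have hl := h.2.2.spec.1
  have hi : IsLocal (fun q => DxInv (matrixCurr w) q i) :=
    hl.clm (ContinuousLinearMap.proj (R := ℝ) (φ := fun _ : Fin m => Fin m → ℍ[ℝ]) i)
  have hij : IsLocal (fun q => DxInv (matrixCurr w) q i j) :=
    hi.clm (ContinuousLinearMap.proj (R := ℝ) (φ := fun _ : Fin m => ℍ[ℝ]) j)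
  rw [totalHom_apply]
  refine (congrFun (Dx_neg hij) p).trans ?_
  rw [← Dx_pi_apply hi, ← Dx_pi_apply hl, h.2.2.spec.2.1]

theorem star_parScal (w : Jet m → Val m) (h : DomH w) : star (parScal w h) = -parScal w h :=
  locRing_ext fun _ => star_imQ _

theorem star_parEntry (w : Jet m → Val m) (h : DomH w) (i j : Fin m) :
    star (parEntry w h i j) = -parEntry w h j i := by
  -- The total derivatives agree because the current is skew-Hermitian; the normalisation at the
  -- zero jet removes the constant.
  refine Subtype.ext (eq_of_Dx_eq (star (parEntry w h i j)).2 (-parEntry w h j i).2 ?_ ?_)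
  · funext p
    change (totalHom m (star (parEntry w h i j))).1 p = (totalHom m (-parEntry w h j i)).1 p
    rw [totalHom_star, map_neg, locRing_star_apply, locRing_neg_apply, totalHom_parEntry,
      totalHom_parEntry]
    simp [matrixCurr, commM]
  · have h0 (i j) : (parEntry w h i j).1 0 = 0 := by
      change -DxInv (matrixCurr w) 0 i j = 0
      rw [h.2.2.spec.2.2]; simp
    rw [locRing_star_apply, locRing_neg_apply, h0, h0]; simp

/-- The nonlocal terms -w∥ and -𝐖∥ are the commutant components that make the commutant part of the
covariant derivative vanish; what remains is ℋ. -/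
theorem nabla_kFull {w : Jet m → Val m} (h : DomH w) :
    ∃ hH : IsLocal (opH w), nabla (kFull w h) = kOf (opH w) hH := by
  have key := nabla_kMat (D := totalHom m) totalHom_star (star_scal _ (isLocal_uFun m))
    (star_scal w h.isLocal) (star_parScal w h) (U := vect _ (isLocal_uFun m))
    (Z := vect w h.isLocal) (star_parEntry w h)
    (locRing_ext fun p => by
      rw [totalHom_parScal]
      simp [scalarCurr, commQ, commV, herm, uFun])
    (fun i j => locRing_ext fun p => by
      rw [totalHom_parEntry]
      simp [matrixCurr, commM, uFun])
  refine ((exists_kOf fun p => ?_) fun p j => ?_).imp fun hH h2 => key.trans h2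
  · have h1 : (totalHom m (scal w h.isLocal)).1 p = (Dx (fun q => (w q).1) p : ImQ) :=
      (coe_Dx_imQ (h.isLocal.clm (ContinuousLinearMap.fst ℝ ImQ (QVec m))) p).symm
    have h2 : (parScal w h).1 p = (DxInv (scalarCurr w) p : ImQ) := rfl
    simp [opH, commQ, commV, herm, uFun, wPar, h1, h2]
    abel
  · have h1 : (totalHom m (vect w h.isLocal j)).1 p = Dx (fun q => (w q).2) p j :=
      (Dx_pi_apply (h.isLocal.clm (ContinuousLinearMap.snd ℝ ImQ (QVec m))) p j).symm
    have h2 : (parScal w h).1 p = (DxInv (scalarCurr w) p : ImQ) := rfl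
    have h3 (i) : (parEntry w h i j).1 p = -DxInv (matrixCurr w) p i j := rfl
    simp [opH, leftMul, vecMat, uFun, wPar, WPar, h1, h2, h3]

/-- The function `h∥` as a quaternion-valued function. -/
def hScal (h : Jet m → Val m) (hh : DomJ h) : locRing m :=
  ⟨fun p => (hPar h p : ℍ[ℝ]), hh.2.spec.1.clm (Algebra.linearMap ℝ ℍ[ℝ]).toContinuousLinearMap⟩

@[simp] theorem hScal_apply (h : Jet m → Val m) (hh : DomJ h) (p : Jet m) :
    (hScal h hh).1 p = (hPar h p : ℍ[ℝ]) := rfl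

/-- The full matrix with odd component given by `h`. -/
def mFull (h : Jet m → Val m) (hh : DomJ h) : LMat m :=
  mMat ((1 / 2 : ℝ) • scal h hh.isLocal) (vect h hh.isLocal) + rhoMat (hScal h hh)

theorem coe_realCurr {h : Jet m → Val m} (hh : IsLocal h) (p : Jet m) :
    ((realCurr h p : ℝ) : ℍ[ℝ]) = (-(scal _ (isLocal_uFun m) * ((1 / 2 : ℝ) • scal h hh) +
        ((1 / 2 : ℝ) • scal h hh) * scal _ (isLocal_uFun m)) +
      (1 / 2 : ℝ) • (∑ i, vect _ (isLocal_uFun m) i * star (vect h hh i) +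
        ∑ i, vect h hh i * star (vect _ (isLocal_uFun m) i))).1 p := by
  have h1 := coe_antiQ (p.2 0).1 (h p).1
  have h2 := coe_antiV (p.2 0).2 (h p).2
  simp only [herm] at h2
  have h3 : ((realCurr h p : ℝ) : ℍ[ℝ]) = (1 / 2 : ℝ) •
      (-((antiQ (p.2 0).1 (h p).1 : ℝ) : ℍ[ℝ]) + ((antiV (p.2 0).2 (h p).2 : ℝ) : ℍ[ℝ])) := by
    rw [realCurr, ← Quaternion.coe_neg, ← Quaternion.coe_add, Quaternion.smul_coe]
  rw [h3, h1, h2]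
  simp only [locRing_add_apply, locRing_neg_apply, locRing_mul_apply, locRing_smul_apply,
    locRing_sum_apply, locRing_star_apply, scal_apply, vect_apply, uFun, mul_smul_comm,
    smul_mul_assoc]
  module

theorem totalHom_hScal (h : Jet m → Val m) (hh : DomJ h) (p : Jet m) :
    (totalHom m (hScal h hh)).1 p = (realCurr h p : ℍ[ℝ]) := by
  refine (lineDeriv_clm (Algebra.linearMap ℝ ℍ[ℝ]).toContinuousLinearMap hh.2.spec.1 p _).trans ?_
  change ((Dx (DxInv (realCurr h)) p : ℝ) : ℍ[ℝ]) = _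
  rw [hh.2.spec.2.1]

theorem half_add_half (a : locRing m) : (1 / 2 : ℝ) • a + (1 / 2 : ℝ) • a = a := by
  module

theorem eMat_commutator_mFull (h : Jet m → Val m) (hh : DomJ h) :
    eMat * mFull h hh - mFull h hh * eMat = kOf h hh.isLocal := by
  have h1 := eMat_commutator_mMat ((1 / 2 : ℝ) • scal h hh.isLocal) (vect h hh.isLocal)
  have h2 := eMat_commutator_rhoMat (m := m) (hScal h hh)
  rw [mFull, mul_add, add_mul, add_sub_add_comm, h1, h2, add_zero, half_add_half]
  rfl

/-- Here h∥ is the coefficient of e that removes the component along e. Dividing by ad e halves the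
scalar slot, which already holds h/2, whence the quarter in front of D h. -/
theorem nabla_mFull {h : Jet m → Val m} (hh : DomJ h) :
    ∃ hJ : IsLocal (opJ h),
      nabla (mFull h hh) = eMat * kOf (opJ h) hJ - kOf (opJ h) hJ * eMat := by
  have hDh (p) : (totalHom m (scal h hh.isLocal)).1 p = (Dx (fun q => (h q).1) p : ImQ) :=
    (coe_Dx_imQ (hh.isLocal.clm (ContinuousLinearMap.fst ℝ ImQ (QVec m))) p).symm
  have hDv (p j) : (totalHom m (vect h hh.isLocal j)).1 p = Dx (fun q => (h q).2) p j :=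
    (Dx_pi_apply (hh.isLocal.clm (ContinuousLinearMap.snd ℝ ImQ (QVec m))) p j).symm
  have key := nabla_mMat (D := totalHom m) totalHom_star (star_scal _ (isLocal_uFun m))
    (s := (1 / 2 : ℝ) • scal h hh.isLocal) (ρ := hScal h hh)
    (by
      refine locRing_ext fun p => ?_
      simp [star_imQ])
    (U := vect _ (isLocal_uFun m)) (Z := vect h hh.isLocal)
    (locRing_ext fun p => by simp) (fun a => locRing_ext fun p => by
      simpa using Quaternion.coe_commutes (hPar h p) (a.1 p))
    (locRing_ext fun p => by
      rw [totalHom_hScal, coe_realCurr hh.isLocal])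
  let a : locRing m := (1 / 4 : ℝ) • totalHom m (scal h hh.isLocal) +
    (1 / 4 : ℝ) • (∑ i, vect _ (isLocal_uFun m) i * star (vect h hh.isLocal i) -
      ∑ i, vect h hh.isLocal i * star (vect _ (isLocal_uFun m) i)) +
    hScal h hh * scal _ (isLocal_uFun m)
  obtain ⟨hJ, hk⟩ := exists_kOf (f := opJ h) (a := a)
    (v := fun j => totalHom m (vect h hh.isLocal j) +
      (1 / 2 : ℝ) • scal h hh.isLocal * vect _ (isLocal_uFun m) j +
      scal _ (isLocal_uFun m) * vect h hh.isLocal j + hScal h hh * vect _ (isLocal_uFun m) j)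
    (fun p => by
      simp [a, opJ, commV, herm, uFun, hDh, Quaternion.coe_mul_eq_smul])
    (fun p j => by
      simp [opJ, leftMul, uFun, hDv, Quaternion.coe_mul_eq_smul])
  refine ⟨hJ, key.trans ?_⟩
  rw [← hk, eMat_commutator_kMat]
  congr 1
  simp only [a, totalHom_smul]
  module

end Operators
end
end QuatHierarchy

namespace QuatHierarchy
noncomputable section

/-! ### Skew-adjointness -/

section Skew

variable {m : ℕ}

theorem IsTotalDeriv.congr {f g : Jet m → ℝ} (hf : IsTotalDeriv f) (h : ∀ p, g p = f p) :
    IsTotalDeriv g := by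
  rwa [show g = f from funext h]

theorem reTrace_kOf_mul_parMat (w : Jet m → Val m) (hw : IsLocal w) (q : locRing m)
    (S : Fin m → Fin m → locRing m) : reTrace m (kOf w hw * parMat q S) = 0 :=
  reTrace_kMat_mul_parMat _ _ _ _

/-- The covariant derivatives are pure `kOf` matrices, trace-orthogonal to the commutant components,
so integration by parts for the full matrices reduces to the pairing. -/
theorem opH_skew {w v : Jet m → Val m} (hw : DomH w) (hv : DomH v) :
    IsTotalDeriv (fun p => pairing (opH w) v p + pairing w (opH v) p) := by
  obtain ⟨hHw, h1⟩ := nabla_kFull hw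
  obtain ⟨hHv, h2⟩ := nabla_kFull hv
  have h3 := isTotalDeriv_reTrace_nabla (kFull w hw) (kFull v hv)
  have h4 : reTrace m (kOf (opH w) hHw * kFull v hv) =
      reTrace m (kOf (opH w) hHw * kOf v hv.isLocal) := by
    rw [kFull, mul_add, map_add, reTrace_kOf_mul_parMat, add_zero]
  have h5 : reTrace m (kFull w hw * kOf (opH v) hHv) =
      reTrace m (kOf w hw.isLocal * kOf (opH v) hHv) := by
    rw [kFull, add_mul, map_add, reTrace_mul_comm (parMat _ _),
      reTrace_kOf_mul_parMat, add_zero]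
  rw [h1, h2, h4, h5] at h3
  refine (h3.const_smul (-1 / 2)).congr fun p => ?_
  rw [reTrace_kOf_mul, reTrace_kOf_mul, smul_eq_mul]
  ring

/-- The trace form is ad-invariant, so e moves from [e, 𝒥f] to the other factor, where [e, `mFull h
hh`] gives back h. -/
theorem opJ_skew {f h : Jet m → Val m} (hf : DomJ f) (hh : DomJ h) :
    IsTotalDeriv (fun p => pairing (opJ f) h p + pairing f (opJ h) p) := by
  obtain ⟨hJf, h1⟩ := nabla_mFull hf
  obtain ⟨hJh, h2⟩ := nabla_mFull hh
  have h3 := isTotalDeriv_reTrace_nabla (mFull f hf) (mFull h hh)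
  have e1 (X Y : LMat m) : reTrace m ((eMat * X - X * eMat) * Y) =
      -reTrace m (X * (eMat * Y - Y * eMat)) := by
    rw [sub_mul, mul_sub, map_sub, map_sub, mul_assoc, reTrace_mul_comm eMat]
    simp only [mul_assoc]
    abel
  rw [h1, h2] at h3
  have h4 (p) : reTrace m ((eMat * kOf (opJ f) hJf - kOf (opJ f) hJf * eMat) * mFull h hh) p =
      2 * pairing (opJ f) h p := by
    rw [e1, eMat_commutator_mFull, Pi.neg_apply, reTrace_kOf_mul]
    ring
  have h5 (p) : reTrace m (mFull f hf * (eMat * kOf (opJ h) hJh - kOf (opJ h) hJh * eMat)) p =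
      2 * pairing f (opJ h) p := by
    have := congrFun (e1 (mFull f hf) (kOf (opJ h) hJh)) p
    rw [eMat_commutator_mFull, Pi.neg_apply, reTrace_kOf_mul] at this
    linear_combination this
  refine (h3.const_smul (1 / 2)).congr fun p => ?_
  rw [h4, h5, smul_eq_mul]
  ring

theorem opR_adjoint {f g : Jet m → Val m} (hf : DomR f) (hg : DomRstar g) :
    EqFunctional (pairing (opR f) g) (pairing f (opRstar g)) := by
  have h1 := opH_skew hf.2 hg.1
  have h2 := opJ_skew hf.1 hg.2
  refine (h1.add (h2.const_smul (-1))).congr fun p => ?_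
  simp only [opR, opRstar, smul_eq_mul]
  ring

end Skew

/-! ### Local solutions and the natural domains -/

section Extraction

variable {m : ℕ}

/-- A commutator [e, Y] has opposite entries at the two distinguished diagonal places and a zero
block in the remaining indices. Adding those two entries, and reading that block, eliminates Y. -/
theorem commutator_kMat_currents {R : Type*} [Ring R] [StarRing R] [Algebra ℝ R] {D : R →+ R}
    {u w q : R} {U Z : Fin m → R} {S : Fin m → Fin m → R} {Y : Matrix (Idx m) (Idx m) R}
    (h : D.mapMatrix (kMat w Z + parMat q S) -
      (kMat u U * (kMat w Z + parMat q S) - (kMat w Z + parMat q S) * kMat u U) =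
      eMat * Y - Y * eMat) :
    D q = u * w - w * u - (1 / 2 : ℝ) • (∑ i, U i * star (Z i) - ∑ i, Z i * star (U i)) ∧
    ∀ i j, D (S i j) = -(star (U i) * Z j - star (Z i) * U j) := by
  have hc (i j) := congrFun (congrFun h i) j
  constructor
  · have h0 := hc none none
    have h1 := hc (some none) (some none)
    simp only [AddMonoidHom.mapMatrix_apply, Matrix.map_apply, Matrix.mul_apply,
      Matrix.add_apply, Matrix.sub_apply, Fintype.sum_option, kMat, parMat, eMat, map_add, map_neg,
      add_zero, zero_add, mul_zero, zero_mul, Finset.sum_const_zero, mul_add, one_mul, mul_one,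
      add_mul, mul_neg, neg_mul, Finset.sum_neg_distrib] at h0 h1
    have h2 : (2 : ℝ) • D q = (2 : ℝ) • (u * w - w * u) -
        (∑ i, U i * star (Z i) - ∑ i, Z i * star (U i)) := by
      rw [← sub_eq_zero, ← sub_eq_zero.2 (congrArg₂ (· + ·) h0 h1)]
      module
    calc D q = (1 / 2 : ℝ) • (2 : ℝ) • D q := by module
      _ = _ := by rw [h2]; module
  · intro i j
    have h1 := hc (some (some i)) (some (some j))
    simp only [AddMonoidHom.mapMatrix_apply, Matrix.map_apply, Matrix.mul_apply,
      Matrix.add_apply, Matrix.sub_apply, Fintype.sum_option, kMat, parMat, eMat,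
      add_zero, zero_add, mul_zero, zero_mul, Finset.sum_const_zero, neg_mul, sub_self] at h1
    rw [sub_eq_zero] at h1
    rw [h1]
    abel

/-- The entries (0, 1) and (1, 0) of [e, Y] are opposite, so their sum eliminates Y. -/
theorem commutator_mMat_currents {R : Type*} [Ring R] [StarRing R] [Algebra ℝ R] {D : R →+ R}
    {u s ρ : R} {U Z : Fin m → R} {Y : Matrix (Idx m) (Idx m) R} (hρc : ρ * u = u * ρ)
    (h : D.mapMatrix (mMat s Z + rhoMat ρ) -
      (kMat u U * (mMat s Z + rhoMat ρ) - (mMat s Z + rhoMat ρ) * kMat u U) =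
      eMat * Y - Y * eMat) :
    D ρ = -(u * s + s * u) +
      (1 / 2 : ℝ) • (∑ i, U i * star (Z i) + ∑ i, Z i * star (U i)) := by
  have h0 := congrFun (congrFun h none) (some none)
  have h1 := congrFun (congrFun h (some none)) none
  simp only [AddMonoidHom.mapMatrix_apply, Matrix.map_apply, Matrix.mul_apply,
    Matrix.add_apply, Matrix.sub_apply, Fintype.sum_option, kMat, mMat, rhoMat, eMat, map_add,
    map_neg, add_zero, zero_add, mul_zero, zero_mul, Finset.sum_const_zero, mul_add, one_mul,
    mul_one, add_mul, mul_neg, neg_mul, Finset.sum_neg_distrib, hρc] at h0 h1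
  have h2 : (2 : ℝ) • D ρ = (2 : ℝ) • -(u * s + s * u) +
      (∑ i, U i * star (Z i) + ∑ i, Z i * star (U i)) := by
    rw [← sub_eq_zero, ← sub_eq_zero.2 (congrArg₂ (· + ·) h0 h1)]
    module
  calc D ρ = (1 / 2 : ℝ) • (2 : ℝ) • D ρ := by module
    _ = _ := by rw [h2]; module

/-- This is how integrability is obtained: the commutant components of an already local matrix X are
primitives of the currents, and `h0` makes them the normalised ones. -/
theorem exists_eq_kFull {w : Jet m → Val m} (hw : IsLocal w) {X Y : LMat m}
    (h1 : sigMat * X * sigMat = X) (h2 : star X = -X) (h0 : ∀ i j, (X i j).1 0 = 0)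
    (h3 : eMat * X - X * eMat = eMat * kOf w hw - kOf w hw * eMat)
    (h4 : nabla X = eMat * Y - Y * eMat) : ∃ h : DomH w, X = kFull w h := by
  rw [kOf, eMat_commutator_kMat] at h3
  obtain ⟨q, S, rfl, hq, -⟩ := eq_kMat_add_parMat h1 h2 (star_scal w hw) h3
  obtain ⟨hDq, hDS⟩ := commutator_kMat_currents h4
  have hq0 : q.1 0 = 0 := by
    have e1 := h0 none none
    have e2 := h0 (some none) (some none)
    simp only [Matrix.add_apply, kMat, parMat, locRing_add_apply, locRing_neg_apply] at e1 e2
    refine eq_zero_of_neg_eq (neg_eq_of_add_eq_zero_left ?_)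
    calc q.1 0 + q.1 0 = (-(scal w hw).1 0 + q.1 0) + ((scal w hw).1 0 + q.1 0) := by abel
      _ = 0 := by rw [e1, e2, add_zero]
  have hqi (p) : ((imCLM (q.1 p) : ImQ) : ℍ[ℝ]) = q.1 p := by
    have hre : (q.1 p).re = 0 := by
      have := congrArg (fun f : locRing m => (f.1 p).re) hq
      simp only [locRing_star_apply, locRing_neg_apply, Quaternion.re_star,
        Quaternion.re_neg] at this
      linarith
    change (q.1 p).im = q.1 p
    ext <;> simp [hre]
  have hS0 (i j) : (S i j).1 0 = 0 := by
    simpa [kMat, parMat] using h0 (some (some i)) (some (some j))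
  have hql : IsLocal (fun p => imCLM (q.1 p)) := IsLocal.clm imCLM q.2
  have hqD : Dx (fun p => imCLM (q.1 p)) = scalarCurr w := by
    funext p
    refine Subtype.ext ?_
    rw [coe_Dx_imQ hql]
    simp only [hqi]
    refine (congrFun (congrArg Subtype.val hDq) p).trans ?_
    simp [scalarCurr, commQ, commV, herm, uFun]
  have hSl' (i j) : IsLocal (fun p => -(S i j).1 p) := IsLocal.neg (S i j).2
  have hSl : IsLocal (fun p i j => -(S i j).1 p) :=
    isLocal_pi (fun i => isLocal_pi (hSl' i))
  have hSD : Dx (fun p i j => -(S i j).1 p) = matrixCurr w := by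
    funext p i j
    rw [Dx_pi_apply hSl, Dx_pi_apply (isLocal_pi (hSl' i)), Dx_neg (S i j).2]
    refine (congrArg Neg.neg (congrFun (congrArg Subtype.val (hDS i j)) p)).trans ?_
    simp [matrixCurr, commM, uFun]
  have hdom : DomH w := ⟨hw, ⟨_, hql, hqD⟩, ⟨_, hSl, hSD⟩⟩
  refine ⟨hdom, ?_⟩
  rw [kFull]
  congr 2
  · refine locRing_ext fun p => ?_
    change _ = ((DxInv (scalarCurr w) p : ImQ) : ℍ[ℝ])
    rw [DxInv_eq hql hqD (by rw [hq0, map_zero]), hqi]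
  · funext i j
    refine locRing_ext fun p => ?_
    change _ = -DxInv (matrixCurr w) p i j
    rw [DxInv_eq hSl hSD (by funext i j; simp [hS0]), neg_neg]

theorem exists_eq_mFull {h : Jet m → Val m} (hh : IsLocal h) {X Y : LMat m}
    (h1 : sigMat * X * sigMat = -X) (h2 : star X = X) (h0 : ∀ i j, (X i j).1 0 = 0)
    (h3 : eMat * X - X * eMat = kOf h hh)
    (h4 : nabla X = eMat * Y - Y * eMat) : ∃ hd : DomJ h, X = mFull h hd := by
  have hs : star ((1 / 2 : ℝ) • scal h hh) = -((1 / 2 : ℝ) • scal h hh) :=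
    locRing_ext fun p => by simp [star_imQ]
  obtain ⟨ρ, rfl, hρ⟩ := eq_mMat_add_rhoMat h1 h2 hs (v := vect h hh)
    (by rw [h3, half_add_half]; rfl)
  have hρr (p) : (((ρ.1 p).re : ℝ) : ℍ[ℝ]) = ρ.1 p :=
    (Quaternion.star_eq_self.1 (congrFun (congrArg Subtype.val hρ) p)).symm
  have hDρ := commutator_mMat_currents (locRing_ext fun p => by
    rw [locRing_mul_apply, locRing_mul_apply, ← hρr]
    exact Quaternion.coe_commutes _ _) h4
  have hρ0 : (ρ.1 0).re = 0 := by
    have e1 := h0 none (some none)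
    have e2 := h0 (some none) none
    simp only [Matrix.add_apply, mMat, rhoMat, locRing_add_apply, locRing_neg_apply] at e1 e2
    have : ρ.1 0 = 0 := by
      refine eq_zero_of_neg_eq (neg_eq_of_add_eq_zero_left ?_)
      rw [← add_zero (0 : ℍ[ℝ])]
      nth_rewrite 1 [← e1]
      rw [← e2]
      abel
    rw [this, Quaternion.re_zero]
  have hρl : IsLocal (fun p => (ρ.1 p).re) := IsLocal.clm reCLM ρ.2
  have hρD : Dx (fun p => (ρ.1 p).re) = realCurr h := by
    funext p
    refine (lineDeriv_clm reCLM ρ.2 p _).trans ?_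
    have h5 : lineDeriv ℝ ρ.1 p (1, fun k => p.2 (k + 1)) = _ :=
      congrFun (congrArg Subtype.val hDρ) p
    rw [h5, reCLM_apply, ← coe_realCurr hh, Quaternion.re_coe]
  have hdom : DomJ h := ⟨hh, ⟨_, hρl, hρD⟩⟩
  refine ⟨hdom, ?_⟩
  rw [mFull]
  congr 2
  refine locRing_ext fun p => ?_
  rw [hScal_apply, hPar, DxInv_eq hρl hρD hρ0, hρr]

end Extraction
end
end QuatHierarchy

namespace QuatHierarchy
noncomputable section

/-! ### The hierarchy -/

/-! ### Involutions and the restriction to the zero jet. -/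

section Symmetries

variable {m : ℕ}

/-- Conjugation with the signature matrix. -/
def sigConj (m : ℕ) : LMat m →+ LMat m where
  toFun X := sigMat * X * sigMat
  map_zero' := by simp
  map_add' X Y := by rw [mul_add, add_mul]

theorem sigConj_apply (X : LMat m) : sigConj m X = sigMat * X * sigMat := rfl

theorem sigConj_mul (X Y : LMat m) : sigConj m (X * Y) = sigConj m X * sigConj m Y := by
  simp only [sigConj_apply]
  calc sigMat * (X * Y) * sigMat = sigMat * X * 1 * (Y * sigMat) := by
        simp only [mul_one, mul_assoc]
    _ = _ := by rw [← sigMat_mul_self]; simp only [mul_assoc]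

theorem totalMat_sigMat : totalMat m sigMat = 0 := by
  have h1 : totalHom m 1 = 0 := Subtype.ext (Dx_const 1)
  apply matrix_ext_idx <;> simp [sigMat, totalMat, h1, Matrix.diagonal_apply, apply_ite]

theorem sigConj_totalMat (X : LMat m) : sigConj m (totalMat m X) = totalMat m (sigConj m X) := by
  simp only [sigConj_apply, isDeriv_totalMat _ _, totalMat_sigMat]
  simp

/-- Conjugate transposition. -/
def starHom (m : ℕ) : LMat m →+ LMat m where
  toFun X := star X
  map_zero' := star_zero _
  map_add' := star_add

theorem starHom_totalMat (X : LMat m) : starHom m (totalMat m X) = totalMat m (starHom m X) :=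
  Matrix.ext fun i j => (totalHom_star (X j i)).symm

/-- Restriction of a function to the jets of the zero function. -/
def evalHom (m : ℕ) : locRing m →+* locRing m where
  toFun f := ⟨fun p => f.1 (p.1, 0), by
    obtain ⟨k, F, hF, hf⟩ := isLocal_iff.1 f.2
    refine ⟨0, fun q => F (q.1, 0), hF.comp (by fun_prop), fun p => hf _⟩⟩
  map_zero' := rfl
  map_one' := rfl
  map_add' _ _ := rfl
  map_mul' _ _ := rfl

theorem evalHom_apply (f : locRing m) (p : Jet m) : (evalHom m f).1 p = f.1 (p.1, 0) := rfl

/-- At the jets of the zero function the total derivative reduces to ∂/∂x. -/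
theorem evalHom_totalHom (f : locRing m) :
    evalHom m (totalHom m f) = totalHom m (evalHom m f) := by
  refine locRing_ext fun p => ?_
  rw [evalHom_apply, totalHom_apply, totalHom_apply]
  simp only [Dx, lineDeriv]
  congr 1
  funext t
  refine congrArg f.1 (Prod.ext rfl ?_)
  funext k
  simp

/-- Restriction of matrices to the jets of the zero function. -/
def evalMat (m : ℕ) : LMat m →+ LMat m := (evalHom m).mapMatrix.toAddMonoidHom

theorem evalMat_apply (X : LMat m) (i j : Idx m) : evalMat m X i j = evalHom m (X i j) := rfl

theorem evalMat_mul (X Y : LMat m) : evalMat m (X * Y) = evalMat m X * evalMat m Y :=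
  (evalHom m).mapMatrix.map_mul X Y

theorem evalMat_eMat : evalMat m eMat = eMat := by
  apply matrix_ext_idx <;> simp [evalMat_apply, eMat]

theorem evalMat_uMat : evalMat m (uMat m) = 0 := by
  have h1 : evalHom m (scal _ (isLocal_uFun m)) = 0 := rfl
  have h2 (j) : evalHom m (vect _ (isLocal_uFun m) j) = 0 := rfl
  have h3 (j) : evalHom m (star (vect _ (isLocal_uFun m) j)) = 0 :=
    locRing_ext fun p => star_zero ℍ[ℝ]
  apply matrix_ext_idx <;> simp [evalMat_apply, uMat, kOf, kMat, h1, h2, h3]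

end Symmetries

/-! ### Identification of the Lax coefficients, commuting flows and Hamiltonians. -/

section Hierarchy

variable {m : ℕ}

theorem opH_uFun (m : ℕ) : opH (uFun m) = uxFun m := by
  have h1 : scalarCurr (uFun m) = fun _ => 0 := by
    funext p
    refine Subtype.ext ?_
    simp [scalarCurr, commQ, commV, uFun]
  have h2 : matrixCurr (uFun m) = fun _ => 0 := by
    funext p i j
    simp [matrixCurr, commM, uFun]
  have h3 : DxInv (scalarCurr (uFun m)) = fun _ => 0 := by
    rw [h1]; exact DxInv_eq (isLocal_const 0) (Dx_const 0) rfl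
  have h4 : DxInv (matrixCurr (uFun m)) = fun _ => 0 := by
    rw [h2]; exact DxInv_eq (isLocal_const 0) (Dx_const 0) rfl
  funext p
  have h5 : Dx (fun q : Jet m => (q.2 0).1) p = (p.2 1).1 :=
    (lineDeriv_clm (ContinuousLinearMap.fst ℝ ImQ (QVec m)) (isLocal_uFun m) p _).trans
      (congrArg Prod.fst (lineDeriv_coord 0 p _))
  have h6 : Dx (fun q : Jet m => (q.2 0).2) p = (p.2 1).2 :=
    (lineDeriv_clm (ContinuousLinearMap.snd ℝ ImQ (QVec m)) (isLocal_uFun m) p _).trans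
      (congrArg Prod.snd (lineDeriv_coord 0 p _))
  refine Prod.ext (Subtype.ext ?_) (funext fun j => ?_)
  · simp [opH, h5, wPar, h3, uxFun, commQ, commV, uFun]
  · simp [opH, h6, wPar, WPar, h3, h4, uxFun, leftMul, vecMat, uFun]

/-- (ℋ𝒥)^l ℋ = ℋ(𝒥ℋ)^l, started from ℋ applied to (u, 𝐮). -/
theorem hSeq_eq (m l : ℕ) : hSeq m l = opH (wSeq m l) := by
  induction l with
  | zero => exact (opH_uFun m).symm
  | succ l ih =>
    rw [hSeq, wSeq, Function.iterate_succ_apply', Function.iterate_succ_apply', ← hSeq, ← wSeq, ih]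
    rfl

theorem wSeq_succ (m l : ℕ) : wSeq m (l + 1) = opJ (hSeq m l) := by
  rw [hSeq_eq, wSeq, Function.iterate_succ_apply', ← wSeq]
  rfl

theorem pairing_uFun (h : Jet m → Val m) : pairing (uFun m) h = realCurr h := by
  funext p
  have h1 : (herm (h p).2 (p.2 0).2).re = (herm (p.2 0).2 (h p).2).re := by
    rw [← star_herm, Quaternion.re_star]
  simp only [pairing, rePair, realCurr, antiQ, antiV, uFun, star_imQ, Quaternion.re_add, h1,
    mul_neg, Quaternion.re_neg, re_mul_comm ((h p).1 : ℍ[ℝ])]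
  ring

/-- Signature conjugation and conjugate transposition give each coefficient its parity and shape,
and restriction to the zero jet gives its normalisation. Each coefficient equation then determines
the next term and also proves that the inverse total derivatives in it exist. -/
theorem exists_hierarchy (m : ℕ) : ∃ V, IsLaxSolution (totalMat m) eMat (uMat m) V ∧
    ∀ l, (∃ hw : DomH (wSeq m l), PowerSeries.coeff (2 * l + 1) V = kFull _ hw) ∧
      ∃ hh : DomJ (hSeq m l), PowerSeries.coeff (2 * l + 2) V = mFull _ hh := by
  obtain ⟨V, hV⟩ := exists_laxSolution (isDeriv_totalMat (m := m)) (uMat m) eMat_cube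
  have hsig (n : ℕ) := hV.map_coeff_of_mul eMat_cube (φ := sigConj m) sigConj_mul sigConj_totalMat
    sigMat_conj_eMat (sigMat_conj_kMat _ _) n
  have hstar (n : ℕ) := hV.map_coeff_of_anti eMat_cube (φ := starHom m) star_mul starHom_totalMat
    star_eMat (star_kMat (star_scal _ _) _) n
  have hzero (n : ℕ) (i j : Idx m) : (PowerSeries.coeff (n + 1) V i j).1 0 = 0 := by
    have h1 := hV.map_coeff_succ_eq_zero eMat_cube (alongHom_eMat _ _) (φ := evalMat m)
      evalMat_mul (fun X => Matrix.ext fun i j => evalHom_totalHom (X i j)) evalMat_eMat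
      evalMat_uMat n
    exact congrFun (congrArg Subtype.val (congrFun (congrFun h1 i) j)) 0
  have hodd (l : ℕ) {w : Jet m → Val m} (hw : IsLocal w)
      (h : eMat * PowerSeries.coeff (2 * l + 1) V - PowerSeries.coeff (2 * l + 1) V * eMat =
        eMat * kOf w hw - kOf w hw * eMat) :
      ∃ hd : DomH w, PowerSeries.coeff (2 * l + 1) V = kFull w hd := by
    refine exists_eq_kFull hw ?_ ?_ (hzero _) h (hV.coeff_succ _)
    · have := hsig (2 * l + 1)
      rw [(odd_two_mul_add_one l).neg_one_pow, neg_one_smul, neg_inj] at this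
      exact this
    · have := hstar (2 * l + 1)
      rw [(odd_two_mul_add_one l).neg_one_pow, neg_one_smul, neg_eq_iff_eq_neg] at this
      exact this
  have heven (l : ℕ) {h : Jet m → Val m} (hh : IsLocal h)
      (he : eMat * PowerSeries.coeff (2 * l + 2) V - PowerSeries.coeff (2 * l + 2) V * eMat =
        kOf h hh) :
      ∃ hd : DomJ h, PowerSeries.coeff (2 * l + 2) V = mFull h hd := by
    have hev : Even (2 * l + 2) := ⟨l + 1, by ring⟩
    refine exists_eq_mFull hh ?_ ?_ (hzero _) he (hV.coeff_succ _)
    · have := hsig (2 * l + 2)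
      rw [hev.neg_one_pow, one_smul] at this
      exact this
    · have := hstar (2 * l + 2)
      rw [hev.neg_one_pow, one_smul] at this
      exact this
  have hboth (l : ℕ) (hw : ∃ hd : DomH (wSeq m l), PowerSeries.coeff (2 * l + 1) V = kFull _ hd) :
      ∃ hh : DomJ (hSeq m l), PowerSeries.coeff (2 * l + 2) V = mFull _ hh := by
    obtain ⟨hd, hK⟩ := hw
    obtain ⟨hH, hn⟩ := nabla_kFull hd
    rw [hSeq_eq]
    refine heven l hH ?_
    rw [← hn, ← hK]
    exact (hV.coeff_succ _).symm
  refine ⟨V, hV, fun l => ?_⟩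
  induction l with
  | zero =>
    have h : ∃ hd : DomH (wSeq m 0), PowerSeries.coeff (2 * 0 + 1) V = kFull _ hd := by
      refine hodd 0 (isLocal_uFun m) ?_
      -- As D e = 0, the lowest equation reads [e, V₁] = [e, u].
      have h1 := hV.coeff_succ 0
      have h2 : totalMat m eMat = 0 := alongHom_eMat _ _
      rw [hV.coeff_zero, h2, zero_sub, neg_sub] at h1
      exact h1.symm
    exact ⟨h, hboth 0 h⟩
  | succ l ih =>
    obtain ⟨hh, hM⟩ := ih.2
    obtain ⟨hJ, hn⟩ := nabla_mFull hh
    have h : ∃ hd : DomH (wSeq m (l + 1)), PowerSeries.coeff (2 * (l + 1) + 1) V = kFull _ hd := by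
      rw [wSeq_succ]
      refine hodd (l + 1) hJ ?_
      rw [← hn, ← hM]
      exact (hV.coeff_succ (2 * l + 2)).symm
    exact ⟨h, hboth (l + 1) h⟩

theorem domH_wSeq (m l : ℕ) : DomH (wSeq m l) := by
  obtain ⟨V, -, h⟩ := exists_hierarchy m
  exact (h l).1.1

theorem domJ_hSeq (m l : ℕ) : DomJ (hSeq m l) := by
  obtain ⟨V, -, h⟩ := exists_hierarchy m
  exact (h l).2.1

theorem domR_hSeq (m l : ℕ) : DomR (hSeq m l) :=
  ⟨domJ_hSeq m l, by rw [← wSeq_succ]; exact domH_wSeq m (l + 1)⟩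

theorem domRstar_wSeq (m l : ℕ) : DomRstar (wSeq m l) :=
  ⟨domH_wSeq m l, by rw [← hSeq_eq]; exact domJ_hSeq m l⟩

/-- The l-th flow is δu = [e, V_(2l+2)]. The mixed derivatives of these coefficients agree, and
bracketing with e transfers the equality to the characteristics. -/
theorem prolong_hSeq_comm (m k l : ℕ) :
    prolong (hSeq m k) (hSeq m l) = prolong (hSeq m l) (hSeq m k) := by
  obtain ⟨V, hV, h⟩ := exists_hierarchy m
  have hl (l : ℕ) : IsLocal (hSeq m l) := (domJ_hSeq m l).isLocal
  have hc (l : ℕ) : eMat * PowerSeries.coeff (2 * l + 2) V -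
      PowerSeries.coeff (2 * l + 2) V * eMat = kOf (hSeq m l) (hl l) := by
    obtain ⟨hh, hM⟩ := (h l).2
    rw [hM, eMat_commutator_mFull]
  have he (l : ℕ) : prolongMat (hSeq m l) (hl l) eMat = 0 := alongHom_eMat _ _
  have key := hV.deriv_coeff_comm eMat_cube isDeriv_totalMat (isDeriv_prolongMat _ (hl k))
    (isDeriv_prolongMat _ (hl l)) (totalMat_prolongMat _ (hl k)) (totalMat_prolongMat _ (hl l))
    (he k) (he l) (2 * k + 1) (2 * l + 1)
    ((prolongMat_uMat _ _).trans (hc k).symm) ((prolongMat_uMat _ _).trans (hc l).symm)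
  have hp (k l : ℕ) : prolongMat (hSeq m k) (hl k) (kOf (hSeq m l) (hl l)) =
      eMat * prolongMat (hSeq m k) (hl k) (PowerSeries.coeff (2 * l + 2) V) -
        prolongMat (hSeq m k) (hl k) (PowerSeries.coeff (2 * l + 2) V) * eMat := by
    rw [← hc, map_sub, isDeriv_prolongMat _ _ _ _, isDeriv_prolongMat _ _ _ _, he]
    simp
  have h1 : prolongMat (hSeq m k) (hl k) (kOf (hSeq m l) (hl l)) =
      prolongMat (hSeq m l) (hl l) (kOf (hSeq m k) (hl k)) := by
    rw [hp, hp, key]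
  rw [prolongMat, prolongMat, prolongHom, prolongHom, alongHom_kOf, alongHom_kOf] at h1
  exact eq_of_kOf_eq h1

theorem Ham_eq (m l : ℕ) : Ham m l = fun p => 1 / (1 + 2 * (l : ℝ)) * hPar (hSeq m l) p := by
  funext p
  rw [Ham, pairing_uFun, hPar]

theorem isLocal_hPar (m l : ℕ) : IsLocal (hPar (hSeq m l)) := (domJ_hSeq m l).2.spec.1

theorem isLocal_Ham (m l : ℕ) : IsLocal (Ham m l) := by
  rw [Ham_eq]
  exact (isLocal_hPar m l).const_smul _

/-- In the trace identity with n = 2l + 1, tr(V_(n+1) e) is 2h∥ and tr(V_n δu) is -2 times the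
pairing of X with w_(l); dividing by 2n gives the claim. -/
theorem isVarDeriv_Ham (m l : ℕ) : IsVarDeriv (Ham m l) (wSeq m l) := by
  refine ⟨(domH_wSeq m l).isLocal, fun X hX => ?_⟩
  obtain ⟨V, hV, h⟩ := exists_hierarchy m
  obtain ⟨⟨hw, hK⟩, hh, hM⟩ := h l
  have he : prolongMat X hX eMat = 0 := alongHom_eMat _ _
  obtain ⟨g, hg⟩ := hV.trace_identity (t := reTrace m) reTrace_mul_comm isDeriv_totalMat
    (isDeriv_prolongMat X hX) (totalMat_prolongMat X hX) he (2 * l + 1)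
  have h1 : prolongMat X hX (PowerSeries.coeff (2 * l + 1 + 1) V) * eMat =
      prolongMat X hX (mFull _ hh * eMat) := by
    rw [isDeriv_prolongMat X hX _ _, he, mul_zero, add_zero, ← hM]
  have h2 : reTrace m (mFull _ hh * eMat) = fun p => 2 * hPar (hSeq m l) p := by
    funext p
    rw [mFull, add_mul, map_add, reTrace_mMat_mul_eMat, zero_add, reTrace_rhoMat_mul_eMat,
      hScal_apply, Quaternion.re_coe]
  have h3 : reTrace m (prolongMat X hX (mFull _ hh * eMat)) =
      fun p => 2 * prolong X (hPar (hSeq m l)) p := by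
    rw [prolongMat, prolongHom, ← along_reTrace, h2]
    funext p
    exact lineDeriv_clm ((2 : ℝ) • ContinuousLinearMap.id ℝ ℝ) (isLocal_hPar m l) p _
  have h4 : reTrace m (kFull _ hw * kOf X hX) = fun p => -2 * pairing X (wSeq m l) p := by
    funext p
    rw [kFull, add_mul, map_add, reTrace_mul_comm (parMat _ _), reTrace_kOf_mul_parMat, add_zero,
      reTrace_kOf_mul, pairing_comm]
  rw [h1, h3, hK, prolongMat_uMat, h4] at hg
  have h5 : prolong X (Ham m l) =
      fun p => 1 / (1 + 2 * (l : ℝ)) * prolong X (hPar (hSeq m l)) p := by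
    rw [Ham_eq]
    funext p
    exact lineDeriv_clm ((1 / (1 + 2 * (l : ℝ))) • ContinuousLinearMap.id ℝ ℝ)
      (isLocal_hPar m l) p _
  have h6 := isTotalDeriv_reTrace g
  rw [← hg] at h6
  refine (h6.const_smul (1 / (2 * (1 + 2 * (l : ℝ))))).congr fun p => ?_
  have h7 : (1 + 2 * (l : ℝ)) ≠ 0 := by positivity
  rw [h5]
  rw [Pi.add_apply, Pi.smul_apply, nsmul_eq_mul, smul_eq_mul]
  push_cast
  field_simp
  ring

theorem varDeriv_Ham (m l : ℕ) : varDeriv (Ham m l) = wSeq m l := (isVarDeriv_Ham m l).varDeriv_eq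

/-- Shifting an application of the recursion operator from one covector field to the other. -/
theorem pairing_wSeq_shift (m k l : ℕ) :
    EqFunctional (pairing (wSeq m k) (hSeq m (l + 1))) (pairing (wSeq m (k + 1)) (hSeq m l)) := by
  have h := opR_adjoint (domR_hSeq m l) (domRstar_wSeq m k)
  have h1 : opR (hSeq m l) = hSeq m (l + 1) := (Function.iterate_succ_apply' _ _ _).symm
  have h2 : opRstar (wSeq m k) = wSeq m (k + 1) := (Function.iterate_succ_apply' _ _ _).symm
  rw [h1, h2, pairing_comm, pairing_comm (hSeq m l)] at h
  exact h

theorem pairing_wSeq_skew (m k l : ℕ) :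
    EqFunctional (pairing (wSeq m k) (hSeq m l)) (fun p => -pairing (wSeq m l) (hSeq m k) p) := by
  have h := opH_skew (domH_wSeq m k) (domH_wSeq m l)
  rw [← hSeq_eq, ← hSeq_eq] at h
  refine h.congr fun p => ?_
  rw [pairing_comm (hSeq m k)]
  ring

/-- Shifting j recursion operators across turns ⟨w_(k), h_(k+j)⟩ into ⟨w_(k+j), h_(k)⟩, and
skew-adjointness of ℋ turns this into minus the original. Hence twice the density is a total
derivative. -/
theorem pairing_wSeq_hSeq (m k l : ℕ) :
    EqFunctional (pairing (wSeq m k) (hSeq m l)) (fun _ => 0) := by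
  have hshift (k l j : ℕ) : EqFunctional (pairing (wSeq m k) (hSeq m (l + j)))
      (pairing (wSeq m (k + j)) (hSeq m l)) := by
    induction j generalizing k with
    | zero => exact EqFunctional.refl _
    | succ j ih =>
      have h1 := pairing_wSeq_shift m k (l + j)
      have h2 := ih (k + 1)
      rw [show k + 1 + j = k + (j + 1) by ring] at h2
      exact h1.trans h2
  have hmain (k j : ℕ) : EqFunctional (pairing (wSeq m k) (hSeq m (k + j))) (fun _ => 0) := by
    have h1 := (hshift k k j).trans (pairing_wSeq_skew m (k + j) k)
    refine (h1.const_smul (1 / 2)).congr fun p => ?_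
    simp only [smul_eq_mul]
    ring
  rcases le_total k l with hkl | hkl
  · obtain ⟨j, rfl⟩ := Nat.exists_eq_add_of_le hkl
    exact hmain k j
  · obtain ⟨j, rfl⟩ := Nat.exists_eq_add_of_le hkl
    refine (pairing_wSeq_skew m (l + j) l).trans ?_
    simpa using (hmain l j).neg

end Hierarchy
end
end QuatHierarchy

open QuatHierarchy in
theorem mainTheorem2 (m : ℕ) :
    -- `ℛ*` is the formal adjoint of `ℛ`
    (∀ f g : Jet m → Val m, DomR f → DomRstar g →
      EqFunctional (pairing (opR f) g) (pairing f (opRstar g))) ∧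
    -- both hierarchies and the Hamiltonians are well defined on the jet space
    (∀ l : ℕ, DomR (hSeq m l) ∧ DomRstar (wSeq m l) ∧
      IsTotalDeriv (pairing (uFun m) (hSeq m l)) ∧ IsLocal (Ham m l)) ∧
    -- the vector fields commute
    (∀ k l : ℕ, prolong (hSeq m k) (hSeq m l) = prolong (hSeq m l) (hSeq m k)) ∧
    -- they are Hamiltonian with Hamiltonians `Ham m l`
    (∀ (l : ℕ) (G : Jet m → ℝ), IsLocal G →
      IsVarDeriv G (varDeriv G) ∧
      EqFunctional (prolong (hSeq m l) G) (poisson G (Ham m l))) ∧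
    -- the other expressions for the Hamiltonians
    (∀ (l : ℕ) (p : Jet m),
      Ham m l p = 1 / (2 + 4 * (l : ℝ)) *
        DxInv (fun q => -antiQ (q.2 0).1 (hSeq m l q).1 + antiV (q.2 0).2 (hSeq m l q).2) p ∧
      Ham m l p = 1 / (1 + 2 * (l : ℝ)) * hPar (hSeq m l) p) ∧
    -- the variational derivatives of the Hamiltonians
    (∀ l : ℕ, IsVarDeriv (Ham m l) (wSeq m l) ∧ varDeriv (Ham m l) = wSeq m l) ∧
    -- involutivity
    (∀ k l : ℕ, EqFunctional (poisson (Ham m k) (Ham m l)) (fun _ => 0) ∧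
      EqFunctional (pairing (wSeq m k) (opH (wSeq m l))) (fun _ => 0)) ∧
    -- duality of covector fields and Hamiltonian vector fields
    (∀ (l : ℕ) (X : Jet m → Val m), IsLocal X →
      EqFunctional (contract (wSeq m (l + 1)) X) (symp X (hSeq m l))) := by
  refine ⟨fun f g hf hg => opR_adjoint hf hg, fun l => ⟨domR_hSeq m l, domRstar_wSeq m l, ?_,
    isLocal_Ham m l⟩, prolong_hSeq_comm m, fun l G hG => ⟨isVarDeriv_varDeriv hG, ?_⟩,
    fun l p => ⟨?_, congrFun (Ham_eq m l) p⟩, fun l => ⟨isVarDeriv_Ham m l, varDeriv_Ham m l⟩,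
    fun k l => ?_, fun l X _ => ?_⟩
  · rw [pairing_uFun]
    exact (domJ_hSeq m l).2
  -- Since ℋ w_(l) = h_(l), the bracket is the pairing of δ𝔊 with the characteristic of X_(l), which
  -- is the defining property of δ𝔊.
  · rw [poisson, varDeriv_Ham, ← hSeq_eq, pairing_comm]
    exact (isVarDeriv_varDeriv hG).2 _ (domJ_hSeq m l).isLocal
  · have h1 : (fun q : Jet m => -antiQ (q.2 0).1 (hSeq m l q).1 +
        antiV (q.2 0).2 (hSeq m l q).2) = fun q => (2 : ℝ) • realCurr (hSeq m l) q := by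
      funext q
      rw [realCurr, smul_eq_mul]
      ring
    rw [h1, DxInv_const_smul 2 (domJ_hSeq m l).2, Ham_eq, hPar]
    simp only [smul_eq_mul]
    have h7 : (1 + 2 * (l : ℝ)) ≠ 0 := by positivity
    have h8 : (2 + 4 * (l : ℝ)) ≠ 0 := by positivity
    field_simp
    ring
  · rw [poisson, varDeriv_Ham, varDeriv_Ham, ← hSeq_eq]
    exact ⟨pairing_wSeq_hSeq m k l, pairing_wSeq_hSeq m k l⟩
  · rw [contract, symp, wSeq_succ]
    exact EqFunctional.refl _
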